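/- Let $H=H_0\supset H_1\supset H_2\supset\cdots$ be real Hilbert spaces with norms $|\cdot|_0\le|\cdot|_1\le\cdots$, let $\mathcal N=\operatorname{proj\,lim}H_p$ be dense in every $H_p$, and suppose that for every $p$ there is $p'>p$ with $H_{p'}\hookrightarrow H_p$ Hilbert–Schmidt, so that $\mathcal N\subset H\subset\mathcal N'$ is a nuclear Gel'fand triple. Write $|\cdot|_{-p}$ for the norm of $H_{-p}=H_p'$, and use the same notation for the norms on complexifications and tensor powers; $\langle\cdot|\cdot\rangle$ is the bilinear pairing that extends the inner product of $H$, and $\mathcal N_{\mathbb C}\subset\mathcal N_{\mathbb C}'$ through it. Let $\mathcal N_{\mathbb C}^{\hat\otimes n}$ be the symmetric tensor power, that is the projective limit of $H_{p,\mathbb C}^{\hat\otimes n}$, and $\mathcal P(\mathcal N')$ the space of continuous polynomials $\varphi(x)=\sum_{n\le N}\langle x^{\otimes n}|\varphi_n\rangle$, $\varphi_n\in\mathcal N_{\mathbb C}^{\hat\otimes n}$. Let $\mu,\nu$ be measures on the cylinder $\sigma$-algebra of $\mathcal N'$ that have an analytic Laplace transform (for $\xi$ in a $0$-neighborhood of $\mathcal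 N_{\mathbb C}$ the function $e^{\langle\cdot|\xi\rangle}$ is integrable and $\xi\mapsto\int e^{\langle x|\xi\rangle}d\mu(x)$ is holomorphic) and are non-degenerate (a continuous polynomial that vanishes almost everywhere is identically $0$). Put $e_\mu(\xi;x)=e^{\langle x|\xi\rangle}/\int e^{\langle y|\xi\rangle}d\mu(y)$, and let $P_{n,\mu}(x)$ be the kernel with $\langle P_{n,\mu}(x)|\xi^{\otimes n}\rangle=d^ne_\mu(0;x)\xi^n$. Let $(H_{p,q,\mu})$ be the completion of $\mathcal P(\mathcal N')$ in the norm $$\|\varphi\|_{p,q,\mu}^2=\sum_n (n!)^2\,2^{qn}\,|a_n|_p^2,\qquad \varphi=\sum_n\langle P_{n,\mu}(\cdot)|a_n\rangle,$$ and let $(\mathcal N)^1=\operatorname{proj\,lim}_{p,q\in\mathbb N}(H_{p,q,\mu})$ (this space does not depend on $\mu$). For $\zeta\in\mathcal N_{\mathbb C}'$ let $D(\zeta^{\otimes n})$ be the differential operator on $\mathcal P(\mathcal N')$ with $D(\zeta^{\otimes n})\langle x^{\otimes m}|\varphi_m\rangle=\frac{m!}{(m-n)!}\langle x^{\otimes(m-n)}\hat\otimes\zeta^{\otimes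 n}|\varphi_m\rangle$ for $m\ge n$ and $0$ for $m<n$, and let $\rho_\mu(\zeta)$ be the generalized function $$\langle\!\langle\rho_\mu(\zeta)|\varphi\rangle\!\rangle_\mu=\sum_n\frac{(-1)^n}{n!}\int_{\mathcal N'}D(\zeta^{\otimes n})\varphi\,d\mu ,\qquad \varphi\in\mathcal P(\mathcal N'),$$ which for $\zeta\in\mathcal N_{\mathbb C}$ extends continuously to every $(H_{p,q,\mu})$. Let $B:(\mathcal N)^1\to(\mathcal N)^1$ be a continuous linear operator. Its local $CS_{\mu\nu}$-symbol is $$\check B_{\mu\nu}(\xi,\eta)=\langle\!\langle\rho_\mu(-\xi)\,|\,B\,e_\nu(\eta;\cdot)\rangle\!\rangle_\mu ,$$ where $B$ is extended to a continuous operator $(H_{p,q,\nu})\to(H_{p',q',\mu})$ for some $p,q,p',q'\in\mathbb N$ with $|\eta|_p^2<2^{-q-1}$, and $e_\nu(\eta;\cdot)=\sum_n\frac1{n!}\langle P_{n,\nu}(\cdot)|\eta^{\otimes n}\rangle\in(H_{p,q,\nu})$. Theorem. For every integer $p_o\ge0$ and every $\varepsilon>0$ there are $C>0$ and an open $0$-neighborhood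 $U\subset\mathcal N_{\mathbb C}$ such that $\check B_{\mu\nu}$ is well defined on the cylinder $\mathcal N_{\mathbb C}\times U$ (such an extension of $B$ exists and the value does not depend on its choice), $\check B_{\mu\nu}$ is holomorphic on $\mathcal N_{\mathbb C}\times U$ (continuous, and analytic along every complex line), and $$|\check B_{\mu\nu}(\xi,\eta)|\le C\,e^{\varepsilon|\xi|_{-p_o}},\qquad \xi\in\mathcal N_{\mathbb C},\ \eta\in U .$$ -/

import Mathlib

open MeasureTheory Topology
open scoped DirectSum

universe u

noncomputable section

namespace AppellCS

/-! ### Complexification of a real vector space -/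

/-- The complexification `E_ℂ = E ⊕ iE`; the pair `(a, b)` stands for `a + i b`. -/
def Cplx (E : Type u) : Type u := E × E

namespace Cplx

variable {E : Type u}

/-- Real part. -/
def re (z : Cplx E) : E := z.1

/-- Imaginary part. -/
def im (z : Cplx E) : E := z.2

instance [AddCommGroup E] : AddCommGroup (Cplx E) := inferInstanceAs (AddCommGroup (E × E))

instance [TopologicalSpace E] : TopologicalSpace (Cplx E) :=
  inferInstanceAs (TopologicalSpace (E × E))

/-- `(s + i t) (a + i b) = (s a - t b) + i (s b + t a)`. -/
instance [AddCommGroup E] [Module ℝ E] : Module ℂ (Cplx E) where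
  smul c z := (c.re • z.1 - c.im • z.2, c.re • z.2 + c.im • z.1)
  one_smul z := by
    change ((1 : ℂ).re • z.1 - (1 : ℂ).im • z.2, (1 : ℂ).re • z.2 + (1 : ℂ).im • z.1) = z
    simp
    rfl
  mul_smul c d z := by
    refine Prod.ext ?_ ?_
    · change (c * d).re • z.1 - (c * d).im • z.2 =
        c.re • (d.re • z.1 - d.im • z.2) - c.im • (d.re • z.2 + d.im • z.1)
      simp only [Complex.mul_re, Complex.mul_im]
      module
    · change (c * d).re • z.2 + (c * d).im • z.1 =
        c.re • (d.re • z.2 + d.im • z.1) + c.im • (d.re • z.1 - d.im • z.2)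
      simp only [Complex.mul_re, Complex.mul_im]
      module
  smul_zero c := by
    refine Prod.ext ?_ ?_
    · change c.re • (0 : E) - c.im • (0 : E) = 0
      simp
    · change c.re • (0 : E) + c.im • (0 : E) = 0
      simp
  smul_add c z w := by
    refine Prod.ext ?_ ?_
    · change c.re • (z.1 + w.1) - c.im • (z.2 + w.2) =
        (c.re • z.1 - c.im • z.2) + (c.re • w.1 - c.im • w.2)
      module
    · change c.re • (z.2 + w.2) + c.im • (z.1 + w.1) =
        (c.re • z.2 + c.im • z.1) + (c.re • w.2 + c.im • w.1)
      module
  add_smul c d z := by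
    refine Prod.ext ?_ ?_
    · change (c + d).re • z.1 - (c + d).im • z.2 =
        (c.re • z.1 - c.im • z.2) + (d.re • z.1 - d.im • z.2)
      simp only [Complex.add_re, Complex.add_im]
      module
    · change (c + d).re • z.2 + (c + d).im • z.1 =
        (c.re • z.2 + c.im • z.1) + (d.re • z.2 + d.im • z.1)
      simp only [Complex.add_re, Complex.add_im]
      module
  zero_smul z := by
    change ((0 : ℂ).re • z.1 - (0 : ℂ).im • z.2, (0 : ℂ).re • z.2 + (0 : ℂ).im • z.1) = 0
    simp

theorem smul_re [AddCommGroup E] [Module ℝ E] (c : ℂ) (z : Cplx E) :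
    (c • z).re = c.re • z.re - c.im • z.im := rfl

theorem smul_im [AddCommGroup E] [Module ℝ E] (c : ℂ) (z : Cplx E) :
    (c • z).im = c.re • z.im + c.im • z.re := rfl

end Cplx

/-! ### The nuclear Gel'fand triple -/

/-- A decreasing sequence `H = H 0 ⊃ H 1 ⊃ H 2 ⊃ ...` of real Hilbert spaces with increasing norms.
The inclusion `H (p + 1) ⊂ H p` is the map `emb p`. -/
structure HilbertChain where
  H : ℕ → Type u
  [normed : ∀ p, NormedAddCommGroup (H p)]
  [innerProduct : ∀ p, InnerProductSpace ℝ (H p)]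
  [complete : ∀ p, CompleteSpace (H p)]
  emb : ∀ p, H (p + 1) →L[ℝ] H p
  emb_injective : ∀ p, Function.Injective (emb p)
  norm_emb_le : ∀ p x, ‖emb p x‖ ≤ ‖x‖

attribute [instance] HilbertChain.normed HilbertChain.innerProduct HilbertChain.complete

namespace HilbertChain

variable (G : HilbertChain.{u})

/-- The inclusion of `H (p + k)` into `H p`. -/
def embIter (p : ℕ) : (k : ℕ) → G.H (p + k) →L[ℝ] G.H p
  | 0 => ContinuousLinearMap.id ℝ (G.H p)
  | k + 1 => (embIter p k).comp (G.emb (p + k))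

/-- The space `𝒩`, the projective limit of the spaces `H p`, with the projective limit topology. -/
def N : Submodule ℝ (∀ p, G.H p) where
  carrier := {x | ∀ p, G.emb p (x (p + 1)) = x p}
  add_mem' hx hy p := by simp [hx p, hy p]
  zero_mem' p := by simp
  smul_mem' c x hx p := by simp [hx p]

/-- The inclusion of `𝒩` into `H p`. -/
def proj (p : ℕ) : ↥G.N →L[ℝ] G.H p :=
  (ContinuousLinearMap.proj (R := ℝ) (φ := G.H) p).comp G.N.subtypeL

/-- `𝒩 ⊂ H ⊂ 𝒩'` is a nuclear Gel'fand triple: `𝒩` is dense in every `H p`, and for every `p` there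
is `p' > p` such that the embedding `H p' → H p` is a Hilbert-Schmidt operator. -/
structure IsNuclear : Prop where
  dense : ∀ p, DenseRange (G.proj p)
  hilbertSchmidt : ∀ p, ∃ k, 0 < k ∧ ∃ C : ℝ, ∀ (m : ℕ) (e : Fin m → G.H (p + k)),
    Orthonormal ℝ e → ∑ i, ‖G.embIter p k (e i)‖ ^ 2 ≤ C

/-- The complexification `𝒩_ℂ`. -/
abbrev NC : Type u := Cplx G.N

/-- The real dual space `𝒩'`. -/
abbrev Dual : Type u := ↥G.N →L[ℝ] ℝ

/-- The complexified dual space `𝒩'_ℂ`, realised as the continuous real-linear functionals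
`𝒩 → ℂ`. -/
abbrev DualC : Type u := ↥G.N →L[ℝ] ℂ

/-- The σ-algebra on `𝒩'` generated by the cylinder sets. -/
instance : MeasurableSpace G.Dual :=
  ⨆ θ : G.N, MeasurableSpace.comap (fun x : G.Dual => x θ) inferInstance

variable {G}

/-- The inclusion `𝒩' ⊂ 𝒩'_ℂ`. -/
def toDualC (x : G.Dual) : G.DualC := Complex.ofRealCLM.comp x

/-- The canonical bilinear form `⟨x | η⟩` of `𝒩'_ℂ` and `𝒩_ℂ`. -/
def pair (x : G.DualC) (η : G.NC) : ℂ := x η.re + Complex.I * x η.im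

/-- An element `h` of `H p` as a functional on `𝒩` through the inner product of `H p`. By the Riesz
theorem these functionals form the space `H_{-p} ⊂ 𝒩'`. -/
def riesz (p : ℕ) (h : G.H p) : G.DualC :=
  Complex.ofRealCLM.comp ((innerSL ℝ h).comp (G.proj p))

/-- The inclusion `𝒩_ℂ ⊂ 𝒩'_ℂ`, by the bilinear extension of the inner product of `H = H 0`. -/
def incl (ξ : G.NC) : G.DualC :=
  riesz 0 (G.proj 0 ξ.re) + Complex.I • riesz 0 (G.proj 0 ξ.im)

/-- The norm `|ξ|_p` of `H_{p,ℂ}` on `𝒩_ℂ`. -/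
def normC (p : ℕ) (ξ : G.NC) : ℝ := √(‖G.proj p ξ.re‖ ^ 2 + ‖G.proj p ξ.im‖ ^ 2)

/-- The dual norm `|ξ|_{-p}` of `H_{-p,ℂ}`, for `ξ ∈ 𝒩_ℂ ⊂ H_{-p,ℂ}`. -/
def dualNormC (p : ℕ) (ξ : G.NC) : ℝ :=
  sSup {r : ℝ | ∃ θ : G.NC, normC p θ ≤ 1 ∧ r = ‖pair (incl ξ) θ‖}

/-! ### Symmetric tensor powers

The Hilbert space `H_{p,ℂ}^{⊗n}` is realised as the space of Hilbert-Schmidt `n`-linear forms on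
its dual, and `𝒩_ℂ^{⊗n}`, the projective limit of these spaces, as the space of the `n`-linear
forms on `𝒩'_ℂ = ⋃ H_{-p,ℂ}` that are Hilbert-Schmidt on every `H_{-p,ℂ}`. The tensor `φ` is the form
`(x₁, ..., xₙ) ↦ ⟨x₁ ⊗ ... ⊗ xₙ | φ⟩`. -/

variable (G) in
/-- Finite orthonormal families in `H p`. -/
abbrev OrthFam (p : ℕ) : Type u := Σ m : ℕ, {e : Fin m → G.H p // Orthonormal ℝ e}

variable (G) in
/-- `n`-linear forms on `𝒩'_ℂ`. -/
abbrev Form (n : ℕ) : Type u := MultilinearMap ℂ (fun _ : Fin n => G.DualC) ℂ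

/-- The values of an `n`-linear form on a finite orthonormal family of `H_{-p}`. -/
def hsCoord (n p : ℕ) (e : G.OrthFam p) :
    G.Form n →ₗ[ℂ] EuclideanSpace ℂ (Fin n → Fin e.1) where
  toFun φ := WithLp.toLp 2 fun i => φ fun j => riesz p (e.2.1 (i j))
  map_add' _ _ := rfl
  map_smul' _ _ := rfl

/-- The partial Hilbert-Schmidt norm `(∑ |φ(e_{i₁}, ..., e_{iₙ})|²)^{1/2}`. -/
def hsSeminorm (n p : ℕ) (e : G.OrthFam p) : Seminorm ℂ (G.Form n) :=
  (normSeminorm ℂ (EuclideanSpace ℂ (Fin n → Fin e.1))).comp (hsCoord n p e)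

theorem hsSeminorm_apply (n p : ℕ) (e : G.OrthFam p) (φ : G.Form n) :
    hsSeminorm n p e φ =
      √(∑ i : Fin n → Fin e.1, ‖φ fun j => riesz p (e.2.1 (i j))‖ ^ 2) := by
  change ‖hsCoord n p e φ‖ = _
  rw [EuclideanSpace.norm_eq]
  rfl

variable (G) in
/-- The symmetric tensor power `𝒩_ℂ^{⊗̂ n}`. -/
def Kernel (n : ℕ) : Submodule ℂ (G.Form n) where
  carrier := {φ | (∀ (σ : Equiv.Perm (Fin n)) (x : Fin n → G.DualC), φ (x ∘ σ) = φ x) ∧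
    ∀ p, BddAbove (Set.range fun e : G.OrthFam p => hsSeminorm n p e φ)}
  add_mem' := by
    rintro φ ψ ⟨hφ, hφ'⟩ ⟨hψ, hψ'⟩
    refine ⟨fun σ x => by simp [hφ σ x, hψ σ x], fun p => ?_⟩
    obtain ⟨a, ha⟩ := hφ' p
    obtain ⟨b, hb⟩ := hψ' p
    refine ⟨a + b, ?_⟩
    rintro _ ⟨e, rfl⟩
    exact (map_add_le_add _ φ ψ).trans (add_le_add (ha ⟨e, rfl⟩) (hb ⟨e, rfl⟩))
  zero_mem' := by
    refine ⟨fun σ x => by simp, fun p => ⟨0, ?_⟩⟩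
    rintro _ ⟨e, rfl⟩
    exact (map_zero (hsSeminorm n p e)).le
  smul_mem' := by
    rintro c φ ⟨hφ, hφ'⟩
    refine ⟨fun σ x => by simp [hφ σ x], fun p => ?_⟩
    obtain ⟨a, ha⟩ := hφ' p
    refine ⟨‖c‖ * a, ?_⟩
    rintro _ ⟨e, rfl⟩
    change hsSeminorm n p e (c • φ) ≤ _
    rw [map_smul_eq_mul]
    exact mul_le_mul_of_nonneg_left (ha ⟨e, rfl⟩) (norm_nonneg c)

/-- The norm `|φ|_p` of `H_{p,ℂ}^{⊗n}`: the Hilbert-Schmidt norm of the form `φ` on `H_{-p,ℂ}`. -/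
def kernelNorm (n p : ℕ) : Seminorm ℂ (G.Kernel n) :=
  ⨆ e : G.OrthFam p, (hsSeminorm n p e).comp (G.Kernel n).subtype

theorem kernelNorm_apply (n p : ℕ) (φ : G.Kernel n) :
    kernelNorm n p φ = ⨆ e : G.OrthFam p, hsSeminorm n p e φ.1 := by
  unfold kernelNorm
  rw [Seminorm.iSup_apply]
  · rfl
  · rw [Seminorm.bddAbove_range_iff]
    intro ψ
    exact ψ.2.2 p

/-- `x ↦ ⟨x | η⟩` as a linear functional on `𝒩'_ℂ`. -/
def pairLin (η : G.NC) : G.DualC →ₗ[ℂ] ℂ where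
  toFun x := pair x η
  map_add' x y := by simp [pair]; ring
  map_smul' c x := by simp [pair]; ring

theorem tensorPow_bound (n p : ℕ) (η : G.NC) (e : G.OrthFam p) :
    hsSeminorm n p e ((MultilinearMap.mkPiAlgebra ℂ (Fin n) ℂ).compLinearMap
      fun _ => pairLin η) ≤ √((normC p η ^ 2) ^ n) := by
  rw [hsSeminorm_apply]
  apply Real.sqrt_le_sqrt
  have h1 : ∀ i : Fin n → Fin e.1,
      ‖((MultilinearMap.mkPiAlgebra ℂ (Fin n) ℂ).compLinearMap fun _ => pairLin η)
        (fun j => riesz p (e.2.1 (i j)))‖ ^ 2 =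
      ∏ j, ‖pair (riesz p (e.2.1 (i j))) η‖ ^ 2 := by
    intro i
    simp [pairLin, Finset.prod_pow]
  simp only [h1]
  have h2 := Finset.prod_univ_sum (fun _ : Fin n => (Finset.univ : Finset (Fin e.1)))
    (fun _ k => ‖pair (riesz p (e.2.1 k)) η‖ ^ 2)
  rw [Fintype.piFinset_univ] at h2
  rw [← h2, Finset.prod_const, Finset.card_univ, Fintype.card_fin]
  refine pow_le_pow_left₀ (Finset.sum_nonneg fun _ _ => by positivity) ?_ n
  have h3 : ∀ k, ‖pair (riesz p (e.2.1 k)) η‖ ^ 2 =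
      ‖Inner.inner ℝ (e.2.1 k) (G.proj p η.re)‖ ^ 2 +
        ‖Inner.inner ℝ (e.2.1 k) (G.proj p η.im)‖ ^ 2 := by
    intro k
    rw [← Complex.normSq_eq_norm_sq, Complex.normSq_apply]
    simp [pair, riesz]
    ring
  simp only [h3, Finset.sum_add_distrib]
  rw [normC, Real.sq_sqrt (by positivity)]
  exact add_le_add (e.2.2.sum_inner_products_le _) (e.2.2.sum_inner_products_le _)

/-- The tensor power `η^{⊗n} ∈ 𝒩_ℂ^{⊗̂ n}` of `η ∈ 𝒩_ℂ`. -/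
def tensorPow (n : ℕ) (η : G.NC) : G.Kernel n :=
  ⟨(MultilinearMap.mkPiAlgebra ℂ (Fin n) ℂ).compLinearMap fun _ => pairLin η, by
    refine ⟨fun σ x => ?_, fun p => ⟨√((normC p η ^ 2) ^ n), ?_⟩⟩
    · simp only [MultilinearMap.compLinearMap_apply, MultilinearMap.mkPiAlgebra_apply,
        Function.comp_apply]
      exact Equiv.prod_comp σ fun j => pairLin η (x j)
    · rintro _ ⟨e, rfl⟩
      exact tensorPow_bound n p η e⟩

/-! ### Continuous polynomials on `𝒩'` -/

variable (G) in
/-- Finite sequences of kernels `φ_n ∈ 𝒩_ℂ^{⊗̂ n}`. -/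
abbrev Kernels : Type u := ⨁ n : ℕ, G.Kernel n

variable (G) in
/-- The space `𝒫(𝒩')` of continuous polynomials `φ(x) = ∑ ⟨x^{⊗n} | φ_n⟩`. A polynomial is recorded
by its kernels `φ_n`, which are determined by the function; the function is `Poly.eval`. -/
abbrev Poly : Type u := G.Kernels

/-- `φ ↦ φ(y₁, ..., yₙ) = ⟨y₁ ⊗ ... ⊗ yₙ | φ⟩` as a linear functional of the kernel `φ`. -/
def evalAt {n : ℕ} (y : Fin n → G.DualC) : G.Kernel n →ₗ[ℂ] ℂ where
  toFun φ := φ.1 y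
  map_add' _ _ := rfl
  map_smul' _ _ := rfl

/-- The value `φ(x) = ∑ ⟨x^{⊗n} | φ_n⟩` of a polynomial, `x ∈ 𝒩'`. -/
def evalPoly (φ : G.Poly) (x : G.Dual) : ℂ :=
  DirectSum.toModule ℂ ℕ ℂ (fun n => evalAt fun _ : Fin n => toDualC x) φ

/-! ### Holomorphic functions and the assumptions on the measures -/

/-- Holomorphic functions on an open set `s` of a complex topological vector space: G-holomorphic
(analytic along every complex line) and continuous. -/
def HolomorphicOn {E : Type*} [AddCommGroup E] [Module ℂ E] [TopologicalSpace E]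
    (f : E → ℂ) (s : Set E) : Prop :=
  IsOpen s ∧ (∀ z ∈ s, ∀ w : E, AnalyticAt ℂ (fun t : ℂ => f (z + t • w)) 0) ∧ ContinuousOn f s

/-- The Laplace transform `E_μ(exp ⟨·|ξ⟩)`. -/
def laplace (μ : Measure G.Dual) (ξ : G.NC) : ℂ :=
  ∫ x : G.Dual, Complex.exp (pair (toDualC x) ξ) ∂μ

/-- `μ` has an analytic Laplace transform in a neighbourhood of `0 ∈ 𝒩_ℂ`. -/
def AnalyticLaplace (μ : Measure G.Dual) : Prop :=
  ∃ U : Set G.NC, 0 ∈ U ∧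
    (∀ ξ ∈ U, Integrable (fun x : G.Dual => Complex.exp (pair (toDualC x) ξ)) μ) ∧
    HolomorphicOn (laplace μ) U

/-- `μ` is non-degenerate: a continuous polynomial vanishes `μ`-almost everywhere only if it is
identically zero. -/
def NonDegenerate (μ : Measure G.Dual) : Prop :=
  ∀ φ : G.Poly, (∀ᵐ x ∂μ, evalPoly φ x = 0) ↔ ∀ x, evalPoly φ x = 0

/-! ### Normalized exponentials and Appell polynomials -/

/-- The normalized exponential `e_μ(ξ; x) = exp ⟨x|ξ⟩ / E_μ(exp ⟨·|ξ⟩)`. -/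
def normExp (μ : Measure G.Dual) (ξ : G.NC) (x : G.Dual) : ℂ :=
  Complex.exp (pair (toDualC x) ξ) / laplace μ ξ

/-- The kernel `P = P_{n,μ}(x)`: it is a functional on `𝒩_ℂ^{⊗̂ n}`, continuous with respect to some
norm `|·|_p`, such that `⟨P | η^{⊗n}⟩ = dⁿ e_μ(0; x) ηⁿ` for all `η ∈ 𝒩_ℂ`. -/
def IsAppell (μ : Measure G.Dual) (n : ℕ) (x : G.Dual) (P : G.Kernel n →ₗ[ℂ] ℂ) : Prop :=
  (∃ p, ∃ C : ℝ, ∀ φ, ‖P φ‖ ≤ C * kernelNorm n p φ) ∧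
    ∀ η : G.NC, P (tensorPow n η) = iteratedDeriv n (fun t : ℂ => normExp μ (t • η) x) 0

open Classical in
/-- The Appell kernel `P_{n,μ}(x)`, as the functional `φ ↦ ⟨P_{n,μ}(x) | φ⟩`. -/
def appell (μ : Measure G.Dual) (n : ℕ) (x : G.Dual) : G.Kernel n →ₗ[ℂ] ℂ :=
  if h : ∃ P, IsAppell μ n x P then h.choose else 0

/-- The value at `x ∈ 𝒩'` of the polynomial `∑ ⟨P_{n,μ}(·) | a_n⟩`. -/
def evalAppell (μ : Measure G.Dual) (a : G.Kernels) (x : G.Dual) : ℂ :=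
  DirectSum.toModule ℂ ℕ ℂ (fun n => appell μ n x) a

open Classical in
/-- The linear map that takes a polynomial `φ` to its Appell kernels, that is to the finite sequence
`(a_n)` for which `φ(x) = ∑ ⟨P_{n,μ}(x) | a_n⟩` on `𝒩'`. -/
def appellKernels (μ : Measure G.Dual) : G.Poly →ₗ[ℂ] G.Kernels :=
  if h : ∃ T : G.Poly →ₗ[ℂ] G.Kernels, ∀ φ x, evalPoly φ x = evalAppell μ (T φ) x
  then h.choose else 0

/-! ### The spaces `(H_{p,q,μ})` and `(𝒩)¹` -/

/-- `(∑ (n!)² 2^{qn} |a_n|_p²)^{1/2}`. -/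
def weightedNorm (p q : ℕ) (a : G.Kernels) : ℝ :=
  √(∑' n, ((n.factorial : ℝ) ^ 2 * 2 ^ (q * n)) * kernelNorm n p (a n) ^ 2)

theorem sqrt_sum_add_le (s : Finset ℕ) (w f g h : ℕ → ℝ) (hw : ∀ n, 0 ≤ w n) (hh : ∀ n, 0 ≤ h n)
    (hle : ∀ n, h n ≤ f n + g n) :
    √(∑ n ∈ s, w n * h n ^ 2) ≤ √(∑ n ∈ s, w n * f n ^ 2) + √(∑ n ∈ s, w n * g n ^ 2) := by
  have key : ∀ k : ℕ → ℝ, √(∑ n ∈ s, w n * k n ^ 2) =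
      ‖(WithLp.toLp 2 fun n : s => √(w n) * k n : EuclideanSpace ℝ s)‖ := by
    intro k
    rw [EuclideanSpace.norm_eq, ← Finset.sum_coe_sort]
    congr 1
    refine Finset.sum_congr rfl fun n _ => ?_
    rw [Real.norm_eq_abs, sq_abs, mul_pow, Real.sq_sqrt (hw n)]
  have h1 : √(∑ n ∈ s, w n * h n ^ 2) ≤ √(∑ n ∈ s, w n * (f n + g n) ^ 2) :=
    Real.sqrt_le_sqrt (Finset.sum_le_sum fun n _ =>
      mul_le_mul_of_nonneg_left (pow_le_pow_left₀ (hh n) (hle n) 2) (hw n))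
  refine h1.trans ?_
  rw [key f, key g, key fun n => f n + g n]
  refine le_trans (le_of_eq ?_) (norm_add_le _ _)
  congr 1
  ext n
  simp [mul_add]

theorem weightedNorm_eq (p q : ℕ) (a : G.Kernels) (s : Finset ℕ) (hs : ∀ n ∉ s, a n = 0) :
    weightedNorm p q a =
      √(∑ n ∈ s, ((n.factorial : ℝ) ^ 2 * 2 ^ (q * n)) * kernelNorm n p (a n) ^ 2) := by
  rw [weightedNorm, tsum_eq_sum (s := s)]
  intro n hn
  simp [hs n hn]

theorem exists_support (a : G.Kernels) : ∃ s : Finset ℕ, ∀ n ∉ s, a n = 0 := by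
  classical
  refine ⟨DFinsupp.support a, fun n hn => ?_⟩
  by_contra h
  exact hn (DFinsupp.mem_support_iff.2 h)

theorem weightedNorm_add (p q : ℕ) (a b : G.Kernels) :
    weightedNorm p q (a + b) ≤ weightedNorm p q a + weightedNorm p q b := by
  obtain ⟨s, hs⟩ := exists_support a
  obtain ⟨t, ht⟩ := exists_support b
  have ha : ∀ n ∉ s ∪ t, a n = 0 := fun n hn => hs n fun h => hn (Finset.mem_union_left _ h)
  have hb : ∀ n ∉ s ∪ t, b n = 0 := fun n hn => ht n fun h => hn (Finset.mem_union_right _ h)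
  have hab : ∀ n ∉ s ∪ t, (a + b) n = 0 := fun n hn => by
    rw [DirectSum.add_apply, ha n hn, hb n hn, add_zero]
  rw [weightedNorm_eq p q a _ ha, weightedNorm_eq p q b _ hb, weightedNorm_eq p q _ _ hab]
  refine sqrt_sum_add_le (s ∪ t) _ (fun n => kernelNorm n p (a n))
    (fun n => kernelNorm n p (b n)) (fun n => kernelNorm n p ((a + b) n))
    (fun n => by positivity) (fun n => apply_nonneg _ _) fun n => ?_
  rw [DirectSum.add_apply]
  exact map_add_le_add _ _ _

theorem weightedNorm_smul (p q : ℕ) (c : ℂ) (a : G.Kernels) :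
    weightedNorm p q (c • a) = ‖c‖ * weightedNorm p q a := by
  unfold weightedNorm
  have h : ∀ n, ((n.factorial : ℝ) ^ 2 * 2 ^ (q * n)) * kernelNorm n p ((c • a) n) ^ 2 =
      ‖c‖ ^ 2 * (((n.factorial : ℝ) ^ 2 * 2 ^ (q * n)) * kernelNorm n p (a n) ^ 2) := by
    intro n
    rw [DirectSum.smul_apply, map_smul_eq_mul]
    ring
  simp only [h, tsum_mul_left]
  rw [Real.sqrt_mul (by positivity), Real.sqrt_sq (norm_nonneg c)]

/-- The norm `‖φ‖_{p,q,μ} = (∑ (n!)² 2^{qn} |a_n|_p²)^{1/2}` of the polynomial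
`φ = ∑ ⟨P_{n,μ}(·) | a_n⟩`. -/
def polyNorm (μ : Measure G.Dual) (p q : ℕ) : Seminorm ℂ G.Poly :=
  Seminorm.of (fun φ => weightedNorm p q (appellKernels μ φ))
    (fun φ ψ => by simpa only [map_add] using weightedNorm_add p q _ _)
    (fun c φ => by simpa only [map_smul] using weightedNorm_smul p q c _)

/-- `𝒫(𝒩')` with the norm `‖·‖_{p,q,μ}`. -/
def NormedPoly (_μ : Measure G.Dual) (_p _q : ℕ) : Type u := G.Poly

instance (μ : Measure G.Dual) (p q : ℕ) : SeminormedAddCommGroup (NormedPoly μ p q) :=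
  (polyNorm μ p q).toAddGroupSeminorm.toSeminormedAddCommGroup

instance (μ : Measure G.Dual) (p q : ℕ) : Module ℂ (NormedPoly μ p q) :=
  inferInstanceAs (Module ℂ G.Poly)

instance (μ : Measure G.Dual) (p q : ℕ) : NormedSpace ℂ (NormedPoly μ p q) where
  norm_smul_le c φ := (map_smul_eq_mul (polyNorm μ p q) c φ).le

/-- The space `(H_{p,q,μ})`, the completion of `𝒫(𝒩')` with respect to `‖·‖_{p,q,μ}`. -/
abbrev Hpq (μ : Measure G.Dual) (p q : ℕ) : Type u := UniformSpace.Completion (NormedPoly μ p q)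

/-- The canonical map of `𝒫(𝒩')` into `(H_{p,q,μ})`. -/
def toHpq (μ : Measure G.Dual) (p q : ℕ) : G.Poly →ₗ[ℂ] Hpq μ p q :=
  (UniformSpace.Completion.toComplL (𝕜 := ℂ) (E := NormedPoly μ p q)).toLinearMap

/-- The test space `(𝒩)¹ = proj lim (H_{p,q,μ})`: the completion of `𝒫(𝒩')` with respect to all the
norms `‖·‖_{p,q,μ}`, that is the closure of the diagonal image of `𝒫(𝒩')` in the product of the
spaces `(H_{p,q,μ})`, with the topology induced by the product. -/
def TestSpace (μ : Measure G.Dual) : Submodule ℂ (∀ i : ℕ × ℕ, Hpq μ i.1 i.2) :=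
  (LinearMap.range (LinearMap.pi fun i : ℕ × ℕ => toHpq μ i.1 i.2)).topologicalClosure

/-- A polynomial as an element of `(𝒩)¹`. -/
def toTest (μ : Measure G.Dual) (φ : G.Poly) : TestSpace μ :=
  ⟨fun i => toHpq μ i.1 i.2 φ, Submodule.le_topologicalClosure _ ⟨φ, rfl⟩⟩

/-- The canonical map `(𝒩)¹ → (H_{p,q,μ})`. -/
def ofTest (μ : Measure G.Dual) (p q : ℕ) (f : TestSpace μ) : Hpq μ p q := f.1 (p, q)

/-! ### Generalized functions and local symbols -/

/-- The function `D(ζ^{⊗n}) φ` on `𝒩'`, for `ζ ∈ 𝒩'_ℂ` and a polynomial `φ`: on monomials,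
`D(ζ^{⊗n}) ⟨x^{⊗m} | φ_m⟩ = m!/(m-n)! ⟨x^{⊗(m-n)} ⊗̂ ζ^{⊗n} | φ_m⟩` if `n ≤ m`, and `0` otherwise. -/
def diffOp (n : ℕ) (ζ : G.DualC) (φ : G.Poly) (x : G.Dual) : ℂ :=
  DirectSum.toModule ℂ ℕ ℂ (fun m => (m.descFactorial n : ℂ) •
    evalAt fun j : Fin m => if (j : ℕ) < m - n then toDualC x else ζ) φ

/-- `⟨⟨Q_{n,μ}(ζ^{⊗n}) | φ⟩⟩_μ = ⟨⟨D(ζ^{⊗n})^* 1 | φ⟩⟩_μ = ∫ D(ζ^{⊗n}) φ dμ`. -/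
def qPair (μ : Measure G.Dual) (n : ℕ) (ζ : G.DualC) (φ : G.Poly) : ℂ :=
  ∫ x, diffOp n ζ φ x ∂μ

/-- `⟨⟨ρ_μ(ζ) | φ⟩⟩_μ` for a polynomial `φ`, with the generalized Radon-Nikodym derivative
`ρ_μ(ζ) = ∑ (-1)ⁿ Q_{n,μ}(ζ^{⊗n} / n!)`; only finitely many terms are not zero. -/
def rhoPair (μ : Measure G.Dual) (ζ : G.DualC) (φ : G.Poly) : ℂ :=
  ∑' n : ℕ, (-1) ^ n * (qPair μ n ζ φ / n.factorial)

/-- `R` is the functional `⟨⟨ρ_μ(ζ) | ·⟩⟩_μ` on `(H_{p,q,μ})`, that is `ρ_μ(ζ)` as an element of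
`(H_{-p,-q,μ}) = (H_{p,q,μ})^*`. -/
def IsRho (μ : Measure G.Dual) (p q : ℕ) (ζ : G.DualC) (R : Hpq μ p q →L[ℂ] ℂ) : Prop :=
  ∀ φ : G.Poly, R (toHpq μ p q φ) = rhoPair μ ζ φ

/-- `e` is the normalized exponential `e_ν(η; ·) = ∑ (1/n!) ⟨P_{n,ν}(·) | η^{⊗n}⟩` as an element of
`(H_{p,q,ν})`. -/
def IsNormExp (ν : Measure G.Dual) (p q : ℕ) (η : G.NC) (e : Hpq ν p q) : Prop :=
  ∃ s : ℕ → G.Poly,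
    (∀ n x, evalPoly (s n) x = (1 / n.factorial : ℂ) * appell ν n x (tensorPow n η)) ∧
    HasSum (fun n => toHpq ν p q (s n)) e

/-- `B'` is the extension of the operator `B : (𝒩)¹ → (𝒩)¹` to a continuous linear operator
`(H_{p,q,ν}) → (H_{p₀,q₀,μ})`. -/
def IsExtension (μ ν : Measure G.Dual) (B : TestSpace μ →L[ℂ] TestSpace μ) (p q p₀ q₀ : ℕ)
    (B' : Hpq ν p q →L[ℂ] Hpq μ p₀ q₀) : Prop :=
  ∀ φ : G.Poly, B' (toHpq ν p q φ) = ofTest μ p₀ q₀ (B (toTest μ φ))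

/-- `z` is the value `⟨⟨ρ_μ(-ξ) | B e_ν(η; ·)⟩⟩_μ` at `(ξ, η)` of the local `CS_{μν}`-symbol of `B`:
for some extension of `B` to an operator `(H_{p,q,ν}) → (H_{p₀,q₀,μ})` the point `η` lies in the
0-neighbourhood `|η|_p² < 2^{-q-1}`, and `z` is the pairing of `ρ_μ(-ξ) ∈ (H_{-p₀,-q₀,μ})` with
`B e_ν(η; ·) ∈ (H_{p₀,q₀,μ})`. -/
def IsSymbolValue (μ ν : Measure G.Dual) (B : TestSpace μ →L[ℂ] TestSpace μ) (ξ η : G.NC)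
    (z : ℂ) : Prop :=
  ∃ (p₀ q₀ p q : ℕ) (B' : Hpq ν p q →L[ℂ] Hpq μ p₀ q₀) (e : Hpq ν p q) (R : Hpq μ p₀ q₀ →L[ℂ] ℂ),
    IsExtension μ ν B p q p₀ q₀ B' ∧ normC p η ^ 2 < (2 ^ (q + 1) : ℝ)⁻¹ ∧
    IsNormExp ν p q η e ∧ IsRho μ p₀ q₀ (incl (-ξ)) R ∧ z = R (B' e)

open Classical in
/-- The local `CS_{μν}`-symbol of `B`, defined at all `(ξ, η)` with `η` in some 0-neighbourhood; its
value is meaningful where there is exactly one `z` with `IsSymbolValue μ ν B ξ η z`. -/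
def csSymbol (μ ν : Measure G.Dual) (B : TestSpace μ →L[ℂ] TestSpace μ) (ξ η : G.NC) : ℂ :=
  if h : ∃ z, IsSymbolValue μ ν B ξ η z then h.choose else 0

end HilbertChain

end AppellCS

end

open AppellCS HilbertChain

namespace AppellCS.HilbertChain

variable {G : HilbertChain.{u}}

/-! ### The chain of norms -/

/-! Everything is governed by one operator on polynomials, the convolution φ ↦ ∫ φ(· + y) dμ(y)
(`conv`). Since e_μ(ξ; ·) is e^{⟨·|ξ⟩} divided by the Laplace transform, convolution turns e_μ(ξ; ·)
back into e^{⟨·|ξ⟩}, and so ⟨P_{n,μ}(·)|a⟩ into ⟨·^{⊗n}|a⟩. Hence the Appell kernels of φ are the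
ordinary kernels of its convolution (`appellKernels_eq`), and ‖φ‖_{p,q,μ} is a weighted norm of the
latter. By Taylor's formula ρ_μ(-ξ) sends φ to ∫ φ(x + ξ) dμ(x), the value at ξ of the same
convolution (`rhoPair_eq`).

If a_n are the Appell kernels of φ, then |a_n|_p ≤ ‖φ‖_{p,2s,μ} / (n! 2^{sn}), so ρ_μ(-ξ) has norm
at most exp(2 · 2^{-s} |ξ|_{-p}) on (H_{p,2s,μ}) (`norm_rhoFun_le`); the factor 2 is the price of
splitting functionals into real and imaginary parts. With p = p_o fixed, the exponential type
becomes as small as desired when s grows. Whatever the target (H_{p_o,2s,μ}), B extends to it from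
some (H_{p,q,ν}) (`exists_isExtension`), where e_ν(η; ·) is bounded for |η|_p² < 2^{-q-1}.
Multiplying the bounds gives the estimate.

The analytic work is to compare the norms of μ and ν (`exists_norm_toHpq_le`), that is, to bound
convolution and its inverse. Nuclearity and the analytic Laplace transform show that μ lives on some
H_{-p} and that the j-th moment of |x|_{-p} is at most K j! A^j (`IsNuclear.exists_momentBound`).
These factorials cancel the binomial coefficients: on kernels with |a_n| ≤ W rⁿ/n!, r small,
convolution is dominated by a geometric series (`SeqBound.conv`), and it is inverted from the top
degree downwards (`SeqBound.of_conv`).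

Holomorphy: both factors of the symbol are locally uniformly convergent series of terms that are
polynomial on complex lines. Continuity follows from local boundedness through the Schwarz lemma. -/

theorem emb_proj (p : ℕ) (θ : G.N) : G.emb p (G.proj (p + 1) θ) = G.proj p θ := θ.2 p

theorem embIter_proj (p k : ℕ) (θ : G.N) : G.embIter p k (G.proj (p + k) θ) = G.proj p θ := by
  induction k with
  | zero => rfl
  | succ k ih =>
    change G.embIter p k (G.emb (p + k) (G.proj (p + k + 1) θ)) = _
    rw [emb_proj, ih]

theorem norm_proj_mono {p q : ℕ} (h : p ≤ q) (θ : G.N) : ‖G.proj p θ‖ ≤ ‖G.proj q θ‖ := by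
  induction q, h using Nat.le_induction with
  | base => rfl
  | succ q _ ih =>
    refine ih.trans ?_
    rw [← emb_proj]
    exact G.norm_emb_le _ _

/-- A vanishing component forces the higher ones to vanish because the embeddings are injective, and
the lower ones because the norms increase. -/
theorem proj_injective (p : ℕ) : Function.Injective (G.proj p) := by
  rw [injective_iff_map_eq_zero]
  intro θ h
  have h1 : ∀ q, G.proj (p + q) θ = 0 := by
    intro q
    induction q with
    | zero => exact h
    | succ q ih =>
      apply G.emb_injective (p + q)
      rw [map_zero]
      exact (emb_proj (p + q) θ).trans ih
  refine Subtype.ext (funext fun q => ?_)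
  have h2 := norm_proj_mono (Nat.le_add_left q p) θ
  rw [h1 q, norm_zero] at h2
  exact norm_le_zero_iff.1 h2

/-- A product neighbourhood restricts finitely many components; since the norms increase, the
largest index and the smallest radius control them all. -/
theorem exists_norm_proj_lt_of_mem_nhds {V : Set G.N} (hV : V ∈ 𝓝 0) :
    ∃ p, ∃ δ > 0, ∀ θ : G.N, ‖G.proj p θ‖ < δ → θ ∈ V := by
  rw [nhds_subtype_eq_comap, Filter.mem_comap] at hV
  obtain ⟨W, hW, hWV⟩ := hV
  rw [nhds_pi, Filter.mem_pi] at hW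
  obtain ⟨I, hI, t, ht, htW⟩ := hW
  choose δ hδ hδt using fun i => Metric.mem_nhds_iff.1 (ht i)
  obtain ⟨p, hp⟩ := hI.bddAbove
  have hI' : ∃ ε > 0, ∀ i ∈ I, ε ≤ δ i := by
    obtain ⟨ε, hε, h⟩ := (hI.isCompact.exists_forall_le' (f := δ) (a := 0)
      (continuous_of_discreteTopology.continuousOn) fun i _ => hδ i)
    exact ⟨ε, hε, fun i hi => h i hi⟩
  obtain ⟨ε, hε, h⟩ := hI'
  refine ⟨p, ε, hε, fun θ hθ => hWV (htW fun i hi => hδt i ?_)⟩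
  change _ ∈ Metric.ball (0 : G.H i) _
  rw [mem_ball_zero_iff]
  exact ((norm_proj_mono (hp hi) θ).trans_lt hθ).trans_le (h i hi)

/-! ### Bounds of functionals and forms -/

/-- The functional `y` satisfies `|y|_{-p} ≤ c`. -/
def DualBound (p : ℕ) (y : G.DualC) (c : ℝ) : Prop := ∀ θ : G.N, ‖y θ‖ ≤ c * ‖G.proj p θ‖

/-- The form `φ` is bounded by `A` on the unit ball of `H_{-p,ℂ}`. -/
def FormBound {n : ℕ} (p : ℕ) (φ : G.Form n) (A : ℝ) : Prop :=
  ∀ (y : Fin n → G.DualC) (c : Fin n → ℝ), (∀ j, 0 ≤ c j) → (∀ j, DualBound p (y j) (c j)) →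
    ‖φ y‖ ≤ A * ∏ j, c j

theorem DualBound.mono {p q : ℕ} {y : G.DualC} {c d : ℝ} (h : DualBound p y c) (hpq : p ≤ q)
    (hc : 0 ≤ c) (hcd : c ≤ d) : DualBound q y d := fun θ =>
  (h θ).trans (mul_le_mul hcd (norm_proj_mono hpq θ) (norm_nonneg _) (hc.trans hcd))

theorem DualBound.add {p : ℕ} {y z : G.DualC} {c d : ℝ} (hy : DualBound p y c)
    (hz : DualBound p z d) : DualBound p (y + z) (c + d) := fun θ => by
  rw [add_mul]
  exact (norm_add_le _ _).trans (add_le_add (hy θ) (hz θ))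

theorem DualBound.neg {p : ℕ} {y : G.DualC} {c : ℝ} (hy : DualBound p y c) :
    DualBound p (-y) c := fun θ => by
  rw [neg_apply, norm_neg]
  exact hy θ

theorem DualBound.smul {p : ℕ} {y : G.DualC} {c : ℝ} (hy : DualBound p y c) (a : ℂ) :
    DualBound p (a • y) (‖a‖ * c) := fun θ => by
  rw [smul_apply, norm_smul, mul_assoc]
  exact mul_le_mul_of_nonneg_left (hy θ) (norm_nonneg a)

/-- This is 𝒩'_ℂ = ⋃ H_{-p,ℂ}: continuity at 0 involves a single norm, and rescaling gives a linear
bound. -/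
theorem exists_dualBound (y : G.DualC) : ∃ p, ∃ c, 0 ≤ c ∧ DualBound p y c := by
  have h1 : y ⁻¹' Metric.ball 0 1 ∈ 𝓝 0 := by
    apply y.continuous.continuousAt.preimage_mem_nhds
    rw [map_zero]
    exact Metric.ball_mem_nhds 0 one_pos
  obtain ⟨p, δ, hδ, h⟩ := exists_norm_proj_lt_of_mem_nhds h1
  refine ⟨p, 2 / δ, by positivity, fun θ => ?_⟩
  by_cases h0 : ‖G.proj p θ‖ = 0
  · have h2 : θ = 0 := proj_injective p (by rw [norm_eq_zero.1 h0, map_zero])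
    simp [h2]
  · have hpos : 0 < ‖G.proj p θ‖ := lt_of_le_of_ne (norm_nonneg _) (Ne.symm h0)
    have h3 := h ((δ / (2 * ‖G.proj p θ‖)) • θ) (by
      rw [map_smul, norm_smul, Real.norm_of_nonneg (by positivity)]
      field_simp
      linarith)
    rw [Set.mem_preimage, mem_ball_zero_iff, map_smul, norm_smul,
      Real.norm_of_nonneg (by positivity)] at h3
    rw [div_mul_eq_mul_div, div_lt_one (by positivity)] at h3
    rw [div_mul_eq_mul_div, le_div_iff₀ hδ]
    linarith

theorem exists_dualBound_family {ι : Type*} [Finite ι] (y : ι → G.DualC) (p₀ : ℕ) :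
    ∃ p, p₀ ≤ p ∧ ∃ c : ι → ℝ, (∀ j, 0 ≤ c j) ∧ ∀ j, DualBound p (y j) (c j) := by
  choose p c hc h using fun j => exists_dualBound (y j)
  obtain ⟨q, hq⟩ := (Set.finite_range p).bddAbove
  exact ⟨max p₀ q, le_max_left _ _, c, hc, fun j =>
    (h j).mono ((hq ⟨j, rfl⟩).trans (le_max_right _ _)) (hc j) le_rfl⟩

theorem FormBound.mono {n p : ℕ} {φ : G.Form n} {A B : ℝ} (h : FormBound p φ A) (hAB : A ≤ B) :
    FormBound p φ B := fun y c hc hy =>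
  (h y c hc hy).trans (mul_le_mul_of_nonneg_right hAB (Finset.prod_nonneg fun j _ => hc j))

theorem FormBound.add {n p : ℕ} {φ ψ : G.Form n} {A B : ℝ} (hφ : FormBound p φ A)
    (hψ : FormBound p ψ B) : FormBound p (φ + ψ) (A + B) := fun y c hc hy => by
  rw [add_mul]
  exact (norm_add_le _ _).trans (add_le_add (hφ y c hc hy) (hψ y c hc hy))

theorem FormBound.smul {n p : ℕ} {φ : G.Form n} {A : ℝ} (hφ : FormBound p φ A) (a : ℂ) :
    FormBound p (a • φ) (‖a‖ * A) := fun y c hc hy => by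
  rw [smul_apply, norm_smul, mul_assoc]
  exact mul_le_mul_of_nonneg_left (hφ y c hc hy) (norm_nonneg a)

theorem FormBound.neg {n p : ℕ} {φ : G.Form n} {A : ℝ} (hφ : FormBound p φ A) :
    FormBound p (-φ) A := fun y c hc hy => by
  rw [neg_apply, norm_neg]
  exact hφ y c hc hy

theorem FormBound.sub {n p : ℕ} {φ ψ : G.Form n} {A B : ℝ} (hφ : FormBound p φ A)
    (hψ : FormBound p ψ B) : FormBound p (φ - ψ) (A + B) := by
  rw [sub_eq_add_neg]
  exact hφ.add hψ.neg

theorem formBound_zero {n p : ℕ} : FormBound p (0 : G.Form n) 0 := fun y c _ _ => by simp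

theorem FormBound.sum {ι : Type*} {n p : ℕ} {s : Finset ι} {φ : ι → G.Form n} {A : ι → ℝ}
    (h : ∀ i ∈ s, FormBound p (φ i) (A i)) : FormBound p (∑ i ∈ s, φ i) (∑ i ∈ s, A i) := by
  classical
  induction s using Finset.induction_on with
  | empty => simpa using formBound_zero
  | insert i s hi ih =>
    rw [Finset.sum_insert hi, Finset.sum_insert hi]
    exact (h i (Finset.mem_insert_self _ _)).add
      (ih fun j hj => h j (Finset.mem_insert_of_mem hj))

/-- The functional of `H p` as a linear map. -/
theorem riesz_apply (p : ℕ) (h : G.H p) (θ : G.N) :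
    riesz p h θ = ((inner ℝ h (G.proj p θ) : ℝ) : ℂ) := rfl

theorem riesz_sum_smul {ι : Type*} (s : Finset ι) (p : ℕ) (a : ι → ℝ) (h : ι → G.H p) :
    riesz p (∑ i ∈ s, a i • h i) = ∑ i ∈ s, (a i : ℂ) • riesz p (h i) := by
  ext θ
  simp [riesz_apply, sum_inner, inner_smul_left]

theorem dualBound_riesz (p : ℕ) (h : G.H p) : DualBound p (riesz p h) ‖h‖ := fun θ => by
  rw [riesz_apply, Complex.norm_real]
  exact norm_inner_le_norm _ _

/-- As `proj p` is injective, f lives on its range; Hahn-Banach extends it without increasing the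
norm and the Riesz theorem represents it. -/
theorem exists_inner_eq_of_bound (p : ℕ) (f : G.N →ₗ[ℝ] ℝ) {c : ℝ} (hc : 0 ≤ c)
    (hf : ∀ θ, ‖f θ‖ ≤ c * ‖G.proj p θ‖) :
    ∃ h : G.H p, ‖h‖ ≤ c ∧ ∀ θ, f θ = inner ℝ h (G.proj p θ) := by
  let E := LinearEquiv.ofInjective (G.proj p).toLinearMap (proj_injective p)
  let g : LinearMap.range (G.proj p).toLinearMap →L[ℝ] ℝ :=
    (f ∘ₗ E.symm.toLinearMap).mkContinuous c (fun v => by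
      obtain ⟨θ, rfl⟩ := E.surjective v
      change ‖f (E.symm (E θ))‖ ≤ c * ‖G.proj p θ‖
      rw [E.symm_apply_apply]
      exact hf θ)
  have hg : ‖g‖ ≤ c := LinearMap.mkContinuous_norm_le _ hc _
  obtain ⟨k, hk, hk'⟩ := exists_extension_norm_eq _ g
  refine ⟨(InnerProductSpace.toDual ℝ (G.H p)).symm k, ?_, fun θ => ?_⟩
  · rw [LinearIsometryEquiv.norm_map, hk']
    exact hg
  · rw [InnerProductSpace.toDual_symm_apply]
    have h1 := hk (E θ)
    have h2 : g (E θ) = f θ := by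
      change f (E.symm (E θ)) = _
      rw [E.symm_apply_apply]
    rw [← h2, ← h1]
    rfl

/-- Real and imaginary parts are indexed by powers of I, so that a multilinear expansion yields 2ⁿ
terms whose coefficients have modulus one. -/
theorem DualBound.exists_riesz {p : ℕ} {y : G.DualC} {c : ℝ} (hc : 0 ≤ c) (hy : DualBound p y c) :
    ∃ h : Fin 2 → G.H p, (∀ b, ‖h b‖ ≤ c) ∧
      y = ∑ b : Fin 2, (Complex.I ^ (b : ℕ)) • riesz p (h b) := by
  obtain ⟨h₀, hh₀, e₀⟩ := exists_inner_eq_of_bound p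
    (Complex.reCLM.comp y).toLinearMap hc fun θ => (Complex.abs_re_le_norm _).trans (hy θ)
  obtain ⟨h₁, hh₁, e₁⟩ := exists_inner_eq_of_bound p
    (Complex.imCLM.comp y).toLinearMap hc fun θ => (Complex.abs_im_le_norm _).trans (hy θ)
  refine ⟨![h₀, h₁], fun b => by fin_cases b <;> assumption, ?_⟩
  ext θ
  have e₀' : (y θ).re = inner ℝ h₀ (G.proj p θ) := e₀ θ
  have e₁' : (y θ).im = inner ℝ h₁ (G.proj p θ) := e₁ θ
  rw [← Complex.re_add_im (y θ), e₀', e₁']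
  simp [riesz_apply, mul_comm]

/-- An orthonormal basis of the span. That its vectors stay in the span matters when the h j come
from 𝒩: the basis then comes from 𝒩 too. -/
theorem exists_orthFam_repr {n p : ℕ} (h : Fin n → G.H p) :
    ∃ e : G.OrthFam p, (∀ i, e.2.1 i ∈ Submodule.span ℝ (Set.range h)) ∧
      ∀ j, h j = ∑ i, (inner ℝ (e.2.1 i) (h j) : ℝ) • e.2.1 i := by
  let V := Submodule.span ℝ (Set.range h)
  have : FiniteDimensional ℝ V := FiniteDimensional.span_of_finite ℝ (Set.finite_range h)
  let b := stdOrthonormalBasis ℝ V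
  refine ⟨⟨_, fun i => (b i : G.H p), b.orthonormal.comp_linearIsometry V.subtypeₗᵢ⟩,
    fun i => (b i).2, fun j => ?_⟩
  have hj : h j ∈ V := Submodule.subset_span ⟨j, rfl⟩
  have h1 := congrArg (Subtype.val) (b.sum_repr' ⟨h j, hj⟩)
  simp only [Submodule.coe_sum, Submodule.coe_smul, Submodule.coe_inner] at h1
  exact h1.symm

theorem norm_sq_eq_sum_of_repr {p : ℕ} (e : G.OrthFam p) {h : G.H p}
    (hh : h = ∑ i, (inner ℝ (e.2.1 i) h : ℝ) • e.2.1 i) :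
    ‖h‖ ^ 2 = ∑ i, (inner ℝ (e.2.1 i) h : ℝ) ^ 2 := by
  rw [← real_inner_self_eq_norm_sq]
  nth_rewrite 1 [hh]
  rw [sum_inner]
  refine Finset.sum_congr rfl fun i _ => ?_
  rw [inner_smul_left]
  simp [sq]

theorem hsSeminorm_le_kernelNorm {n p : ℕ} (φ : G.Kernel n) (e : G.OrthFam p) :
    hsSeminorm n p e φ.1 ≤ kernelNorm n p φ := by
  rw [kernelNorm_apply]
  exact le_ciSup (φ.2.2 p) e

/-- Cauchy-Schwarz in an orthonormal basis of the span of the h j: the coefficient tensor has ℓ²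
norm ∏ ‖h j‖, and the values of φ on the basis have ℓ² norm at most |φ|_p. -/
theorem norm_apply_riesz_le {n p : ℕ} (φ : G.Kernel n) (h : Fin n → G.H p) :
    ‖φ.1 fun j => riesz p (h j)‖ ≤ kernelNorm n p φ * ∏ j, ‖h j‖ := by
  classical
  obtain ⟨e, -, he⟩ := exists_orthFam_repr h
  have h1 : (fun j => riesz p (h j)) = fun j => ∑ i, ((inner ℝ (e.2.1 i) (h j) : ℝ) : ℂ) •
      riesz p (e.2.1 i) := by
    funext j
    rw [← riesz_sum_smul, ← he j]
  rw [h1, MultilinearMap.map_sum]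
  simp only [MultilinearMap.map_smul_univ]
  calc _ ≤ ∑ r : Fin n → Fin e.1, (∏ j, |(inner ℝ (e.2.1 (r j)) (h j) : ℝ)|) *
        ‖φ.1 fun j => riesz p (e.2.1 (r j))‖ := by
        refine (norm_sum_le _ _).trans (le_of_eq (Finset.sum_congr rfl fun r _ => ?_))
        rw [norm_smul, norm_prod]
        simp
    _ ≤ √(∑ r : Fin n → Fin e.1, (∏ j, |(inner ℝ (e.2.1 (r j)) (h j) : ℝ)|) ^ 2) *
        √(∑ r : Fin n → Fin e.1, ‖φ.1 fun j => riesz p (e.2.1 (r j))‖ ^ 2) :=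
        Real.sum_mul_le_sqrt_mul_sqrt _ _ _
    _ = (∏ j, ‖h j‖) * hsSeminorm n p e φ.1 := by
        rw [hsSeminorm_apply]
        congr 1
        have h2 := Finset.prod_univ_sum (fun _ : Fin n => (Finset.univ : Finset (Fin e.1)))
          (fun j k => (inner ℝ (e.2.1 k) (h j) : ℝ) ^ 2)
        rw [Fintype.piFinset_univ] at h2
        simp only [← Finset.prod_pow, sq_abs]
        rw [← h2]
        simp only [← norm_sq_eq_sum_of_repr e (he _)]
        rw [Finset.prod_pow, Real.sqrt_sq (by positivity)]
    _ ≤ _ := by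
        rw [mul_comm]
        exact mul_le_mul_of_nonneg_right (hsSeminorm_le_kernelNorm φ e) (by positivity)

/-- The factor 2ⁿ comes from splitting every argument into real and imaginary parts. It is harmless,
being absorbed later into the radius r of bounds W rⁿ/n!. -/
theorem formBound_kernelNorm {n p : ℕ} (φ : G.Kernel n) :
    FormBound p φ.1 (2 ^ n * kernelNorm n p φ) := fun y c hc hy => by
  classical
  choose h hh hy' using fun j => (hy j).exists_riesz (hc j)
  rw [funext hy', MultilinearMap.map_sum]
  simp only [MultilinearMap.map_smul_univ]
  refine (norm_sum_le _ _).trans ((Finset.sum_le_card_nsmul _ _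
    (kernelNorm n p φ * ∏ j, c j) fun r _ => ?_).trans (le_of_eq ?_))
  · rw [norm_smul, norm_prod]
    simp only [norm_pow, Complex.norm_I, one_pow, Finset.prod_const_one, one_mul]
    refine (norm_apply_riesz_le φ _).trans (mul_le_mul_of_nonneg_left ?_ (apply_nonneg _ _))
    exact Finset.prod_le_prod (fun j _ => norm_nonneg _) fun j _ => hh j _
  · simp [mul_assoc]

/-- Every form on `𝒩'_ℂ` bounded for one of the norms `|·|_{-p'}` is a Hilbert-Schmidt form on
`H_{-p}`, with a bound that is uniform in `p'`. -/
theorem IsNuclear.exists_hsSeminorm_le (hG : G.IsNuclear) (p : ℕ) :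
    ∃ q, p ≤ q ∧ ∃ C : ℝ, 0 < C ∧ ∀ p', q ≤ p' → ∀ (n : ℕ) (φ : G.Form n) (A : ℝ), 0 ≤ A →
      FormBound p' φ A → ∀ e : G.OrthFam p, hsSeminorm n p e φ ≤ C ^ n * A := by
  classical
  obtain ⟨k, -, C, hC⟩ := hG.hilbertSchmidt p
  have hC0 : 0 ≤ C := by simpa using hC 0 Fin.elim0 ⟨fun i => i.elim0, fun i => i.elim0⟩
  -- Here √C would do for the estimate; adding 1 keeps the constant positive.
  refine ⟨p + k, Nat.le_add_right _ _, √(C + 1), by positivity, fun p' hp' n φ A hA hφ e => ?_⟩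
  let T := G.embIter p k
  -- As a functional, h ∈ H_p has norm at most ‖T' h‖ in H_{-(p+k)}, so the Hilbert-Schmidt sum of φ
  -- is dominated by that of T'.
  let T' := ContinuousLinearMap.adjoint T
  have hb : ∀ h, DualBound p' (riesz p h) ‖T' h‖ := by
    intro h
    refine DualBound.mono (p := p + k) (fun θ => ?_) hp' (norm_nonneg _) le_rfl
    rw [riesz_apply, ← embIter_proj p k, ← ContinuousLinearMap.adjoint_inner_left,
      Complex.norm_real]
    exact norm_inner_le_norm _ _
  -- An operator and its adjoint have the same Hilbert-Schmidt norm: Parseval in a basis of the span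
  -- of the T' e_i, exchange of sums, then Bessel.
  have hsum : ∑ i, ‖T' (e.2.1 i)‖ ^ 2 ≤ C := by
    obtain ⟨f, -, hf⟩ := exists_orthFam_repr fun i => T' (e.2.1 i)
    simp only [fun i => norm_sq_eq_sum_of_repr f (hf i)]
    rw [Finset.sum_comm]
    refine le_trans (Finset.sum_le_sum fun j _ => ?_) (hC _ f.2.1 f.2.2)
    simp only [T', ContinuousLinearMap.adjoint_inner_right]
    have := e.2.2.sum_inner_products_le (G.embIter p k (f.2.1 j)) (s := Finset.univ)
    refine le_trans (le_of_eq (Finset.sum_congr rfl fun i _ => ?_)) this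
    rw [real_inner_comm, Real.norm_eq_abs, sq_abs]
  rw [hsSeminorm_apply, Real.sqrt_le_left (by positivity)]
  calc _ ≤ ∑ r : Fin n → Fin e.1, A ^ 2 * ∏ j, ‖T' (e.2.1 (r j))‖ ^ 2 := by
        refine Finset.sum_le_sum fun r _ => ?_
        rw [Finset.prod_pow, ← mul_pow]
        exact pow_le_pow_left₀ (norm_nonneg _)
          (hφ _ _ (fun j => norm_nonneg _) fun j => hb _) 2
    _ = A ^ 2 * (∑ i, ‖T' (e.2.1 i)‖ ^ 2) ^ n := by
        have h2 := Finset.prod_univ_sum (fun _ : Fin n => (Finset.univ : Finset (Fin e.1)))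
          (fun _ k => ‖T' (e.2.1 k)‖ ^ 2)
        rw [Fintype.piFinset_univ] at h2
        rw [← Finset.mul_sum, ← h2, Finset.prod_const, Finset.card_univ, Fintype.card_fin]
    _ ≤ A ^ 2 * (C + 1) ^ n := by
        gcongr
        linarith
    _ = (√(C + 1) ^ n * A) ^ 2 := by
        rw [mul_pow, ← pow_mul, mul_comm n 2, pow_mul, Real.sq_sqrt (by positivity)]
        ring

/-- Converse of `formBound_kernelNorm` with a loss of index: Hilbert-Schmidt norms and bounds on
balls define the same kernels, at the cost of a factor Cⁿ. -/
theorem IsNuclear.exists_kernelNorm_le (hG : G.IsNuclear) (p : ℕ) :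
    ∃ q, p ≤ q ∧ ∃ C : ℝ, 0 < C ∧ ∀ p', q ≤ p' → ∀ (n : ℕ) (φ : G.Kernel n) (A : ℝ), 0 ≤ A →
      FormBound p' φ.1 A → kernelNorm n p φ ≤ C ^ n * A := by
  obtain ⟨q, hq, C, hC, h⟩ := hG.exists_hsSeminorm_le p
  refine ⟨q, hq, C, hC, fun p' hp' n φ A hA hφ => ?_⟩
  rw [kernelNorm_apply]
  have : Nonempty (G.OrthFam p) := ⟨⟨0, Fin.elim0, ⟨fun i => i.elim0, fun i => i.elim0⟩⟩⟩
  exact ciSup_le fun e => h p' hp' n φ.1 A hA hφ e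

/-- A symmetric form is a kernel if it is bounded for all norms `|·|_{-p}`, `p ≥ p₀`. -/
theorem IsNuclear.mem_kernel (hG : G.IsNuclear) {n : ℕ} {φ : G.Form n}
    (hσ : ∀ (σ : Equiv.Perm (Fin n)) (x : Fin n → G.DualC), φ (x ∘ σ) = φ x) (p₀ : ℕ)
    (hφ : ∀ p, p₀ ≤ p → ∃ A, 0 ≤ A ∧ FormBound p φ A) : φ ∈ G.Kernel n := by
  refine ⟨hσ, fun p => ?_⟩
  obtain ⟨q, -, C, -, h⟩ := hG.exists_hsSeminorm_le p
  obtain ⟨A, hA, hφA⟩ := hφ (max p₀ q) (le_max_left _ _)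
  refine ⟨C ^ n * A, ?_⟩
  rintro _ ⟨e, rfl⟩
  exact h _ (le_max_right _ _) n φ A hA hφA e


/-! ### Approximation of functionals by functionals of finite rank -/

theorem norm_sub_orthogonal_sum_le {p : ℕ} (e : G.OrthFam p) (h : G.H p) :
    ‖h - ∑ i, (inner ℝ (e.2.1 i) h : ℝ) • e.2.1 i‖ ≤ ‖h‖ := by
  have h1 : inner ℝ (h - ∑ i, (inner ℝ (e.2.1 i) h : ℝ) • e.2.1 i)
      (∑ i, (inner ℝ (e.2.1 i) h : ℝ) • e.2.1 i) = 0 := by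
    rw [inner_sub_left, e.2.2.inner_sum]
    simp only [inner_sum, inner_smul_right, real_inner_comm, conj_trivial, sub_self]
  have h2 := norm_add_sq_eq_norm_sq_add_norm_sq_of_inner_eq_zero _ _ h1
  rw [sub_add_cancel] at h2
  nlinarith [norm_nonneg h, norm_nonneg (h - ∑ i, (inner ℝ (e.2.1 i) h : ℝ) • e.2.1 i),
    norm_nonneg (∑ i, (inner ℝ (e.2.1 i) h : ℝ) • e.2.1 i)]

theorem inner_sub_orthogonal_sum {p : ℕ} (e : G.OrthFam p) (h : G.H p) (j : Fin e.1) :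
    inner ℝ (e.2.1 j) (h - ∑ i, (inner ℝ (e.2.1 i) h : ℝ) • e.2.1 i) = 0 := by
  rw [inner_sub_right, e.2.2.inner_right_fintype, sub_self]

theorem orthonormal_cons {p m : ℕ} {e : Fin m → G.H p} (he : Orthonormal ℝ e) {v : G.H p}
    (hv : ‖v‖ = 1) (hev : ∀ i, inner ℝ (e i) v = 0) :
    Orthonormal ℝ (Fin.cons v e : Fin (m + 1) → G.H p) := by
  refine ⟨fun i => ?_, fun i j hij => ?_⟩
  · induction i using Fin.cases with
    | zero => simpa using hv
    | succ i => simpa using he.1 i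
  · induction i using Fin.cases with
    | zero =>
      induction j using Fin.cases with
      | zero => exact absurd rfl hij
      | succ j => simpa [real_inner_comm] using hev j
    | succ i =>
      induction j using Fin.cases with
      | zero => simpa using hev i
      | succ j => simpa using he.2 fun h => hij (by rw [h])

/-- A Hilbert-Schmidt embedding is a norm limit of finite-rank operators, and density lets their
ranges be taken inside 𝒩. -/
theorem IsNuclear.exists_finite_rank (hG : G.IsNuclear) (p : ℕ) :
    ∃ q, p ≤ q ∧ ∀ δ : ℝ, 0 < δ → ∃ (m : ℕ) (t : Fin m → G.N) (ψ : Fin m → G.N →L[ℝ] ℝ),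
      ∀ θ, ‖G.proj p (θ - ∑ j, ψ j θ • t j)‖ ≤ δ * ‖G.proj q θ‖ := by
  obtain ⟨k, -, C, hC⟩ := hG.hilbertSchmidt p
  refine ⟨p + k, Nat.le_add_right _ _, fun δ' hδ' => ?_⟩
  obtain ⟨δ, hδ, rfl⟩ : ∃ δ > 0, δ' = 2 * δ := ⟨δ' / 2, by positivity, by ring⟩
  let T := G.embIter p k
  let f : G.OrthFam (p + k) → ℝ := fun e => ∑ i, ‖T (e.2.1 i)‖ ^ 2
  have hbdd : BddAbove (Set.range f) := ⟨C, by rintro _ ⟨e, rfl⟩; exact hC _ e.2.1 e.2.2⟩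
  have : Nonempty (G.OrthFam (p + k)) := ⟨⟨0, Fin.elim0, ⟨fun i => i.elim0, fun i => i.elim0⟩⟩⟩
  -- The family e nearly exhausts the Hilbert-Schmidt sum of T. A unit vector v orthogonal to it can
  -- be adjoined, so ‖T v‖² cannot exceed the missing δ².
  obtain ⟨e, he⟩ := exists_lt_of_lt_ciSup (f := f)
    (show (⨆ e, f e) - δ ^ 2 < ⨆ e, f e by linarith [pow_pos hδ 2])
  have hT : ∀ v, (∀ i, inner ℝ (e.2.1 i) v = 0) → ‖T v‖ ≤ δ * ‖v‖ := by
    intro v hv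
    by_cases h0 : v = 0
    · simp [h0]
    have hv0 : 0 < ‖v‖ := norm_pos_iff.2 h0
    have hcons := orthonormal_cons (v := ‖v‖⁻¹ • v) e.2.2 (by
      rw [norm_smul, norm_inv, norm_norm, inv_mul_cancel₀ hv0.ne'])
      (fun i => by rw [inner_smul_right, hv i, mul_zero])
    have h1 := le_ciSup hbdd ⟨_, _, hcons⟩
    simp only [f, Fin.sum_univ_succ, Fin.cons_zero, Fin.cons_succ] at h1
    change _ - _ < ∑ i, ‖T (e.2.1 i)‖ ^ 2 at he
    have h2 : ‖T (‖v‖⁻¹ • v)‖ ^ 2 < δ ^ 2 := by linarith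
    have h3 := lt_of_pow_lt_pow_left₀ 2 hδ.le h2
    rw [map_smul, norm_smul, norm_inv, norm_norm, inv_mul_lt_iff₀ hv0] at h3
    linarith
  -- The m approximation errors must add up to at most δ; dividing by m + 1 also covers m = 0.
  have hd : ∀ j, ∃ t : G.N, ‖T (e.2.1 j) - G.proj p t‖ < δ / (e.1 + 1) := fun j => by
    obtain ⟨t, ht⟩ := (hG.dense p).exists_dist_lt (T (e.2.1 j))
      (show 0 < δ / (e.1 + 1) by positivity)
    exact ⟨t, by rwa [dist_eq_norm] at ht⟩
  choose t ht using hd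
  refine ⟨e.1, t, fun j => (innerSL ℝ (e.2.1 j)).comp (G.proj (p + k)), fun θ => ?_⟩
  set h := G.proj (p + k) θ with hh
  have h1 := hT _ (inner_sub_orthogonal_sum e h)
  have h2 : G.proj p (θ - ∑ j, (inner ℝ (e.2.1 j) h : ℝ) • t j) =
      T (h - ∑ i, (inner ℝ (e.2.1 i) h : ℝ) • e.2.1 i) +
        ∑ j, (inner ℝ (e.2.1 j) h : ℝ) • (T (e.2.1 j) - G.proj p (t j)) := by
    simp only [map_sub, map_sum, map_smul, smul_sub, Finset.sum_sub_distrib, T]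
    rw [hh, embIter_proj]
    abel
  change ‖G.proj p (θ - ∑ j, (inner ℝ (e.2.1 j) h : ℝ) • t j)‖ ≤ _
  rw [h2]
  refine (norm_add_le _ _).trans ?_
  have h3 : ‖∑ j, (inner ℝ (e.2.1 j) h : ℝ) • (T (e.2.1 j) - G.proj p (t j))‖ ≤
      ∑ _j : Fin e.1, ‖h‖ * (δ / (e.1 + 1)) := by
    refine norm_sum_le_of_le _ fun j _ => ?_
    rw [norm_smul]
    refine mul_le_mul ?_ (ht j).le (norm_nonneg _) (norm_nonneg _)
    refine (norm_inner_le_norm _ _).trans ?_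
    rw [e.2.2.1 j, one_mul]
  have h4 : ∑ _j : Fin e.1, ‖h‖ * (δ / (e.1 + 1)) ≤ δ * ‖h‖ := by
    rw [Finset.sum_const, Finset.card_univ, Fintype.card_fin, nsmul_eq_mul]
    have : (e.1 : ℝ) * (‖h‖ * (δ / (e.1 + 1))) = δ * ‖h‖ * (e.1 / (e.1 + 1)) := by ring
    rw [this]
    refine mul_le_of_le_one_right (by positivity) ?_
    rw [div_le_one (by positivity)]
    linarith
  have h5 := mul_le_mul_of_nonneg_left (norm_sub_orthogonal_sum_le e h) hδ.le
  linarith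

/-- The operator `y ↦ ∑ y(t_j) ψ_j` of finite rank on `𝒩'_ℂ`. -/
noncomputable def finRank {m : ℕ} (t : Fin m → G.N) (ψ : Fin m → G.DualC) :
    G.DualC →ₗ[ℂ] G.DualC where
  toFun y := ∑ j, y (t j) • ψ j
  map_add' y z := by
    rw [← Finset.sum_add_distrib]
    exact Finset.sum_congr rfl fun j _ => add_smul (y (t j)) (z (t j)) (ψ j)
  map_smul' a y := by simp [mul_smul, Finset.smul_sum]

theorem finRank_apply {m : ℕ} (t : Fin m → G.N) (ψ : Fin m → G.DualC) (y : G.DualC) :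
    finRank t ψ y = ∑ j, y (t j) • ψ j := rfl

/-- Transpose of `IsNuclear.exists_finite_rank`: y minus its approximation, evaluated at θ, is y at
the remainder of θ. -/
theorem IsNuclear.exists_finRank (hG : G.IsNuclear) (p : ℕ) :
    ∃ q, p ≤ q ∧ ∀ δ : ℝ, 0 < δ → ∃ (m : ℕ) (t : Fin m → G.N) (ψ : Fin m → G.DualC),
      ∀ (y : G.DualC) (c : ℝ), 0 ≤ c → DualBound p y c →
        DualBound q (y - finRank t ψ y) (δ * c) := by
  obtain ⟨q, hq, h⟩ := hG.exists_finite_rank p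
  refine ⟨q, hq, fun δ hδ => ?_⟩
  obtain ⟨m, t, ψ, hψ⟩ := h δ hδ
  refine ⟨m, t, fun j => toDualC (ψ j), fun y c hc hy θ => ?_⟩
  have h1 : (y - finRank t (fun j => toDualC (ψ j)) y) θ = y (θ - ∑ j, ψ j θ • t j) := by
    rw [map_sub, map_sum, sub_apply, finRank_apply]
    simp [toDualC, mul_comm]
  rw [h1, mul_comm δ, mul_assoc]
  exact (hy _).trans (mul_le_mul_of_nonneg_left (hψ θ) hc)

/-- Expand φ at y = z + (y - z) over subsets of slots. Apart from φ z, every term has a slot filled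
by y - z and so carries a factor δ; there are at most 2ⁿ of them, each at most 2ⁿ A δ ∏ c j. -/
theorem FormBound.norm_sub_le {n p : ℕ} {φ : G.Form n} {A δ : ℝ} (hφ : FormBound p φ A)
    (hA : 0 ≤ A) (hδ : 0 ≤ δ) (hδ1 : δ ≤ 1) {y z : Fin n → G.DualC} {c : Fin n → ℝ}
    (hc : ∀ j, 0 ≤ c j) (hy : ∀ j, DualBound p (y j) (c j))
    (hz : ∀ j, DualBound p (y j - z j) (δ * c j)) :
    ‖φ y - φ z‖ ≤ 4 ^ n * A * δ * ∏ j, c j := by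
  classical
  -- From 1 + δ ≤ 2.
  have hz' : ∀ j, DualBound p (z j) (2 * c j) := fun j => by
    have h := (hy j).add (hz j).neg
    rw [show y j + -(y j - z j) = z j by abel] at h
    exact h.mono le_rfl (add_nonneg (hc j) (mul_nonneg hδ (hc j))) (by nlinarith [hc j])
  have h1 : φ y = ∑ s : Finset (Fin n), φ (s.piecewise z (y - z)) := by
    rw [← φ.map_add_univ z (y - z)]
    congr 1
    abel
  have h2 : φ y - φ z = ∑ s ∈ Finset.univ.erase Finset.univ, φ (s.piecewise z (y - z)) := by
    rw [h1, ← Finset.add_sum_erase _ _ (Finset.mem_univ Finset.univ), Finset.piecewise_univ,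
      add_sub_cancel_left]
  rw [h2]
  have h3 : ∀ s ∈ (Finset.univ : Finset (Finset (Fin n))).erase Finset.univ,
      ‖φ (s.piecewise z (y - z))‖ ≤ 2 ^ n * A * δ * ∏ j, c j := by
    intro s hs
    obtain ⟨i, hi⟩ : ∃ i, i ∉ s := by
      by_contra! h
      exact (Finset.mem_erase.1 hs).1 (Finset.eq_univ_iff_forall.2 h)
    refine (hφ (s.piecewise z (y - z)) (s.piecewise (fun j => 2 * c j) fun j => δ * c j)
      (fun j => ?_) fun j => ?_).trans ?_
    · by_cases hj : j ∈ s
      · simpa [hj] using hc j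
      · simpa [hj] using mul_nonneg hδ (hc j)
    · by_cases hj : j ∈ s
      · simpa [hj] using hz' j
      · simpa [hj] using hz j
    · have h4 : ∏ j, s.piecewise (fun j => 2 * c j) (fun j => δ * c j) j =
          (∏ j, if j ∈ s then 2 else δ) * ∏ j, c j := by
        rw [← Finset.prod_mul_distrib]
        refine Finset.prod_congr rfl fun j _ => ?_
        by_cases hj : j ∈ s <;> simp [hj]
      have h5 : (∏ j, if j ∈ s then (2 : ℝ) else δ) ≤ δ * 2 ^ n := by
        rw [← Finset.mul_prod_erase _ _ (Finset.mem_univ i), if_neg hi]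
        refine mul_le_mul_of_nonneg_left ?_ hδ
        refine (Finset.prod_le_prod (g := fun _ => (2 : ℝ)) (fun j _ => ?_) fun j _ => ?_).trans ?_
        · split_ifs <;> linarith
        · split_ifs <;> linarith
        · rw [Finset.prod_const]
          exact pow_le_pow_right₀ (by norm_num) (Finset.card_erase_le.trans (by simp))
      rw [h4]
      have h6 : 0 ≤ ∏ j, c j := Finset.prod_nonneg fun j _ => hc j
      calc _ ≤ A * ((δ * 2 ^ n) * ∏ j, c j) := by gcongr
        _ = _ := by ring
  have h6 : 0 ≤ ∏ j, c j := Finset.prod_nonneg fun j _ => hc j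
  refine (norm_sum_le_of_le _ h3).trans ?_
  rw [Finset.sum_const, nsmul_eq_mul]
  have h7 : ((Finset.univ.erase Finset.univ : Finset (Finset (Fin n))).card : ℝ) ≤ 2 ^ n := by
    have : (Finset.univ.erase Finset.univ : Finset (Finset (Fin n))).card ≤ 2 ^ n :=
      Finset.card_erase_le.trans (by simp)
    exact_mod_cast this
  calc _ ≤ 2 ^ n * (2 ^ n * A * δ * ∏ j, c j) := by gcongr
    _ = _ := by
      rw [show (4 : ℝ) = 2 * 2 by norm_num, mul_pow]
      ring

/-! ### Polarization -/

/-- Passing to complements leaves the alternating sum over the subsets of tᶜ, which vanishes unless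
tᶜ is empty. -/
theorem sum_neg_one_pow_card_compl {n : ℕ} (t : Finset (Fin n)) :
    ∑ s : Finset (Fin n), (if t ⊆ s then (-1 : ℂ) ^ sᶜ.card else 0) =
      if t = Finset.univ then 1 else 0 := by
  classical
  rw [← Equiv.sum_comp (Equiv.ofBijective _ (compl_bijective : Function.Bijective
    (compl : Finset (Fin n) → _)))]
  have h := Finset.sum_powerset_neg_one_pow_card (x := tᶜ)
  simp only [Equiv.ofBijective_apply, compl_compl]
  rw [← Finset.sum_filter]
  have h2 : Finset.univ.filter (fun s : Finset (Fin n) => t ⊆ sᶜ) = tᶜ.powerset := by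
    ext s
    simp only [Finset.mem_filter, Finset.mem_univ, true_and, Finset.mem_powerset]
    exact ⟨fun h => by simpa using Finset.compl_subset_compl.2 h,
      fun h => by simpa using Finset.compl_subset_compl.2 h⟩
  rw [h2]
  have h3 := congrArg (Int.cast : ℤ → ℂ) h
  push_cast at h3
  rw [h3]
  simp [Finset.compl_eq_empty_iff]

/-- Polarization by inclusion-exclusion: after expansion over maps f, only those with full image
survive, and these are the permutations. No symmetry of F is needed, so the formula also serves for
products of distinct functionals. -/
theorem sum_perm_eq_sum_finset {n : ℕ} {E : Type*} [AddCommGroup E] [Module ℂ E]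
    (F : MultilinearMap ℂ (fun _ : Fin n => E) ℂ) (x : Fin n → E) :
    ∑ σ : Equiv.Perm (Fin n), F (x ∘ σ) =
      ∑ s : Finset (Fin n), (-1 : ℂ) ^ sᶜ.card * F fun _ => ∑ i ∈ s, x i := by
  classical
  have h1 : ∀ s : Finset (Fin n), (F fun _ => ∑ i ∈ s, x i) =
      ∑ f : Fin n → Fin n, if Finset.univ.image f ⊆ s then F (x ∘ f) else 0 := by
    intro s
    rw [F.map_sum_finset (fun _ i => x i) fun _ => s, ← Finset.sum_filter]
    refine Finset.sum_congr ?_ fun _ _ => rfl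
    ext f
    simp [Fintype.mem_piFinset, Finset.image_subset_iff]
  simp only [h1, Finset.mul_sum]
  rw [Finset.sum_comm]
  have h2 : ∀ f : Fin n → Fin n, ∑ s : Finset (Fin n),
      (-1 : ℂ) ^ sᶜ.card * (if Finset.univ.image f ⊆ s then F (x ∘ f) else 0) =
      if Function.Bijective f then F (x ∘ f) else 0 := by
    intro f
    have h3 := sum_neg_one_pow_card_compl (Finset.univ.image f)
    calc _ = (∑ s : Finset (Fin n),
          (if Finset.univ.image f ⊆ s then (-1 : ℂ) ^ sᶜ.card else 0)) * F (x ∘ f) := by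
          rw [Finset.sum_mul]
          refine Finset.sum_congr rfl fun s _ => ?_
          split_ifs <;> simp
      _ = _ := by
          rw [h3]
          have h4 : Finset.univ.image f = Finset.univ ↔ Function.Bijective f := by
            rw [← Finite.surjective_iff_bijective, Finset.eq_univ_iff_forall]
            simp [Function.Surjective]
          simp [h4]
  simp only [h2]
  rw [← Finset.sum_filter]
  refine Finset.sum_bij (fun σ _ => ⇑σ)
    (fun σ _ => Finset.mem_filter.2 ⟨Finset.mem_univ _, σ.bijective⟩)
    (fun σ _ τ _ h => DFunLike.coe_injective h) (fun f hf => ?_) fun σ _ => rfl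
  exact ⟨Equiv.ofBijective f ((Finset.mem_filter.1 hf).2), Finset.mem_univ _, rfl⟩

/-- A symmetric multilinear form is determined by its diagonal. -/
theorem factorial_mul_apply_eq {n : ℕ} (φ : G.Kernel n) (x : Fin n → G.DualC) :
    (n.factorial : ℂ) * φ.1 x =
      ∑ s : Finset (Fin n), (-1 : ℂ) ^ sᶜ.card * φ.1 fun _ => ∑ i ∈ s, x i := by
  rw [← sum_perm_eq_sum_finset φ.1 x]
  simp only [φ.2.1]
  rw [Finset.sum_const, Finset.card_univ, Fintype.card_perm, Fintype.card_fin, nsmul_eq_mul]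

/-- `η ↦ ⟨x | η⟩` as a linear functional on `𝒩_ℂ`. -/
noncomputable def pairLinRight (x : G.DualC) : G.NC →ₗ[ℂ] ℂ where
  toFun η := pair x η
  map_add' η ξ := by
    change x (η.re + ξ.re) + Complex.I * x (η.im + ξ.im) = _
    simp only [map_add, pair]
    ring
  map_smul' c η := by
    simp only [pair, Cplx.smul_re, Cplx.smul_im, map_add, map_sub, map_smul, RingHom.id_apply,
      Complex.real_smul, smul_eq_mul]
    linear_combination (x η.re + Complex.I * x η.im) * Complex.re_add_im c -
      c.im * x η.im * Complex.I_sq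

theorem pairLinRight_apply (x : G.DualC) (η : G.NC) : pairLinRight x η = pair x η := rfl

theorem tensorPow_apply (n : ℕ) (η : G.NC) (y : Fin n → G.DualC) :
    (tensorPow n η).1 y = ∏ j, pair (y j) η := by
  simp [tensorPow, pairLin]

/-- An element of `𝒩` as an element of `𝒩_ℂ`. -/
noncomputable def ofN (θ : G.N) : G.NC := (θ, 0)

theorem pair_ofN (x : G.DualC) (θ : G.N) : pair x (ofN θ) = x θ := by
  change x θ + Complex.I * x 0 = x θ
  simp

/-- The form `φ ∘ P^{⊗n}`, for `P` of finite rank, is a linear combination of tensor powers. -/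
theorem exists_span_eq_comp_finRank {n m : ℕ} (φ : G.Kernel n) (t : Fin m → G.N)
    (ψ : Fin m → G.DualC) :
    ∃ κ ∈ Submodule.span ℂ (Set.range (tensorPow (G := G) n)),
      κ.1 = φ.1.compLinearMap fun _ => finRank t ψ := by
  classical
  refine ⟨(n.factorial : ℂ)⁻¹ • ∑ r : Fin n → Fin m, φ.1 (ψ ∘ r) •
    ∑ s : Finset (Fin n), (-1 : ℂ) ^ sᶜ.card • tensorPow n (∑ i ∈ s, ofN (t (r i))), ?_, ?_⟩
  · refine Submodule.smul_mem _ _ (Submodule.sum_mem _ fun r _ => Submodule.smul_mem _ _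
      (Submodule.sum_mem _ fun s _ => Submodule.smul_mem _ _ (Submodule.subset_span ⟨_, rfl⟩)))
  · refine MultilinearMap.ext fun y => ?_
    have hexp : ∀ z : Fin n → G.DualC, (φ.1.compLinearMap fun _ => finRank t ψ) z =
        ∑ r : Fin n → Fin m, (∏ j, z j (t (r j))) * φ.1 (ψ ∘ r) := by
      intro z
      rw [MultilinearMap.compLinearMap_apply]
      simp only [finRank_apply]
      rw [MultilinearMap.map_sum]
      simp only [MultilinearMap.map_smul_univ]
      rfl
    have hsym : ∀ σ : Equiv.Perm (Fin n), (φ.1.compLinearMap fun _ => finRank t ψ) (y ∘ σ) =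
        (φ.1.compLinearMap fun _ => finRank t ψ) y := fun σ =>
      φ.2.1 σ fun j => finRank t ψ (y j)
    have h1 : (n.factorial : ℂ) * (φ.1.compLinearMap fun _ => finRank t ψ) y =
        ∑ σ : Equiv.Perm (Fin n), (φ.1.compLinearMap fun _ => finRank t ψ) (y ∘ σ) := by
      simp only [hsym]
      rw [Finset.sum_const, Finset.card_univ, Fintype.card_perm, Fintype.card_fin, nsmul_eq_mul]
    -- Polarization is applied to the product of the functionals y j, with the vectors t (r i) as
    -- variables; this produces tensor powers of sums of the t's.
    have h2 : ∀ r : Fin n → Fin m, ∑ σ : Equiv.Perm (Fin n), ∏ j, y (σ j) (t (r j)) =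
        ∑ s : Finset (Fin n), (-1 : ℂ) ^ sᶜ.card *
          (tensorPow n (∑ i ∈ s, ofN (t (r i)))).1 y := by
      intro r
      have h3 := sum_perm_eq_sum_finset ((MultilinearMap.mkPiAlgebra ℂ (Fin n) ℂ).compLinearMap
        fun j => pairLinRight (y j)) fun i => ofN (t (r i))
      simp only [MultilinearMap.compLinearMap_apply, MultilinearMap.mkPiAlgebra_apply,
        Function.comp_apply, pairLinRight_apply, pair_ofN] at h3
      simp only [tensorPow_apply]
      rw [← h3, ← Equiv.sum_comp (Equiv.inv (Equiv.Perm (Fin n)))]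
      refine Finset.sum_congr rfl fun σ _ => ?_
      rw [← Equiv.prod_comp σ]
      simp
    have h4 : (n.factorial : ℂ) ≠ 0 := by exact_mod_cast n.factorial_ne_zero
    rw [← mul_right_inj' h4, h1]
    simp only [hexp, Function.comp_apply]
    rw [Finset.sum_comm]
    simp only [← Finset.sum_mul, h2]
    have h5 : ∀ (ι : Type) (s : Finset ι) (κ : ι → G.Kernel n),
        (∑ i ∈ s, κ i).1 y = ∑ i ∈ s, (κ i).1 y := by
      intro ι s κ
      exact map_sum (evalAt y) κ s
    have h6 : ∀ (a : ℂ) (κ : G.Kernel n), (a • κ).1 y = a * κ.1 y := fun a κ => rfl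
    rw [h6, h5]
    simp only [h6, h5]
    rw [mul_inv_cancel_left₀ h4]
    exact Finset.sum_congr rfl fun r _ => mul_comm _ _

/-- A continuous functional on `𝒩_ℂ^{⊗̂ n}` is determined by its values on tensor powers. -/
theorem IsNuclear.eq_zero_of_tensorPow (hG : G.IsNuclear) {n : ℕ} (P : G.Kernel n →ₗ[ℂ] ℂ)
    {p : ℕ} {C : ℝ} (hP : ∀ φ, ‖P φ‖ ≤ C * kernelNorm n p φ)
    (h0 : ∀ η, P (tensorPow n η) = 0) : P = 0 := by
  refine LinearMap.ext fun φ => ?_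
  obtain ⟨q, -, D, hD, hq⟩ := hG.exists_kernelNorm_le p
  obtain ⟨r, hqr, hr⟩ := hG.exists_finRank q
  have hφ := formBound_kernelNorm (p := r) φ
  set A := 2 ^ n * kernelNorm n r φ
  have hA : 0 ≤ A := mul_nonneg (by positivity) (apply_nonneg _ _)
  -- P kills the approximation κ of φ, which lies in the span of the tensor powers, so only the
  -- error of size δ contributes.
  have key : ∀ δ : ℝ, 0 < δ → δ ≤ 1 → ‖P φ‖ ≤ |C| * (D ^ n * (4 ^ n * A)) * δ := by
    intro δ hδ hδ1
    obtain ⟨m, t, ψ, hψ⟩ := hr δ hδ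
    obtain ⟨κ, hκ, hκ'⟩ := exists_span_eq_comp_finRank φ t ψ
    have h1 : P κ = 0 := by
      have : Submodule.span ℂ (Set.range (tensorPow (G := G) n)) ≤ LinearMap.ker P := by
        rw [Submodule.span_le]
        rintro _ ⟨η, rfl⟩
        exact h0 η
      exact this hκ
    have h2 : FormBound q (φ - κ).1 (4 ^ n * A * δ) := fun y c hc hy => by
      change ‖φ.1 y - κ.1 y‖ ≤ _
      rw [hκ']
      exact hφ.norm_sub_le hA hδ.le hδ1 hc
        (fun j => (hy j).mono hqr (hc j) le_rfl) fun j => hψ _ _ (hc j) (hy j)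
    have h3 := hq q le_rfl n (φ - κ) _ (by positivity) h2
    calc ‖P φ‖ = ‖P (φ - κ)‖ := by rw [map_sub, h1, sub_zero]
      _ ≤ C * kernelNorm n p (φ - κ) := hP _
      _ ≤ |C| * kernelNorm n p (φ - κ) :=
        mul_le_mul_of_nonneg_right (le_abs_self C) (apply_nonneg _ _)
      _ ≤ |C| * (D ^ n * (4 ^ n * A * δ)) := by gcongr
      _ = _ := by ring
  have h1 : ‖P φ‖ ≤ 0 := by
    set M := |C| * (D ^ n * (4 ^ n * A))
    have hM : 0 ≤ M := by positivity
    by_contra! h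
    have h2 := key (min 1 (‖P φ‖ / (2 * (M + 1)))) (by positivity) (min_le_left _ _)
    have h3 : M * min 1 (‖P φ‖ / (2 * (M + 1))) ≤ M * (‖P φ‖ / (2 * (M + 1))) :=
      mul_le_mul_of_nonneg_left (min_le_right _ _) hM
    have h4 : M * (‖P φ‖ / (2 * (M + 1))) = ‖P φ‖ / 2 * (M / (M + 1)) := by
      field_simp
    have h5 : M / (M + 1) ≤ 1 := by
      rw [div_le_one (by positivity)]
      linarith
    nlinarith
  exact norm_le_zero_iff.1 h1

/-! ### Kernels are determined by the polynomial function -/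

theorem eq_sum_lof (φ : G.Kernels) {s : Finset ℕ} (hs : ∀ n ∉ s, φ n = 0) :
    φ = ∑ n ∈ s, DirectSum.lof ℂ ℕ (fun n => G.Kernel n) n (φ n) := by
  classical
  refine DFinsupp.ext fun k => ?_
  rw [DFinsupp.finsetSum_apply]
  by_cases hk : k ∈ s
  · rw [Finset.sum_eq_single_of_mem k hk]
    · exact (DirectSum.lof_apply (M := fun n => G.Kernel n) ℂ k (φ k)).symm
    · intro n _ hn
      exact DFinsupp.single_eq_of_ne hn.symm
  · rw [hs k hk]
    refine (Finset.sum_eq_zero fun n hn => ?_).symm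
    exact DFinsupp.single_eq_of_ne fun h => hk (h ▸ hn)

theorem toModule_eq_sum {V : Type*} [AddCommGroup V] [Module ℂ V] (f : ∀ n, G.Kernel n →ₗ[ℂ] V)
    (φ : G.Kernels) {s : Finset ℕ} (hs : ∀ n ∉ s, φ n = 0) :
    DirectSum.toModule ℂ ℕ V f φ = ∑ n ∈ s, f n (φ n) := by
  classical
  have h := congrArg (DirectSum.toModule ℂ ℕ V f) (eq_sum_lof φ hs)
  rw [h, map_sum]
  exact Finset.sum_congr rfl fun n _ => 
    DirectSum.toModule_lof (M := fun n => G.Kernel n) ℂ n (φ n)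

theorem evalPoly_eq_sum (φ : G.Poly) (x : G.Dual) {s : Finset ℕ} (hs : ∀ n ∉ s, φ n = 0) :
    evalPoly φ x = ∑ n ∈ s, (φ n).1 fun _ => toDualC x :=
  toModule_eq_sum _ φ hs

theorem toDualC_smul (r : ℝ) (x : G.Dual) : toDualC (r • x) = (r : ℂ) • toDualC x := by
  ext θ
  simp [toDualC]

theorem toDualC_sum {ι : Type*} (s : Finset ι) (x : ι → G.Dual) :
    toDualC (∑ i ∈ s, x i) = ∑ i ∈ s, toDualC (x i) := by
  ext θ
  simp [toDualC]

theorem exists_eq_sum_toDualC (y : G.DualC) :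
    ∃ x : Fin 2 → G.Dual, y = ∑ b : Fin 2, (Complex.I ^ (b : ℕ)) • toDualC (x b) := by
  refine ⟨![Complex.reCLM.comp y, Complex.imCLM.comp y], ?_⟩
  ext θ
  rw [← Complex.re_add_im (y θ)]
  simp [toDualC, mul_comm]

/-- Polarization kills φ on real functionals; real and imaginary parts and complex multilinearity do
the rest. -/
theorem kernel_eq_zero_of_diagonal {n : ℕ} (φ : G.Kernel n)
    (h : ∀ x : G.Dual, φ.1 (fun _ => toDualC x) = 0) : φ = 0 := by
  classical
  have h4 : (n.factorial : ℂ) ≠ 0 := by exact_mod_cast n.factorial_ne_zero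
  have h1 : ∀ x : Fin n → G.Dual, φ.1 (fun j => toDualC (x j)) = 0 := by
    intro x
    rw [← mul_right_inj' h4, factorial_mul_apply_eq, mul_zero]
    refine Finset.sum_eq_zero fun s _ => ?_
    rw [← toDualC_sum, h, mul_zero]
  refine Subtype.ext (MultilinearMap.ext fun y => ?_)
  choose x hx using fun j => exists_eq_sum_toDualC (y j)
  rw [funext hx, MultilinearMap.map_sum]
  simp only [MultilinearMap.map_smul_univ, h1, smul_zero, Finset.sum_const_zero]
  rfl

/-- On a real line r ↦ r x the function is a polynomial in r with infinitely many zeros, so each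
homogeneous part vanishes at x. This justifies recording polynomials by their kernels. -/
theorem eq_zero_of_evalPoly (φ : G.Poly) (h : ∀ x, evalPoly φ x = 0) : φ = 0 := by
  classical
  obtain ⟨s, hs⟩ := exists_support φ
  have h1 : ∀ n ∈ s, ∀ x : G.Dual, (φ n).1 (fun _ => toDualC x) = 0 := by
    intro n hn x
    let Q : Polynomial ℂ := ∑ k ∈ s, Polynomial.monomial k ((φ k).1 fun _ => toDualC x)
    have hQ : Q = 0 := by
      refine Polynomial.eq_zero_of_infinite_isRoot Q (Set.Infinite.mono ?_
        (Set.infinite_range_of_injective Complex.ofReal_injective))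
      rintro _ ⟨r, rfl⟩
      have h2 := h (r • x)
      rw [evalPoly_eq_sum φ _ hs] at h2
      simp only [Set.mem_ofPred_eq, Polynomial.IsRoot.def, Q, Polynomial.eval_finsetSum,
        Polynomial.eval_monomial]
      rw [← h2]
      refine Finset.sum_congr rfl fun k _ => ?_
      rw [toDualC_smul, MultilinearMap.map_smul_univ]
      simp [mul_comm]
    have h3 := congrArg (fun Q => Polynomial.coeff Q n) hQ
    simpa [Q, Polynomial.finsetSum_coeff, Polynomial.coeff_monomial, hn] using h3
  refine DFinsupp.ext fun n => ?_
  by_cases hn : n ∈ s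
  · exact kernel_eq_zero_of_diagonal _ (h1 n hn)
  · exact hs n hn

theorem evalPoly_smul (a : ℂ) (φ : G.Poly) (x : G.Dual) :
    evalPoly (a • φ) x = a * evalPoly φ x := map_smul _ _ _

theorem evalPoly_sub (φ ψ : G.Poly) (x : G.Dual) :
    evalPoly (φ - ψ) x = evalPoly φ x - evalPoly ψ x := map_sub _ _ _

theorem evalPoly_injective {φ ψ : G.Poly} (h : ∀ x, evalPoly φ x = evalPoly ψ x) : φ = ψ :=
  sub_eq_zero.1 (eq_zero_of_evalPoly _ fun x => by rw [evalPoly_sub, h x, sub_self])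


/-! ### Separability -/

/-- Finite-rank approximations with errors 1/(n + 1) have countably many finite-dimensional ranges,
whose span is dense. Separability makes the dual norm a countable supremum, hence measurable. -/
theorem IsNuclear.separableSpace_H (hG : G.IsNuclear) (p : ℕ) :
    TopologicalSpace.SeparableSpace (G.H p) := by
  obtain ⟨q, -, h⟩ := hG.exists_finite_rank p
  choose m t ψ hψ using fun n : ℕ => h (1 / ((n : ℝ) + 1)) (by positivity)
  have h1 : TopologicalSpace.IsSeparable (Set.range (G.proj p)) := by
    have h2 : TopologicalSpace.IsSeparable
        (Submodule.span ℝ (⋃ n, Set.range fun j => G.proj p (t n j)) : Set (G.H p)) :=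
      (TopologicalSpace.IsSeparable.iUnion fun n =>
        (Set.finite_range _).countable.isSeparable).span
    refine h2.closure.mono ?_
    rintro _ ⟨θ, rfl⟩
    rw [Metric.mem_closure_iff]
    intro ε hε
    obtain ⟨n, hn⟩ := exists_nat_gt (‖G.proj q θ‖ / ε)
    refine ⟨∑ j, ψ n j θ • G.proj p (t n j), ?_, ?_⟩
    · exact Submodule.sum_mem _ fun j _ => Submodule.smul_mem _ _
        (Submodule.subset_span (Set.mem_iUnion.2 ⟨n, ⟨j, rfl⟩⟩))
    · rw [dist_eq_norm]
      have h3 := hψ n θ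
      simp only [map_sub, map_sum, map_smul] at h3
      refine h3.trans_lt ?_
      rw [div_lt_iff₀ hε] at hn
      rw [one_div, inv_mul_lt_iff₀ (by positivity)]
      nlinarith
  have h2 := h1.closure
  rw [(hG.dense p).closure_range] at h2
  exact TopologicalSpace.isSeparable_univ_iff.1 h2

theorem IsNuclear.separableSpace_N (hG : G.IsNuclear) : TopologicalSpace.SeparableSpace G.N := by
  have := fun p => hG.separableSpace_H p
  have := fun p => UniformSpace.secondCountable_of_separable (G.H p)
  have : SecondCountableTopology (∀ p, G.H p) := inferInstance
  have : SecondCountableTopology G.N := TopologicalSpace.Subtype.secondCountableTopology _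
  infer_instance

/-! ### Moments of the measure -/

theorem measurable_apply (θ : G.N) : Measurable fun x : G.Dual => x θ :=
  (comap_measurable _).mono (le_iSup (fun θ : G.N =>
    MeasurableSpace.comap (fun x : G.Dual => x θ) inferInstance) θ) le_rfl

theorem continuous_ofN : Continuous (ofN : G.N → G.NC) :=
  Continuous.prodMk continuous_id continuous_const

theorem AnalyticLaplace.isFiniteMeasure {μ : Measure G.Dual} (hμ : AnalyticLaplace μ) :
    IsFiniteMeasure μ := by
  obtain ⟨U, h0, hU, -⟩ := hμ
  have h1 : Integrable (fun _ : G.Dual => (1 : ℂ)) μ := by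
    refine (hU 0 h0).congr (Filter.Eventually.of_forall fun x => ?_)
    have : pair (toDualC x) 0 = 0 := map_zero (pairLinRight (toDualC x))
    simp [this]
  exact (integrable_const_iff_isFiniteMeasure one_ne_zero).1 h1

/-- Continuity of the Laplace transform at 0 bounds it nearby; for real arguments the integrand is
positive, so this bounds the integral itself. -/
theorem AnalyticLaplace.exists_exp_bound {μ : Measure G.Dual} (hμ : AnalyticLaplace μ) :
    ∃ (p : ℕ) (δ K : ℝ), 0 < δ ∧ 0 < K ∧ ∀ θ : G.N, ‖G.proj p θ‖ < δ →
      ∫⁻ x, ENNReal.ofReal (Real.exp (x θ)) ∂μ ≤ ENNReal.ofReal K := by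
  obtain ⟨U, h0, hU, hUo, -, hc⟩ := hμ
  have h1 : {ξ | ξ ∈ U ∧ ‖laplace μ ξ‖ < ‖laplace μ (0 : G.NC)‖ + 1} ∈ 𝓝 (0 : G.NC) := by
    refine Filter.inter_mem (hUo.mem_nhds h0) ?_
    exact (hc.continuousAt (hUo.mem_nhds h0)).norm.eventually_lt continuousAt_const
      (lt_add_one _)
  have h2 : (ofN : G.N → G.NC) ⁻¹' _ ∈ 𝓝 0 := continuous_ofN.continuousAt.preimage_mem_nhds h1
  obtain ⟨p, δ, hδ, h⟩ := exists_norm_proj_lt_of_mem_nhds h2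
  refine ⟨p, δ, ‖laplace μ (0 : G.NC)‖ + 1, hδ, by positivity, fun θ hθ => ?_⟩
  obtain ⟨h3, h4⟩ := h θ hθ
  have h5 : ∀ x : G.Dual, Complex.exp (pair (toDualC x) (ofN θ)) = (Real.exp (x θ) : ℂ) := by
    intro x
    rw [pair_ofN]
    exact (Complex.ofReal_exp _).symm
  have h6 : Integrable (fun x : G.Dual => Real.exp (x θ)) μ := by
    refine (hU _ h3).norm.congr (Filter.Eventually.of_forall fun x => ?_)
    simp only [h5, Complex.norm_real, Real.norm_eq_abs, Real.abs_exp]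
  rw [← ofReal_integral_eq_lintegral_ofReal h6
    (Filter.Eventually.of_forall fun x => (Real.exp_pos _).le)]
  refine ENNReal.ofReal_le_ofReal (le_trans (le_of_eq ?_) h4.le)
  rw [laplace]
  simp only [h5]
  rw [integral_complex_ofReal, Complex.norm_real, Real.norm_of_nonneg]
  exact integral_nonneg fun x => (Real.exp_pos _).le

/-- From u^{2m}/(2m)! ≤ e^{|u|} ≤ e^u + e^{-u} on the ball of radius δ, extended by homogeneity. The
two exponentials give 2K; scaling to norm δ/2 gives L = 2/δ. -/
theorem AnalyticLaplace.exists_moment_bound {μ : Measure G.Dual} (hμ : AnalyticLaplace μ) :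
    ∃ (p : ℕ) (K L : ℝ), 0 < K ∧ 0 < L ∧ ∀ (θ : G.N) (m : ℕ),
      ∫⁻ x, ENNReal.ofReal ((x θ) ^ (2 * m)) ∂μ ≤
        ENNReal.ofReal (K * (2 * m).factorial * (L * ‖G.proj p θ‖) ^ (2 * m)) := by
  obtain ⟨p, δ, K, hδ, hK, h⟩ := hμ.exists_exp_bound
  refine ⟨p, 2 * K, 2 / δ, by positivity, by positivity, fun θ m => ?_⟩
  have key : ∀ τ : G.N, ‖G.proj p τ‖ < δ → ∫⁻ x, ENNReal.ofReal ((x τ) ^ (2 * m)) ∂μ ≤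
      ENNReal.ofReal (2 * K * (2 * m).factorial) := by
    intro τ hτ
    have hpt : ∀ x : G.Dual, ENNReal.ofReal ((x τ) ^ (2 * m)) ≤
        ENNReal.ofReal (2 * m).factorial * (ENNReal.ofReal (Real.exp (x τ)) +
          ENNReal.ofReal (Real.exp (x (-τ)))) := by
      intro x
      rw [← ENNReal.ofReal_add (Real.exp_pos _).le (Real.exp_pos _).le,
        ← ENNReal.ofReal_mul (by positivity)]
      refine ENNReal.ofReal_le_ofReal ?_
      have h1 := Real.pow_div_factorial_le_exp |x τ| (abs_nonneg _) (2 * m)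
      rw [div_le_iff₀ (by positivity), (even_two_mul m).pow_abs] at h1
      have h2 : Real.exp |x τ| ≤ Real.exp (x τ) + Real.exp (x (-τ)) := by
        rw [map_neg]
        rcases abs_cases (x τ) with ⟨h, -⟩ | ⟨h, -⟩ <;> rw [h]
        · linarith [Real.exp_pos (-(x τ))]
        · linarith [Real.exp_pos (x τ)]
      have h3 : (0 : ℝ) ≤ (2 * m).factorial := by positivity
      nlinarith
    refine (lintegral_mono hpt).trans ?_
    have hm : ∀ τ : G.N, Measurable fun x : G.Dual => ENNReal.ofReal (Real.exp (x τ)) :=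
      fun τ => (Real.measurable_exp.comp (measurable_apply τ)).ennreal_ofReal
    rw [lintegral_const_mul _ ((hm τ).fun_add (hm (-τ))), lintegral_add_left (hm _)]
    have h4 := add_le_add (h τ hτ) (h (-τ) (by rwa [map_neg, norm_neg]))
    refine (mul_le_mul_right h4 _).trans (le_of_eq ?_)
    rw [← ENNReal.ofReal_add hK.le hK.le, ← ENNReal.ofReal_mul (by positivity)]
    congr 1
    ring
  by_cases h0 : ‖G.proj p θ‖ = 0
  · rcases Nat.eq_zero_or_pos m with rfl | hm
    · have h1 := key 0 (by simpa using hδ)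
      simpa using h1
    · have h2 : θ = 0 := proj_injective p (by rw [norm_eq_zero.1 h0, map_zero])
      simp [h2, hm.ne']
  · have hpos : 0 < ‖G.proj p θ‖ := lt_of_le_of_ne (norm_nonneg _) (Ne.symm h0)
    have h1 := key ((δ / (2 * ‖G.proj p θ‖)) • θ) (by
      rw [map_smul, norm_smul, Real.norm_of_nonneg (by positivity)]
      field_simp
      linarith)
    have h2 : ∀ x : G.Dual, ENNReal.ofReal ((x θ) ^ (2 * m)) =
        ENNReal.ofReal ((2 / δ * ‖G.proj p θ‖) ^ (2 * m)) *
          ENNReal.ofReal ((x ((δ / (2 * ‖G.proj p θ‖)) • θ)) ^ (2 * m)) := by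
      intro x
      rw [← ENNReal.ofReal_mul (by positivity), ← mul_pow, map_smul, smul_eq_mul]
      congr 2
      field_simp
    simp only [h2]
    rw [lintegral_const_mul _ ((measurable_apply _).pow_const _).ennreal_ofReal]
    refine (mul_le_mul_right h1 _).trans (le_of_eq ?_)
    rw [← ENNReal.ofReal_mul (by positivity)]
    congr 1
    ring

/-- The moments of `|x|²` over a finite-dimensional subspace. -/
theorem lintegral_sum_sq_pow_le {μ : Measure G.Dual} {p : ℕ} {K L : ℝ} (hK : 0 < K) (hL : 0 < L)
    (h : ∀ (θ : G.N) (m : ℕ), ∫⁻ x, ENNReal.ofReal ((x θ) ^ (2 * m)) ∂μ ≤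
        ENNReal.ofReal (K * (2 * m).factorial * (L * ‖G.proj p θ‖) ^ (2 * m)))
    {d : ℕ} (θ : Fin d → G.N) (hθ : ∀ j, θ j ≠ 0) {C : ℝ} (hC : ∑ j, ‖G.proj p (θ j)‖ ^ 2 ≤ C)
    (m : ℕ) :
    ∫⁻ x, ENNReal.ofReal ((∑ j, (x (θ j)) ^ 2) ^ m) ∂μ ≤
      ENNReal.ofReal (K * (2 * m).factorial * (L ^ 2 * C) ^ m) := by
  set w : Fin d → ℝ := fun j => ‖G.proj p (θ j)‖ ^ 2 with hw
  have hw0 : ∀ j, 0 < w j := fun j => by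
    refine pow_pos (norm_pos_iff.2 fun h0 => hθ j (proj_injective p ?_)) 2
    rw [h0, map_zero]
  set W := ∑ j, w j with hW
  have hWC : (L ^ 2 * W) ^ m ≤ (L ^ 2 * C) ^ m := by
    have : 0 ≤ W := Finset.sum_nonneg fun j _ => (hw0 j).le
    gcongr
  refine le_trans ?_ (ENNReal.ofReal_le_ofReal (mul_le_mul_of_nonneg_left hWC (by positivity)))
  rcases Nat.eq_zero_or_pos d with rfl | hd
  · rcases Nat.eq_zero_or_pos m with rfl | hm
    · simpa using h 0 0
    · simp [hm.ne', hW]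
  have : Nonempty (Fin d) := ⟨⟨0, hd⟩⟩
  have hWpos : 0 < W := Finset.sum_pos (fun j _ => hw0 j) Finset.univ_nonempty
  -- Jensen with the weights w_j/W. They are chosen so that every summand has the same moment bound
  -- (L² W)^m, which makes the result independent of the dimension d.
  have hpt : ∀ x : G.Dual, (∑ j, (x (θ j)) ^ 2) ^ m ≤
      ∑ j, w j / W * (W / w j) ^ m * (x (θ j)) ^ (2 * m) := by
    intro x
    have h1 := Real.pow_arith_mean_le_arith_mean_pow Finset.univ (fun j => w j / W)
      (fun j => W / w j * (x (θ j)) ^ 2) (fun j _ => div_nonneg (hw0 j).le hWpos.le)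
      (by rw [← Finset.sum_div, div_self hWpos.ne'])
      (fun j _ => mul_nonneg (div_nonneg hWpos.le (hw0 j).le) (sq_nonneg _)) m
    refine le_trans (le_of_eq ?_) (h1.trans (le_of_eq ?_))
    · congr 1
      refine Finset.sum_congr rfl fun j _ => ?_
      have := (hw0 j).ne'
      field_simp
    · refine Finset.sum_congr rfl fun j _ => ?_
      rw [mul_pow, pow_mul, mul_assoc]
  refine (lintegral_mono fun x => ENNReal.ofReal_le_ofReal (hpt x)).trans ?_
  have hcoef : ∀ j, 0 ≤ w j / W * (W / w j) ^ m := fun j => by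
    have := (hw0 j).le
    positivity
  have hpt2 : ∀ x : G.Dual, ENNReal.ofReal
      (∑ j, w j / W * (W / w j) ^ m * (x (θ j)) ^ (2 * m)) =
      ∑ j, ENNReal.ofReal (w j / W * (W / w j) ^ m) * ENNReal.ofReal ((x (θ j)) ^ (2 * m)) := by
    intro x
    rw [ENNReal.ofReal_sum_of_nonneg fun j _ => mul_nonneg (hcoef j)
      ((even_two_mul m).pow_nonneg _)]
    exact Finset.sum_congr rfl fun j _ => ENNReal.ofReal_mul (hcoef j)
  simp only [hpt2]
  have hm : ∀ j, Measurable fun x : G.Dual => ENNReal.ofReal ((x (θ j)) ^ (2 * m)) := fun j =>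
    ((measurable_apply _).pow_const _).ennreal_ofReal
  rw [lintegral_finsetSum _ fun j _ => (hm j).const_mul _]
  have hterm : ∀ j ∈ Finset.univ, ∫⁻ x : G.Dual, ENNReal.ofReal (w j / W * (W / w j) ^ m) *
      ENNReal.ofReal ((x (θ j)) ^ (2 * m)) ∂μ ≤
      ENNReal.ofReal (w j / W * (K * (2 * m).factorial * (L ^ 2 * W) ^ m)) := by
    intro j _
    rw [lintegral_const_mul _ (hm j)]
    refine (mul_le_mul_right (h _ _) _).trans (le_of_eq ?_)
    rw [← ENNReal.ofReal_mul (hcoef j)]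
    congr 1
    have h2 : (L * ‖G.proj p (θ j)‖) ^ (2 * m) = (L ^ 2 * w j) ^ m := by
      rw [pow_mul, mul_pow, hw]
    have h3 : (W / w j) ^ m * (L ^ 2 * w j) ^ m = (L ^ 2 * W) ^ m := by
      rw [← mul_pow]
      have := (hw0 j).ne'
      congr 1
      field_simp
    rw [h2, ← h3]
    ring
  refine (Finset.sum_le_sum hterm).trans (le_of_eq ?_)
  rw [← ENNReal.ofReal_sum_of_nonneg fun j _ => by
    have := (hw0 j).le
    positivity]
  rw [← Finset.sum_mul, ← Finset.sum_div, div_self hWpos.ne', one_mul]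

theorem factorial_two_mul_le (j : ℕ) :
    ((2 * j).factorial : ℝ) ≤ 4 ^ j * (j.factorial : ℝ) ^ 2 := by
  have h1 : (2 * j).factorial = (2 * j).choose j * j.factorial * j.factorial := by
    have := Nat.add_choose_mul_factorial_mul_factorial j j
    rw [two_mul]
    exact this.symm
  have h2 : ((2 * j).choose j : ℝ) ≤ 2 ^ (2 * j) := by exact_mod_cast Nat.choose_le_two_pow _ _
  rw [h1, sq]
  push_cast
  rw [mul_assoc]
  refine mul_le_mul_of_nonneg_right (h2.trans (le_of_eq ?_)) (by positivity)
  rw [pow_mul]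
  norm_num

/-- The measure `μ` is carried by `H_{-p}`, with the bound `S` of `|x|_{-p}`, whose moments grow
at most like `K j! A^j`. -/
structure MomentBound (μ : Measure G.Dual) (p : ℕ) (S : G.Dual → ℝ) (K A : ℝ) : Prop where
  K_pos : 0 < K
  A_pos : 0 < A
  nonneg : ∀ x, 0 ≤ S x
  dualBound : ∀ᵐ x ∂μ, DualBound p (toDualC x) (S x)
  integrable : ∀ j : ℕ, Integrable (fun x => S x ^ j) μ
  integral_le : ∀ j : ℕ, ∫ x, S x ^ j ∂μ ≤ K * j.factorial * A ^ j

/-- S is the norm |x|_{-(p₁+k)}, computed as a supremum over a dense sequence. On finitely many of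
its vectors it is at most the Euclidean norm of x in an orthonormal basis of their span; the
Hilbert-Schmidt embedding bounds the sum of the squared p₁-norms of that basis by C, so the moments
are bounded uniformly in the dimension. Monotone convergence finishes. -/
theorem IsNuclear.exists_momentBound (hG : G.IsNuclear) {μ : Measure G.Dual}
    (hμ : AnalyticLaplace μ) : ∃ p S K A, MomentBound μ p S K A := by
  have := hμ.isFiniteMeasure
  obtain ⟨p₁, K, L, hK, hL, hmom⟩ := hμ.exists_moment_bound
  obtain ⟨k, -, C, hC⟩ := hG.hilbertSchmidt p₁
  have hC0 : 0 ≤ C := by simpa using hC 0 Fin.elim0 ⟨fun i => i.elim0, fun i => i.elim0⟩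
  have := hG.separableSpace_N
  let v : ℕ → G.N := TopologicalSpace.denseSeq G.N
  have hv : DenseRange v := TopologicalSpace.denseRange_denseSeq G.N
  -- For v i = 0 the quotient is 0 by convention, which does not affect the supremum.
  let f : ℕ → G.Dual → ENNReal := fun i x =>
    ENNReal.ofReal (|x (v i)| / ‖G.proj (p₁ + k) (v i)‖)
  have hf : ∀ i, Measurable (f i) := fun i =>
    ((continuous_abs.measurable.comp (measurable_apply _)).div_const _).ennreal_ofReal
  let Sinf : G.Dual → ENNReal := fun x => ⨆ i, f i x
  have hSm : Measurable Sinf := Measurable.iSup hf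
  let g : ℕ → G.Dual → ENNReal := fun r x => ⨆ i, ⨆ (_ : i ≤ r), f i x
  have hgm : ∀ r, Measurable (g r) := fun r =>
    Measurable.iSup fun i => Measurable.iSup fun _ => hf i
  have hg : ∀ x, Monotone fun r => g r x := fun x r s hrs =>
    iSup_mono fun i => iSup_mono' fun hi => ⟨hi.trans hrs, le_rfl⟩
  have hgS : ∀ x, ⨆ r, g r x = Sinf x := fun x =>
    le_antisymm (iSup_le fun r => iSup_le fun i => iSup_le fun _ => le_iSup (fun i => f i x) i)
      (iSup_le fun i => le_iSup_of_le i (le_iSup₂_of_le i le_rfl le_rfl))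
  have hfin : ∀ r m : ℕ, ∫⁻ x, (g r x) ^ (2 * m) ∂μ ≤
      ENNReal.ofReal (K * (2 * m).factorial * (L ^ 2 * C) ^ m) := by
    intro r m
    obtain ⟨e, hmem, he⟩ := exists_orthFam_repr (p := p₁ + k) fun i : Fin (r + 1) =>
      G.proj (p₁ + k) (v i)
    have hrange : ∀ j, ∃ θ, G.proj (p₁ + k) θ = e.2.1 j := by
      intro j
      have h1 : Submodule.span ℝ (Set.range fun i : Fin (r + 1) => G.proj (p₁ + k) (v i)) ≤
          LinearMap.range (G.proj (p₁ + k)).toLinearMap := by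
        rw [Submodule.span_le]
        rintro _ ⟨i, rfl⟩
        exact ⟨v i, rfl⟩
      exact h1 (hmem j)
    choose θ hθ using hrange
    have hθ0 : ∀ j, θ j ≠ 0 := fun j h0 => by
      have h1 := e.2.2.1 j
      rw [← hθ j, h0, map_zero, norm_zero] at h1
      exact zero_ne_one h1
    have hCθ : ∑ j, ‖G.proj p₁ (θ j)‖ ^ 2 ≤ C := by
      simp only [← embIter_proj p₁ k, hθ]
      exact hC _ e.2.1 e.2.2
    refine le_trans (lintegral_mono fun x => ?_)
      (lintegral_sum_sq_pow_le hK hL hmom θ hθ0 hCθ m)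
    have h2 : g r x ≤ ENNReal.ofReal √(∑ j, (x (θ j)) ^ 2) := by
      refine iSup₂_le fun i hi => ENNReal.ofReal_le_ofReal ?_
      refine div_le_of_le_mul₀ (norm_nonneg _) (Real.sqrt_nonneg _) ?_
      have h3 := he ⟨i, Nat.lt_succ_of_le hi⟩
      have h4 : v i = ∑ j, (inner ℝ (e.2.1 j) (G.proj (p₁ + k) (v i)) : ℝ) • θ j := by
        refine proj_injective (p₁ + k) ?_
        simp only [map_sum, map_smul, hθ]
        exact h3
      have h5 := norm_sq_eq_sum_of_repr e h3
      have h6 : x (v i) = ∑ j, (inner ℝ (e.2.1 j) (G.proj (p₁ + k) (v i)) : ℝ) * x (θ j) := by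
        conv_lhs => rw [h4, map_sum]
        simp only [map_smul, smul_eq_mul]
      rw [h6, mul_comm, ← Real.sqrt_sq (norm_nonneg (G.proj (p₁ + k) (v i)))]
      refine (Finset.abs_sum_le_sum_abs _ _).trans ?_
      simp only [abs_mul]
      refine (Real.sum_mul_le_sqrt_mul_sqrt _ _ _).trans (le_of_eq ?_)
      simp only [sq_abs]
      rw [h5]
    refine (pow_le_pow_left' h2 (2 * m)).trans (le_of_eq ?_)
    rw [← ENNReal.ofReal_pow (Real.sqrt_nonneg _), pow_mul, Real.sq_sqrt
      (Finset.sum_nonneg fun j _ => sq_nonneg _)]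
  have hinf : ∀ m : ℕ, ∫⁻ x, (Sinf x) ^ (2 * m) ∂μ ≤
      ENNReal.ofReal (K * (2 * m).factorial * (L ^ 2 * C) ^ m) := by
    intro m
    refine le_of_tendsto' (lintegral_tendsto_of_tendsto_of_monotone
      (fun r => ((hgm r).pow_const (2 * m)).aemeasurable)
      (Filter.Eventually.of_forall fun x r s hrs => pow_le_pow_left' (hg x hrs) _)
      (Filter.Eventually.of_forall fun x => ?_)) fun r => hfin r m
    refine ((ENNReal.continuous_pow (2 * m)).tendsto _).comp ?_
    rw [← hgS x]
    exact tendsto_atTop_iSup (hg x)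
  -- Finiteness of the second moment already shows that μ is carried by H_{-(p₁+k)}.
  have htop : ∀ᵐ x ∂μ, Sinf x ≠ ⊤ := by
    have h1 := ae_lt_top (hSm.pow_const 2) (μ := μ)
      (ne_top_of_le_ne_top ENNReal.ofReal_ne_top (hinf 1))
    filter_upwards [h1] with x hx h
    rw [h] at hx
    simp at hx
  -- The 4 absorbs (2j)! ≤ 4^j (j!)²; the 1 keeps B positive.
  let B := √(4 * (L ^ 2 * (C + 1)))
  have hB : 0 < B := by positivity
  have hB2 : B ^ 2 = 4 * (L ^ 2 * (C + 1)) := Real.sq_sqrt (by positivity)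
  let K' := μ.real Set.univ + K
  have hK' : 0 < K' := by positivity
  have hlint : ∀ j : ℕ, ∫⁻ x, ENNReal.ofReal ((Sinf x).toReal ^ j) ∂μ ≤
      ENNReal.ofReal (K' * j.factorial * B ^ j) := by
    intro j
    -- Only even moments are known so far. With y = S^j, the inequality y ≤ s + y²/s reduces the
    -- j-th moment to the 2j-th, which is at most K s².
    set s : ℝ := j.factorial * B ^ j with hs
    have hs0 : 0 < s := by positivity
    have hpt : ∀ x, ENNReal.ofReal ((Sinf x).toReal ^ j) ≤
        ENNReal.ofReal s + ENNReal.ofReal s⁻¹ * Sinf x ^ (2 * j) := by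
      intro x
      have h1 : (Sinf x).toReal ^ j ≤ s + s⁻¹ * (Sinf x).toReal ^ (2 * j) := by
        rw [mul_comm 2 j, pow_mul]
        set y := (Sinf x).toReal ^ j
        have h2 : y * s ≤ s * s + y ^ 2 := by nlinarith [sq_nonneg (y - s), sq_nonneg (y + s)]
        calc y = s⁻¹ * (y * s) := by field_simp
          _ ≤ s⁻¹ * (s * s + y ^ 2) := by gcongr
          _ = _ := by field_simp
      refine (ENNReal.ofReal_le_ofReal h1).trans ?_
      rw [ENNReal.ofReal_add hs0.le (by positivity), ENNReal.ofReal_mul (p := s⁻¹) (by positivity),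
        ENNReal.ofReal_pow ENNReal.toReal_nonneg]
      gcongr
      exact ENNReal.ofReal_toReal_le
    refine (lintegral_mono hpt).trans ?_
    rw [lintegral_add_left measurable_const, lintegral_const, lintegral_const_mul _
      (hSm.pow_const _)]
    have h3 : ENNReal.ofReal s * μ Set.univ = ENNReal.ofReal (s * μ.real Set.univ) := by
      rw [ENNReal.ofReal_mul hs0.le, measureReal_def, ENNReal.ofReal_toReal (measure_ne_top _ _)]
    rw [h3]
    refine (add_le_add_right (mul_le_mul_right (hinf j) _) _).trans ?_
    rw [← ENNReal.ofReal_mul (by positivity), ← ENNReal.ofReal_add (by positivity)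
      (by positivity)]
    refine ENNReal.ofReal_le_ofReal ?_
    have h4 : K * (2 * j).factorial * (L ^ 2 * C) ^ j ≤ K * s ^ 2 := by
      have h5 : (L ^ 2 * C) ^ j ≤ (L ^ 2 * (C + 1)) ^ j := by
        gcongr
        linarith
      calc _ ≤ K * (4 ^ j * (j.factorial : ℝ) ^ 2) * (L ^ 2 * (C + 1)) ^ j := by
            gcongr
            exact factorial_two_mul_le j
        _ = K * ((j.factorial : ℝ) ^ 2 * (4 * (L ^ 2 * (C + 1))) ^ j) := by
            rw [mul_pow 4]
            ring
        _ = _ := by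
            rw [← hB2, hs, mul_pow, ← pow_mul, ← pow_mul, mul_comm 2 j]
    calc _ ≤ s * μ.real Set.univ + s⁻¹ * (K * s ^ 2) := by gcongr
      _ = K' * s := by
          field_simp
          rfl
      _ = _ := by rw [hs]; ring
  have hSr : Measurable fun x => (Sinf x).toReal := hSm.ennreal_toReal
  have hint : ∀ j : ℕ, Integrable (fun x => (Sinf x).toReal ^ j) μ := fun j =>
    ⟨(hSr.pow_const j).aestronglyMeasurable, by
      rw [hasFiniteIntegral_iff_ofReal (Filter.Eventually.of_forall fun x => by positivity)]
      exact (hlint j).trans_lt ENNReal.ofReal_lt_top⟩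
  refine ⟨p₁ + k, fun x => (Sinf x).toReal, K', B, hK', hB, fun x => ENNReal.toReal_nonneg, ?_,
    hint, fun j => ?_⟩
  · filter_upwards [htop] with x hx
    have h1 : ∀ θ : G.N, |x θ| ≤ (Sinf x).toReal * ‖G.proj (p₁ + k) θ‖ := by
      intro θ
      -- Both sides are continuous in θ, so the dense sequence suffices.
      refine hv.induction_on (p := fun θ => |x θ| ≤ (Sinf x).toReal * ‖G.proj (p₁ + k) θ‖) θ
        (isClosed_le x.continuous.abs
          (continuous_const.mul (G.proj (p₁ + k)).continuous.norm)) fun i => ?_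
      have h2 : f i x ≤ Sinf x := le_iSup (fun i => f i x) i
      have h3 := (ENNReal.ofReal_le_iff_le_toReal hx).1 h2
      by_cases h0 : ‖G.proj (p₁ + k) (v i)‖ = 0
      · have h4 : v i = 0 := proj_injective (p₁ + k) (by rw [norm_eq_zero.1 h0, map_zero])
        simp [h4]
      · exact (div_le_iff₀ (lt_of_le_of_ne (norm_nonneg _) (Ne.symm h0))).1 h3
    intro θ
    have h2 : ‖toDualC x θ‖ = |x θ| := Complex.norm_real _
    rw [h2]
    exact h1 θ
  · rw [integral_eq_lintegral_of_nonneg_ae (Filter.Eventually.of_forall fun x => by positivity)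
      (hSr.pow_const j).aestronglyMeasurable]
    exact ENNReal.toReal_le_of_le_ofReal (by positivity) (hlint j)


/-! ### Contraction of kernels with the moments of a measure -/

/-- Splitting of `n` slots into the first `n - k` and the last `k`. -/
def slotEquiv {n k : ℕ} (h : k ≤ n) : Fin (n - k) ⊕ Fin k ≃ Fin n :=
  finSumFinEquiv.trans (finCongr (Nat.sub_add_cancel h))

theorem slotEquiv_inl {n k : ℕ} (h : k ≤ n) (i : Fin (n - k)) :
    ((slotEquiv h (Sum.inl i) : Fin n) : ℕ) = i := by
  simp [slotEquiv]

theorem slotEquiv_inr {n k : ℕ} (h : k ≤ n) (i : Fin k) :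
    ((slotEquiv h (Sum.inr i) : Fin n) : ℕ) = n - k + i := by
  simp [slotEquiv]

/-- The form `(x₁, ..., x_{n-k}) ↦ ((y₁, ..., y_k) ↦ φ(x₁, ..., x_{n-k}, y₁, ..., y_k))`. -/
noncomputable def splitForm {n k : ℕ} (h : k ≤ n) (φ : G.Form n) :
    MultilinearMap ℂ (fun _ : Fin (n - k) => G.DualC) (G.Form k) :=
  (φ.domDomCongr (slotEquiv h).symm).currySum

theorem splitForm_apply {n k : ℕ} (h : k ≤ n) (φ : G.Form n) (x : Fin (n - k) → G.DualC)
    (y : Fin k → G.DualC) :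
    splitForm h φ x y = φ fun i => Sum.elim x y ((slotEquiv h).symm i) := rfl

theorem prod_slotEquiv {n k : ℕ} (h : k ≤ n) (s : ℝ) (c : Fin k → ℝ) :
    ∏ i, Sum.elim (fun _ => s) c ((slotEquiv h).symm i) = s ^ (n - k) * ∏ j, c j := by
  rw [Equiv.prod_comp (slotEquiv h).symm (Sum.elim (fun _ => s) c), Fintype.prod_sum_type]
  simp

theorem FormBound.splitForm {n k q : ℕ} (h : k ≤ n) {φ : G.Form n} {B : ℝ}
    (hφ : FormBound q φ B) {x : G.DualC} {s : ℝ} (hs : 0 ≤ s) (hx : DualBound q x s)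
    {y : Fin k → G.DualC} {c : Fin k → ℝ} (hc : ∀ j, 0 ≤ c j)
    (hy : ∀ j, DualBound q (y j) (c j)) :
    ‖splitForm h φ (fun _ => x) y‖ ≤ B * (s ^ (n - k) * ∏ j, c j) := by
  rw [splitForm_apply, ← prod_slotEquiv h]
  refine hφ _ _ (fun i => ?_) fun i => ?_
  · rcases (slotEquiv h).symm i with i | i
    · exact hs
    · exact hc i
  · rcases (slotEquiv h).symm i with i | i
    · exact hx
    · exact hy i

section Moments

variable {μ : Measure G.Dual} {p : ℕ} {S : G.Dual → ℝ} {K A : ℝ}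

theorem dualBound_zero {q : ℕ} {c : ℝ} (hc : 0 ≤ c) : DualBound q (0 : G.DualC) c := fun θ => by
  rw [zero_apply, norm_zero]
  positivity

/-- The form φ is not visibly measurable for the cylinder σ-algebra. Its finite-rank approximations
depend on x only through finitely many values x(t_j), and they converge wherever x ∈ H_{-p}, hence
almost everywhere. -/
theorem IsNuclear.aestronglyMeasurable_splitForm (hG : G.IsNuclear) (hm : MomentBound μ p S K A)
    {n k : ℕ} (h : k ≤ n) (φ : G.Kernel n) (y : Fin k → G.DualC) :
    AEStronglyMeasurable (fun x => splitForm h φ.1 (fun _ => toDualC x) y) μ := by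
  classical
  obtain ⟨q, hpq, c, hc, hy⟩ := exists_dualBound_family y p
  obtain ⟨r, hqr, hr⟩ := hG.exists_finRank q
  choose m t ψ hψ using fun i : ℕ => hr (1 / ((i : ℝ) + 1)) (by positivity)
  refine aestronglyMeasurable_of_tendsto_ae Filter.atTop
    (f := fun i x => splitForm h φ.1 (fun _ => finRank (t i) (ψ i) (toDualC x)) y)
    (fun i => ?_) ?_
  · have h1 : (fun x : G.Dual => splitForm h φ.1 (fun _ => finRank (t i) (ψ i) (toDualC x)) y) =
        fun x => ∑ ρ : Fin (n - k) → Fin (m i), (∏ j, (x (t i (ρ j)) : ℂ)) *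
          splitForm h φ.1 (fun j => ψ i (ρ j)) y := by
      funext x
      have h2 : ∀ z : G.DualC, finRank (t i) (ψ i) z = ∑ j, z (t i j) • ψ i j := fun z => rfl
      simp only [h2]
      rw [MultilinearMap.map_sum]
      simp only [MultilinearMap.map_smul_univ]
      rw [sum_apply]
      rfl
    rw [h1]
    refine (Finset.measurable_fun_sum _ fun ρ _ => (Finset.measurable_fun_prod _ fun j _ =>
      ?_).mul_const _).aestronglyMeasurable
    exact Complex.measurable_ofReal.comp (measurable_apply _)
  · filter_upwards [hm.dualBound] with x hx
    have hφ := formBound_kernelNorm (p := r) φ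
    have hB : 0 ≤ 2 ^ n * kernelNorm n r φ := mul_nonneg (by positivity) (apply_nonneg _ _)
    have key : ∀ i : ℕ, ‖splitForm h φ.1 (fun _ => finRank (t i) (ψ i) (toDualC x)) y -
        splitForm h φ.1 (fun _ => toDualC x) y‖ ≤
        4 ^ n * (2 ^ n * kernelNorm n r φ) * (1 / ((i : ℝ) + 1)) *
          (S x ^ (n - k) * ∏ j, c j) := by
      intro i
      rw [norm_sub_rev, splitForm_apply, splitForm_apply, ← prod_slotEquiv h]
      refine hφ.norm_sub_le hB (by positivity) ?_ (fun l => ?_) (fun l => ?_) fun l => ?_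
      · rw [div_le_one (by positivity)]
        linarith [(Nat.cast_nonneg i : (0 : ℝ) ≤ i)]
      · rcases (slotEquiv h).symm l with j | j
        · exact hm.nonneg x
        · exact hc j
      · rcases (slotEquiv h).symm l with j | j
        · exact hx.mono (hpq.trans hqr) (hm.nonneg x) le_rfl
        · exact (hy j).mono hqr (hc j) le_rfl
      · rcases (slotEquiv h).symm l with j | j
        · exact hψ i _ _ (hm.nonneg x) (hx.mono hpq (hm.nonneg x) le_rfl)
        · have h0 : DualBound r (0 : G.DualC) (1 / ((i : ℝ) + 1) * c j) :=
            dualBound_zero (mul_nonneg (by positivity) (hc j))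
          rw [← sub_self (y j)] at h0
          exact h0
    rw [tendsto_iff_norm_sub_tendsto_zero]
    refine squeeze_zero (fun i => norm_nonneg _) key ?_
    have h3 := (tendsto_one_div_add_atTop_nhds_zero_nat (𝕜 := ℝ)).const_mul
      (4 ^ n * (2 ^ n * kernelNorm n r φ))
    have h4 := h3.mul_const (S x ^ (n - k) * ∏ j, c j)
    simpa using h4

theorem MomentBound.ae_norm_splitForm_le (hm : MomentBound μ p S K A) {n k q : ℕ} (h : k ≤ n)
    {φ : G.Form n} {B : ℝ} (hpq : p ≤ q) (hφ : FormBound q φ B) {y : Fin k → G.DualC}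
    {c : Fin k → ℝ} (hc : ∀ j, 0 ≤ c j) (hy : ∀ j, DualBound q (y j) (c j)) :
    ∀ᵐ x ∂μ, ‖splitForm h φ (fun _ => toDualC x) y‖ ≤ B * (∏ j, c j) * S x ^ (n - k) := by
  filter_upwards [hm.dualBound] with x hx
  refine (hφ.splitForm h (hm.nonneg x) (hx.mono hpq (hm.nonneg x) le_rfl) hc hy).trans
    (le_of_eq ?_)
  ring

theorem IsNuclear.integrable_splitForm (hG : G.IsNuclear) (hm : MomentBound μ p S K A)
    {n k : ℕ} (h : k ≤ n) (φ : G.Kernel n) (y : Fin k → G.DualC) :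
    Integrable (fun x => splitForm h φ.1 (fun _ => toDualC x) y) μ := by
  obtain ⟨q, hpq, c, hc, hy⟩ := exists_dualBound_family y p
  exact ((hm.integrable (n - k)).const_mul _).mono' (hG.aestronglyMeasurable_splitForm hm h φ y)
    (hm.ae_norm_splitForm_le h hpq (formBound_kernelNorm φ) hc hy)

/-- The form `(y₁, ..., y_k) ↦ ∫ φ(x, ..., x, y₁, ..., y_k) dμ(x)`. -/
noncomputable def contrForm (hG : G.IsNuclear) (hm : MomentBound μ p S K A) {n k : ℕ} (h : k ≤ n)
    (φ : G.Kernel n) : G.Form k where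
  toFun y := ∫ x, splitForm h φ.1 (fun _ => toDualC x) y ∂μ
  map_update_add' y i a b := by
    rw [← integral_add (hG.integrable_splitForm hm h φ _) (hG.integrable_splitForm hm h φ _)]
    simp only [MultilinearMap.map_update_add]
  map_update_smul' y i a b := by
    simp only [MultilinearMap.map_update_smul, smul_eq_mul]
    rw [integral_const_mul]

theorem formBound_contrForm (hG : G.IsNuclear) (hm : MomentBound μ p S K A) {n k q : ℕ}
    (h : k ≤ n) (hpq : p ≤ q) {φ : G.Kernel n} {B : ℝ} (hB : 0 ≤ B) (hφ : FormBound q φ.1 B) :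
    FormBound q (contrForm hG hm h φ) (B * (K * (n - k).factorial * A ^ (n - k))) := by
  intro y c hc hy
  refine (norm_integral_le_of_norm_le ((hm.integrable (n - k)).const_mul _)
    (hm.ae_norm_splitForm_le h hpq hφ hc hy)).trans ?_
  rw [integral_const_mul]
  have h1 : 0 ≤ ∏ j, c j := Finset.prod_nonneg fun j _ => hc j
  calc _ ≤ B * (∏ j, c j) * (K * (n - k).factorial * A ^ (n - k)) :=
        mul_le_mul_of_nonneg_left (hm.integral_le _) (by positivity)
    _ = _ := by ring

theorem contrForm_mem (hG : G.IsNuclear) (hm : MomentBound μ p S K A) {n k : ℕ}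
    (h : k ≤ n) (φ : G.Kernel n) : contrForm hG hm h φ ∈ G.Kernel k := by
  refine hG.mem_kernel (fun σ y => ?_) p fun q hq =>
    ⟨_, ?_, formBound_contrForm hG hm h hq ?_ (formBound_kernelNorm φ)⟩
  · refine integral_congr_ae (Filter.Eventually.of_forall fun x => ?_)
    -- The permutation of the last k slots is extended by the identity on the others.
    have h1 := φ.2.1 ((slotEquiv h).permCongr (Equiv.sumCongr (Equiv.refl _) σ))
      fun i => Sum.elim (fun _ => toDualC x) y ((slotEquiv h).symm i)
    refine Eq.trans ?_ h1
    simp only [splitForm_apply]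
    congr 1
    funext i
    simp only [Function.comp_apply, Equiv.permCongr_apply, Equiv.symm_apply_apply]
    rcases (slotEquiv h).symm i with j | j <;> rfl
  · have := hm.K_pos
    have := hm.A_pos
    have : 0 ≤ kernelNorm k q (0 : G.Kernel k) := apply_nonneg _ _
    have h2 : 0 ≤ 2 ^ n * kernelNorm n q φ := mul_nonneg (by positivity) (apply_nonneg _ _)
    positivity
  · exact mul_nonneg (by positivity) (apply_nonneg _ _)

/-- The contraction `𝒩_ℂ^{⊗̂ n} → 𝒩_ℂ^{⊗̂ k}` with the `(n - k)`-th moment of `μ`. -/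
noncomputable def contr (hG : G.IsNuclear) (hm : MomentBound μ p S K A) {n k : ℕ} (h : k ≤ n) :
    G.Kernel n →ₗ[ℂ] G.Kernel k where
  toFun φ := ⟨contrForm hG hm h φ, contrForm_mem hG hm h φ⟩
  map_add' φ ψ := by
    refine Subtype.ext (MultilinearMap.ext fun y => ?_)
    exact integral_add (hG.integrable_splitForm hm h φ _) (hG.integrable_splitForm hm h ψ _)
  map_smul' a φ := by
    refine Subtype.ext (MultilinearMap.ext fun y => ?_)
    exact integral_const_mul a _

theorem contr_apply (hG : G.IsNuclear) (hm : MomentBound μ p S K A) {n k : ℕ} (h : k ≤ n)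
    (φ : G.Kernel n) (y : Fin k → G.DualC) :
    (contr hG hm h φ).1 y = ∫ x, splitForm h φ.1 (fun _ => toDualC x) y ∂μ := rfl

theorem contr_self (hG : G.IsNuclear) (hm : MomentBound μ p S K A) {n : ℕ} (φ : G.Kernel n) :
    contr hG hm le_rfl φ = (μ.real Set.univ : ℂ) • φ := by
  refine Subtype.ext (MultilinearMap.ext fun y => ?_)
  have h1 : ∀ x : G.Dual, splitForm le_rfl φ.1 (fun _ => toDualC x) y = φ.1 y := by
    intro x
    rw [splitForm_apply]
    congr 1
    funext i
    obtain ⟨j, rfl⟩ := (slotEquiv (le_refl n)).surjective i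
    rw [Equiv.symm_apply_apply]
    rcases j with j | j
    · exact absurd j.2 (by simp)
    · rw [Sum.elim_inr]
      congr 1
      ext
      rw [slotEquiv_inr]
      simp
  rw [contr_apply]
  simp only [h1]
  rw [integral_const]
  change _ = (μ.real Set.univ : ℂ) * φ.1 y
  simp

theorem contr_tensorPow (hG : G.IsNuclear) (hm : MomentBound μ p S K A) {n k : ℕ} (h : k ≤ n)
    (η : G.NC) : contr hG hm h (tensorPow n η) =
      (∫ x, pair (toDualC x) η ^ (n - k) ∂μ) • tensorPow k η := by
  refine Subtype.ext (MultilinearMap.ext fun y => ?_)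
  rw [contr_apply]
  change _ = (∫ x, pair (toDualC x) η ^ (n - k) ∂μ) * (tensorPow k η).1 y
  rw [← integral_mul_const]
  congr 1
  funext x
  rw [splitForm_apply, tensorPow_apply, tensorPow_apply,
    Equiv.prod_comp (slotEquiv h).symm
      (fun i => pair (Sum.elim (fun _ => toDualC x) y i) η), Fintype.prod_sum_type]
  simp

/-! ### Convolution with a measure as an operator on kernels -/

/-- The component of degree `k` of the convolution with `μ` on kernels of degree `n`. -/
noncomputable def convComp (hG : G.IsNuclear) (hm : MomentBound μ p S K A) (n k : ℕ) :
    G.Kernel n →ₗ[ℂ] G.Kernel k :=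
  if h : k ≤ n then (n.choose k : ℂ) • contr hG hm h else 0

theorem convComp_of_le (hG : G.IsNuclear) (hm : MomentBound μ p S K A) {n k : ℕ} (h : k ≤ n) :
    convComp hG hm n k = (n.choose k : ℂ) • contr hG hm h := dif_pos h

theorem convComp_of_lt (hG : G.IsNuclear) (hm : MomentBound μ p S K A) {n k : ℕ} (h : n < k) :
    convComp hG hm n k = 0 := dif_neg (not_le.2 h)

theorem convComp_self (hG : G.IsNuclear) (hm : MomentBound μ p S K A) {n : ℕ} (φ : G.Kernel n) :
    convComp hG hm n n φ = (μ.real Set.univ : ℂ) • φ := by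
  rw [convComp_of_le hG hm le_rfl, Nat.choose_self, Nat.cast_one, one_smul, contr_self]

/-- The growth (n - k)! of the moments cancels against C(n,k)/n!, leaving 1/k!. The shape W r^k/k!
is thus preserved up to the geometric factor (A r)^{n-k}. -/
theorem formBound_convComp (hG : G.IsNuclear) (hm : MomentBound μ p S K A) {n k q : ℕ}
    (h : k ≤ n) (hpq : p ≤ q) {φ : G.Kernel n} {W r : ℝ} (hW : 0 ≤ W) (hr : 0 ≤ r)
    (hφ : FormBound q φ.1 (W * r ^ n / n.factorial)) :
    FormBound q (convComp hG hm n k φ).1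
      (K * W * r ^ k / k.factorial * (A * r) ^ (n - k)) := by
  rw [convComp_of_le hG hm h]
  have h1 := (formBound_contrForm hG hm h hpq (by positivity) hφ).smul (n.choose k : ℂ)
  refine h1.mono (le_of_eq ?_)
  rw [Complex.norm_natCast]
  have h2 : (n.choose k : ℝ) * k.factorial * (n - k).factorial = n.factorial := by
    exact_mod_cast Nat.choose_mul_factorial_mul_factorial h
  have h3 : r ^ n = r ^ k * r ^ (n - k) := by rw [← pow_add, Nat.add_sub_cancel' h]
  have h4 : (k.factorial : ℝ) ≠ 0 := by positivity
  have h5 : (n.factorial : ℝ) ≠ 0 := by positivity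
  rw [h3, mul_pow]
  field_simp
  rw [← h2]
  ring

/-- The operator `φ ↦ ∫ φ(· + y) dμ(y)` on polynomials, in terms of kernels. -/
noncomputable def conv (hG : G.IsNuclear) (hm : MomentBound μ p S K A) : G.Poly →ₗ[ℂ] G.Kernels :=
  DirectSum.toModule ℂ ℕ G.Kernels fun n => ∑ k ∈ Finset.range (n + 1),
    (DirectSum.lof ℂ ℕ (fun n => G.Kernel n) k).comp (convComp hG hm n k)

theorem lof_apply_same {n : ℕ} (φ : G.Kernel n) :
    DirectSum.lof ℂ ℕ (fun n => G.Kernel n) n φ n = φ :=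
  DirectSum.lof_apply (M := fun n => G.Kernel n) ℂ n φ

theorem lof_apply_ne {n k : ℕ} (h : k ≠ n) (φ : G.Kernel n) :
    DirectSum.lof ℂ ℕ (fun n => G.Kernel n) n φ k = 0 :=
  DFinsupp.single_eq_of_ne h

theorem conv_lof (hG : G.IsNuclear) (hm : MomentBound μ p S K A) (n : ℕ) (φ : G.Kernel n) :
    conv hG hm (DirectSum.lof ℂ ℕ (fun n => G.Kernel n) n φ) = ∑ k ∈ Finset.range (n + 1),
      DirectSum.lof ℂ ℕ (fun n => G.Kernel n) k (convComp hG hm n k φ) := by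
  refine (DirectSum.toModule_lof (M := fun n => G.Kernel n) ℂ n φ).trans ?_
  simp

theorem sum_apply_kernels {ι : Type*} (s : Finset ι) (f : ι → G.Kernels) (k : ℕ) :
    (∑ i ∈ s, f i) k = ∑ i ∈ s, f i k := DFinsupp.finsetSum_apply s f k

theorem conv_lof_apply (hG : G.IsNuclear) (hm : MomentBound μ p S K A) (n k : ℕ)
    (φ : G.Kernel n) :
    conv hG hm (DirectSum.lof ℂ ℕ (fun n => G.Kernel n) n φ) k = convComp hG hm n k φ := by
  rw [conv_lof, sum_apply_kernels]
  by_cases hk : k ≤ n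
  · rw [Finset.sum_eq_single_of_mem k (Finset.mem_range.2 (Nat.lt_succ_of_le hk)),
      lof_apply_same]
    intro j _ hj
    exact lof_apply_ne hj.symm _
  · rw [convComp_of_lt hG hm (not_le.1 hk)]
    refine Finset.sum_eq_zero fun j hj => lof_apply_ne ?_ _
    rintro rfl
    exact hk (Nat.lt_succ_iff.1 (Finset.mem_range.1 hj))

theorem exists_support_range (a : G.Kernels) : ∃ N : ℕ, ∀ n ∉ Finset.range N, a n = 0 := by
  obtain ⟨s, hs⟩ := exists_support a
  refine ⟨s.sup id + 1, fun n hn => hs n fun h => hn ?_⟩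
  exact Finset.mem_range.2 (Nat.lt_succ_of_le (Finset.le_sup (f := id) h))

theorem conv_apply (hG : G.IsNuclear) (hm : MomentBound μ p S K A) (φ : G.Poly)
    {s : Finset ℕ} (hs : ∀ n ∉ s, φ n = 0) (k : ℕ) :
    conv hG hm φ k = ∑ n ∈ s, convComp hG hm n k (φ n) := by
  have h := congrArg (conv hG hm) (eq_sum_lof φ hs)
  rw [h, map_sum, sum_apply_kernels]
  exact Finset.sum_congr rfl fun n _ => conv_lof_apply hG hm n k (φ n)

/-- The bounds `|a_n|_{-q} ≤ W rⁿ / n!` of a sequence of kernels. -/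
def SeqBound (q : ℕ) (W r : ℝ) (a : G.Kernels) : Prop :=
  ∀ n, FormBound q (a n).1 (W * r ^ n / n.factorial)

theorem sum_filter_pow_sub_le {ρ : ℝ} (h0 : 0 ≤ ρ) (h1 : ρ ≤ 1 / 2) (N k : ℕ) :
    ∑ n ∈ Finset.range N with k ≤ n, ρ ^ (n - k) ≤ 2 := by
  have h2 : (Finset.range N).filter (fun n => k ≤ n) = Finset.Ico k N := by
    ext n
    simp [and_comm]
  rw [h2, Finset.sum_Ico_eq_sum_range]
  simp only [Nat.add_sub_cancel_left]
  have h3 : ρ < 1 := by linarith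
  have h4 := (summable_geometric_of_lt_one h0 h3).sum_le_tsum (Finset.range (N - k))
    fun i _ => pow_nonneg h0 i
  rw [tsum_geometric_of_lt_one h0 h3] at h4
  refine h4.trans ?_
  rw [inv_le_comm₀ (by linarith) (by norm_num)]
  linarith

theorem sum_val {ι : Type*} {n : ℕ} (s : Finset ι) (f : ι → G.Kernel n) :
    (∑ i ∈ s, f i).1 = ∑ i ∈ s, (f i).1 := map_sum (G.Kernel n).subtype f s

/-- For A r ≤ 1/2 the contributions of all degrees n ≥ k form a geometric series with sum at most 2.
-/
theorem SeqBound.conv (hG : G.IsNuclear) (hm : MomentBound μ p S K A) {q : ℕ} (hpq : p ≤ q)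
    {W r : ℝ} (hW : 0 ≤ W) (hr : 0 ≤ r) (hAr : A * r ≤ 1 / 2) {b : G.Poly}
    (hb : SeqBound q W r b) : SeqBound q (2 * K * W) r (conv hG hm b) := by
  intro k
  obtain ⟨N, hN⟩ := exists_support_range b
  rw [conv_apply hG hm b hN, ← Finset.sum_filter_add_sum_filter_not _ (fun n => k ≤ n)]
  have h0 : ∑ n ∈ Finset.range N with ¬ k ≤ n, convComp hG hm n k (b n) = 0 := by
    refine Finset.sum_eq_zero fun n hn => ?_
    rw [convComp_of_lt hG hm (not_le.1 (Finset.mem_filter.1 hn).2)]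
    rfl
  rw [h0, add_zero, sum_val]
  have h1 := FormBound.sum (p := q) (s := (Finset.range N).filter fun n => k ≤ n)
    (φ := fun n => (convComp hG hm n k (b n)).1) fun n hn =>
    formBound_convComp hG hm (Finset.mem_filter.1 hn).2 hpq hW hr (hb n)
  refine h1.mono ?_
  rw [← Finset.mul_sum]
  have := hm.K_pos
  have h2 := sum_filter_pow_sub_le (mul_nonneg hm.A_pos.le hr) hAr N k
  calc _ ≤ K * W * r ^ k / k.factorial * 2 := by gcongr
    _ = _ := by ring

/-- In degree n, convolution is M = μ(𝒩') times b_n plus terms from higher degrees, so b is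
recovered downwards from its top degree. The condition 4 K A r ≤ M makes the higher terms no larger
than the given bound, and the constant 2/M reproduces itself. -/
theorem SeqBound.of_conv (hG : G.IsNuclear) (hm : MomentBound μ p S K A)
    (hM : 0 < μ.real Set.univ) {q : ℕ} (hpq : p ≤ q)
    {W r : ℝ} (hW : 0 ≤ W) (hr : 0 ≤ r) (hAr : A * r ≤ 1 / 2)
    (hKr : 4 * K * (A * r) ≤ μ.real Set.univ) {b : G.Poly}
    (hb : SeqBound q W r (HilbertChain.conv hG hm b)) :
    SeqBound q (2 / μ.real Set.univ * W) r b := by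
  set M := μ.real Set.univ
  obtain ⟨N, hN⟩ := exists_support_range b
  have hzero : ∀ n, N ≤ n → FormBound q (b n).1 (2 / M * W * r ^ n / n.factorial) := by
    intro n hn
    rw [hN n (by simpa using hn)]
    exact formBound_zero.mono (by positivity)
  -- Induction on the distance i below N, beyond which all kernels vanish.
  have key : ∀ i n, N ≤ n + i → FormBound q (b n).1 (2 / M * W * r ^ n / n.factorial) := by
    intro i
    induction i with
    | zero => exact fun n hn => hzero n hn
    | succ i ih =>
      intro n hn
      by_cases hNn : N ≤ n
      · exact hzero n hNn
      have h1 := conv_apply hG hm b hN n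
      rw [← Finset.sum_filter_add_sum_filter_not _ (fun m => n + 1 ≤ m)] at h1
      have h2 : ∑ m ∈ Finset.range N with ¬ n + 1 ≤ m, convComp hG hm m n (b m) =
          (M : ℂ) • b n := by
        rw [Finset.sum_eq_single_of_mem n (by simp; omega), convComp_self]
        intro m hm' hmn
        have h3 := (Finset.mem_filter.1 hm').2
        rw [convComp_of_lt hG hm (by omega)]
        rfl
      rw [h2] at h1
      have hMC : (M : ℂ) ≠ 0 := by exact_mod_cast hM.ne'
      have h3 : b n = (M : ℂ)⁻¹ • (HilbertChain.conv hG hm b n -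
          ∑ m ∈ Finset.range N with n + 1 ≤ m, convComp hG hm m n (b m)) := by
        rw [h1, add_sub_cancel_left, inv_smul_smul₀ hMC]
      have h4 := FormBound.sum (p := q) (s := (Finset.range N).filter fun m => n + 1 ≤ m)
        (φ := fun m => (convComp hG hm m n (b m)).1) fun m hm' =>
        formBound_convComp hG hm (by have := (Finset.mem_filter.1 hm').2; omega) hpq
          (by positivity) hr (ih m (by have := (Finset.mem_filter.1 hm').2; omega))
      rw [← sum_val] at h4
      have h5 := ((hb n).sub h4).smul (M : ℂ)⁻¹
      rw [h3]
      refine FormBound.mono (φ := ((M : ℂ)⁻¹ • (HilbertChain.conv hG hm b n -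
          ∑ m ∈ Finset.range N with n + 1 ≤ m, convComp hG hm m n (b m)) : G.Kernel n).1) h5 ?_
      rw [norm_inv, Complex.norm_real, Real.norm_of_nonneg hM.le, ← Finset.mul_sum]
      have hA := hm.A_pos
      have hK := hm.K_pos
      -- The sum starts at m = n + 1, which leaves a factor A r that can be made small.
      have h6 : ∑ m ∈ Finset.range N with n + 1 ≤ m, (A * r) ^ (m - n) ≤ A * r * 2 := by
        have h7 := sum_filter_pow_sub_le (mul_nonneg hA.le hr) hAr N (n + 1)
        refine le_trans (le_of_eq ?_) (mul_le_mul_of_nonneg_left h7 (mul_nonneg hA.le hr))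
        rw [Finset.mul_sum]
        refine Finset.sum_congr rfl fun m hm' => ?_
        rw [← pow_succ']
        congr 1
        have := (Finset.mem_filter.1 hm').2
        omega
      have h8 : K * (2 / M * W) * r ^ n / n.factorial *
          ∑ m ∈ Finset.range N with n + 1 ≤ m, (A * r) ^ (m - n) ≤
          W * r ^ n / n.factorial := by
        calc _ ≤ K * (2 / M * W) * r ^ n / n.factorial * (A * r * 2) := by gcongr
          _ = (4 * K * (A * r)) / M * (W * r ^ n / n.factorial) := by ring
          _ ≤ 1 * (W * r ^ n / n.factorial) := by
            gcongr
            rwa [div_le_one hM]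
          _ = _ := one_mul _
      calc _ ≤ M⁻¹ * (W * r ^ n / n.factorial + W * r ^ n / n.factorial) := by gcongr
        _ = _ := by ring
  exact fun n => key N n (Nat.le_add_left _ _)

/-- This is the estimate `SeqBound.of_conv` with W = 0. -/
theorem conv_injective (hG : G.IsNuclear) (hm : MomentBound μ p S K A)
    (hM : 0 < μ.real Set.univ) : Function.Injective (conv hG hm) := by
  rw [injective_iff_map_eq_zero]
  intro b hb
  have key : ∀ q, p ≤ q → SeqBound q (2 / μ.real Set.univ * 0) 0 b := fun q hq => by
    refine SeqBound.of_conv hG hm hM hq le_rfl le_rfl (by norm_num) (by simp) ?_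
    rw [hb]
    intro n
    simp only [zero_mul, zero_div]
    exact formBound_zero
  refine DFinsupp.ext fun n => Subtype.ext (MultilinearMap.ext fun y => ?_)
  obtain ⟨q, hq, c, hc, hy⟩ := exists_dualBound_family y p
  have h1 := key q hq n y c hc hy
  simp only [mul_zero, zero_mul, zero_div] at h1
  exact norm_le_zero_iff.1 h1

theorem mem_of_lof_mem (V : Submodule ℂ G.Kernels) (a : G.Kernels)
    (h : ∀ n, DirectSum.lof ℂ ℕ (fun n => G.Kernel n) n (a n) ∈ V) : a ∈ V := by
  obtain ⟨s, hs⟩ := exists_support a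
  rw [eq_sum_lof a hs]
  exact sum_mem fun n _ => h n

/-- Convolution is triangular with respect to the degree, with the nonzero scalar μ(𝒩') on the
diagonal. -/
theorem conv_surjective (hG : G.IsNuclear) (hm : MomentBound μ p S K A)
    (hM : 0 < μ.real Set.univ) : Function.Surjective (conv hG hm) := by
  have hMC : (μ.real Set.univ : ℂ) ≠ 0 := by exact_mod_cast hM.ne'
  have key : ∀ (n : ℕ) (a : G.Kernel n),
      DirectSum.lof ℂ ℕ (fun n => G.Kernel n) n a ∈ LinearMap.range (conv hG hm) := by
    intro n
    induction n using Nat.strong_induction_on with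
    | _ n ih =>
      intro a
      have h1 := LinearMap.mem_range_self (conv hG hm)
        (DirectSum.lof ℂ ℕ (fun n => G.Kernel n) n a)
      rw [conv_lof, Finset.sum_range_succ, convComp_self, map_smul] at h1
      generalize LinearMap.range (conv hG hm) = V at h1 ih ⊢
      have h3 : ∑ k ∈ Finset.range n, DirectSum.lof ℂ ℕ (fun n => G.Kernel n) k
          (convComp hG hm n k a) ∈ V := sum_mem fun k hk => ih k (Finset.mem_range.1 hk) _
      refine (V.smul_mem_iff hMC).1 ?_
      have h4 := V.add_mem h1 (V.smul_mem (-1 : ℂ) h3)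
      rw [add_right_comm] at h4
      nth_rewrite 1 [← one_smul ℂ (∑ k ∈ Finset.range n, _)] at h4
      rwa [← add_smul, add_neg_cancel, zero_smul, zero_add] at h4
  exact fun a => mem_of_lof_mem (LinearMap.range (conv hG hm)) a fun n => key n (a n)

/-- The convolution with `μ` as a linear automorphism of the space of sequences of kernels. -/
noncomputable def convEquiv (hG : G.IsNuclear) (hm : MomentBound μ p S K A)
    (hM : 0 < μ.real Set.univ) : G.Poly ≃ₗ[ℂ] G.Kernels :=
  LinearEquiv.ofBijective (conv hG hm) ⟨conv_injective hG hm hM, conv_surjective hG hm hM⟩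

theorem convEquiv_apply (hG : G.IsNuclear) (hm : MomentBound μ p S K A)
    (hM : 0 < μ.real Set.univ) (φ : G.Poly) : convEquiv hG hm hM φ = conv hG hm φ := rfl


/-! ### The Laplace transform along complex lines -/

theorem pair_smul (y : G.DualC) (t : ℂ) (η : G.NC) : pair y (t • η) = t * pair y η :=
  map_smul (pairLinRight y) t η

theorem DualBound.norm_pair_le {q : ℕ} {y : G.DualC} {c : ℝ} (h : DualBound q y c) (η : G.NC) :
    ‖pair y η‖ ≤ c * (‖G.proj q η.re‖ + ‖G.proj q η.im‖) := by
  rw [mul_add]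
  refine (norm_add_le _ _).trans (add_le_add (h _) ?_)
  rw [norm_mul, Complex.norm_I, one_mul]
  exact h _

theorem measurable_pair (η : G.NC) : Measurable fun x : G.Dual => pair (toDualC x) η :=
  (Complex.measurable_ofReal.comp (measurable_apply _)).add
    ((Complex.measurable_ofReal.comp (measurable_apply _)).const_mul _)

theorem MomentBound.ae_norm_pair_pow_le (hm : MomentBound μ p S K A) (η : G.NC) (j : ℕ) :
    ∀ᵐ x ∂μ, ‖pair (toDualC x) η ^ j‖ ≤
      (‖G.proj p η.re‖ + ‖G.proj p η.im‖) ^ j * S x ^ j := by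
  filter_upwards [hm.dualBound] with x hx
  rw [norm_pow, ← mul_pow, mul_comm]
  exact pow_le_pow_left₀ (norm_nonneg _) (hx.norm_pair_le η) j

theorem MomentBound.integrable_pair_pow (hm : MomentBound μ p S K A) (η : G.NC) (j : ℕ) :
    Integrable (fun x => pair (toDualC x) η ^ j) μ :=
  ((hm.integrable j).const_mul _).mono' ((measurable_pair η).pow_const j).aestronglyMeasurable
    (hm.ae_norm_pair_pow_le η j)

theorem MomentBound.integral_norm_pair_pow_le (hm : MomentBound μ p S K A) (η : G.NC) (j : ℕ) :
    ∫ x, ‖pair (toDualC x) η ^ j‖ ∂μ ≤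
      K * j.factorial * (A * (‖G.proj p η.re‖ + ‖G.proj p η.im‖)) ^ j := by
  refine (integral_mono_ae (hm.integrable_pair_pow η j).norm ((hm.integrable j).const_mul _)
    (hm.ae_norm_pair_pow_le η j)).trans ?_
  rw [integral_const_mul]
  refine (mul_le_mul_of_nonneg_left (hm.integral_le j) (by positivity)).trans (le_of_eq ?_)
  rw [mul_pow]
  ring

/-- The exponential series may be integrated termwise: by the moment bound its terms have integrals
dominated by a geometric series. -/
theorem MomentBound.hasSum_laplace (hm : MomentBound μ p S K A) (η : G.NC) {t : ℂ}
    (ht : ‖t‖ * (A * (‖G.proj p η.re‖ + ‖G.proj p η.im‖)) < 1) :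
    HasSum (fun j : ℕ => t ^ j * ((∫ x, pair (toDualC x) η ^ j ∂μ) / j.factorial))
      (laplace μ (t • η)) := by
  set c := A * (‖G.proj p η.re‖ + ‖G.proj p η.im‖)
  have hc : 0 ≤ c := mul_nonneg hm.A_pos.le (by positivity)
  have h1 := hasSum_integral_of_summable_integral_norm (μ := μ)
    (F := fun (j : ℕ) (x : G.Dual) => t ^ j / j.factorial * pair (toDualC x) η ^ j)
    (fun j => (hm.integrable_pair_pow η j).const_mul _) (by
      refine Summable.of_nonneg_of_le (fun j => integral_nonneg fun x => norm_nonneg _)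
        (fun j => ?_) ((summable_geometric_of_lt_one (by positivity) ht).mul_left K)
      simp only [norm_mul]
      rw [integral_const_mul]
      refine (mul_le_mul_of_nonneg_left (hm.integral_norm_pair_pow_le η j)
        (norm_nonneg _)).trans (le_of_eq ?_)
      rw [norm_div, norm_pow, Complex.norm_natCast, mul_pow]
      have : (j.factorial : ℝ) ≠ 0 := by positivity
      field_simp
      rw [mul_pow, mul_pow]
      ring)
  have h2 : laplace μ (t • η) =
      ∫ x, ∑' j : ℕ, t ^ j / j.factorial * pair (toDualC x) η ^ j ∂μ := by
    refine integral_congr_ae (Filter.Eventually.of_forall fun x => ?_)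
    have h3 := NormedSpace.expSeries_div_hasSum_exp (pair (toDualC x) (t • η))
    rw [← Complex.exp_eq_exp_ℂ] at h3
    refine h3.tsum_eq.symm.trans ?_
    refine tsum_congr fun j => ?_
    rw [pair_smul, mul_pow]
    ring
  rw [h2]
  refine h1.congr_fun fun j => ?_
  rw [integral_const_mul]
  ring

theorem MomentBound.hasFPowerSeriesAt_laplace (hm : MomentBound μ p S K A) (η : G.NC) :
    HasFPowerSeriesAt (fun t : ℂ => laplace μ (t • η)) (FormalMultilinearSeries.ofScalars ℂ
      fun j : ℕ => (∫ x, pair (toDualC x) η ^ j ∂μ) / (j.factorial : ℂ)) 0 := by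
  rw [hasFPowerSeriesAt_iff]
  have h1 : ∀ᶠ t : ℂ in 𝓝 0, ‖t‖ * (A * (‖G.proj p η.re‖ + ‖G.proj p η.im‖)) < 1 := by
    refine ((continuous_norm.mul continuous_const).continuousAt).eventually_lt
      continuousAt_const ?_
    simp
  filter_upwards [h1] with t ht
  simp only [FormalMultilinearSeries.coeff_ofScalars, smul_eq_mul, zero_add]
  exact hm.hasSum_laplace η ht

theorem MomentBound.analyticAt_laplace (hm : MomentBound μ p S K A) (η : G.NC) :
    AnalyticAt ℂ (fun t : ℂ => laplace μ (t • η)) 0 := (hm.hasFPowerSeriesAt_laplace η).analyticAt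

theorem MomentBound.iteratedDeriv_laplace (hm : MomentBound μ p S K A) (η : G.NC) (j : ℕ) :
    iteratedDeriv j (fun t : ℂ => laplace μ (t • η)) 0 = ∫ x, pair (toDualC x) η ^ j ∂μ := by
  have h1 := (hm.hasFPowerSeriesAt_laplace η).eq_formalMultilinearSeries
    (hm.analyticAt_laplace η).hasFPowerSeriesAt
  have h2 := congrArg (fun P => FormalMultilinearSeries.coeff P j) h1
  simp only [FormalMultilinearSeries.coeff_ofScalars] at h2
  have h3 : (j.factorial : ℂ) ≠ 0 := by exact_mod_cast j.factorial_ne_zero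
  exact ((div_left_inj' h3).1 h2).symm

theorem laplace_zero : laplace μ (0 : G.NC) = (μ.real Set.univ : ℂ) := by
  have h1 : ∀ x : G.Dual, pair (toDualC x) 0 = 0 := fun x => map_zero (pairLinRight (toDualC x))
  simp [laplace, h1]

/-! ### Diagonal values of sequences of kernels -/

/-- The value `∑ ⟨y^{⊗n} | a_n⟩`, `y ∈ 𝒩'_ℂ`. -/
noncomputable def diagEval (y : G.DualC) : G.Kernels →ₗ[ℂ] ℂ :=
  DirectSum.toModule ℂ ℕ ℂ fun n => evalAt fun _ : Fin n => y

theorem diagEval_eq_sum (y : G.DualC) (a : G.Kernels) {s : Finset ℕ} (hs : ∀ n ∉ s, a n = 0) :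
    diagEval y a = ∑ n ∈ s, (a n).1 fun _ => y := toModule_eq_sum _ a hs

theorem diagEval_lof (y : G.DualC) (n : ℕ) (φ : G.Kernel n) :
    diagEval y (DirectSum.lof ℂ ℕ (fun n => G.Kernel n) n φ) = φ.1 fun _ => y :=
  DirectSum.toModule_lof (M := fun n => G.Kernel n) ℂ n φ

theorem SeqBound.norm_apply_le {q : ℕ} {W r : ℝ} {a : G.Kernels} (ha : SeqBound q W r a)
    {y : G.DualC} {c : ℝ} (hc : 0 ≤ c) (hy : DualBound q y c) (n : ℕ) :
    ‖(a n).1 fun _ => y‖ ≤ W * ((r * c) ^ n / n.factorial) := by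
  refine (ha n (fun _ => y) (fun _ => c) (fun _ => hc) fun _ => hy).trans (le_of_eq ?_)
  rw [Finset.prod_const, Finset.card_univ, Fintype.card_fin, mul_pow]
  ring

theorem SeqBound.norm_diagEval_le {q : ℕ} {W r : ℝ} {a : G.Kernels} (ha : SeqBound q W r a)
    (hW : 0 ≤ W) (hr : 0 ≤ r) {y : G.DualC} {c : ℝ} (hc : 0 ≤ c) (hy : DualBound q y c) :
    ‖diagEval y a‖ ≤ W * Real.exp (r * c) := by
  obtain ⟨N, hN⟩ := exists_support_range a
  rw [diagEval_eq_sum y a hN]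
  refine (norm_sum_le_of_le _ fun n _ => ha.norm_apply_le hc hy n).trans ?_
  rw [← Finset.mul_sum]
  exact mul_le_mul_of_nonneg_left (Real.sum_le_exp_of_nonneg (mul_nonneg hr hc) N) hW

theorem seqBound_lof {q n : ℕ} {r : ℝ} (hr : 0 < r) (φ : G.Kernel n) :
    SeqBound q (2 ^ n * kernelNorm n q φ * (n.factorial / r ^ n)) r
      (DirectSum.lof ℂ ℕ (fun n => G.Kernel n) n φ) := by
  intro k
  have h0 : 0 ≤ kernelNorm n q φ := apply_nonneg _ _
  by_cases hk : k = n
  · subst hk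
    rw [lof_apply_same]
    refine (formBound_kernelNorm φ).mono (le_of_eq ?_)
    have : (k.factorial : ℝ) ≠ 0 := by positivity
    field_simp
  · rw [lof_apply_ne hk]
    exact formBound_zero.mono (by positivity)

theorem MomentBound.exists_radius (hm : MomentBound μ p S K A) (hM : 0 < μ.real Set.univ) :
    ∃ r₀ > 0, ∀ r, 0 ≤ r → r ≤ r₀ → A * r ≤ 1 / 2 ∧ 4 * K * (A * r) ≤ μ.real Set.univ := by
  have hA := hm.A_pos
  have hK := hm.K_pos
  refine ⟨min (1 / (2 * A)) (μ.real Set.univ / (4 * K * A)), by positivity, fun r _ h => ?_⟩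
  have h1 := h.trans (min_le_left _ _)
  have h2 := h.trans (min_le_right _ _)
  rw [le_div_iff₀ (by positivity)] at h1 h2
  constructor <;> linarith

/-! ### Appell kernels -/

/-- The functional `φ ↦ ⟨P_{n,μ}(x) | φ⟩`, constructed by inverting the convolution with `μ`. -/
noncomputable def appellFun (hG : G.IsNuclear) (hm : MomentBound μ p S K A)
    (hM : 0 < μ.real Set.univ) (n : ℕ) (x : G.Dual) : G.Kernel n →ₗ[ℂ] ℂ :=
  (diagEval (toDualC x) ∘ₗ (convEquiv hG hm hM).symm.toLinearMap) ∘ₗ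
    DirectSum.lof ℂ ℕ (fun n => G.Kernel n) n

theorem appellFun_apply (hG : G.IsNuclear) (hm : MomentBound μ p S K A)
    (hM : 0 < μ.real Set.univ) (n : ℕ) (x : G.Dual) (φ : G.Kernel n) :
    appellFun hG hm hM n x φ = evalPoly ((convEquiv hG hm hM).symm
      (DirectSum.lof ℂ ℕ (fun n => G.Kernel n) n φ)) x := rfl

/-- `SeqBound.of_conv` controls the inverse convolution, and evaluation at x costs only an
exponential factor. -/
theorem exists_appellFun_le (hG : G.IsNuclear) (hm : MomentBound μ p S K A)
    (hM : 0 < μ.real Set.univ) (n : ℕ) (x : G.Dual) :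
    ∃ q, ∃ C : ℝ, ∀ φ, ‖appellFun hG hm hM n x φ‖ ≤ C * kernelNorm n q φ := by
  obtain ⟨r, hr, hr₀⟩ := hm.exists_radius hM
  obtain ⟨h1, h2⟩ := hr₀ r hr.le le_rfl
  obtain ⟨q, c, hc, hx⟩ := exists_dualBound (toDualC x)
  refine ⟨max p q, 2 / μ.real Set.univ * (2 ^ n * (n.factorial / r ^ n)) * Real.exp (r * c),
    fun φ => ?_⟩
  have h0 : 0 ≤ kernelNorm n (max p q) φ := apply_nonneg _ _
  have h3 := seqBound_lof (q := max p q) hr φ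
  rw [← (convEquiv hG hm hM).apply_symm_apply (DirectSum.lof ℂ ℕ _ n φ)] at h3
  have h4 := SeqBound.of_conv hG hm hM (le_max_left p q) (by positivity) hr.le h1 h2 h3
  refine (h4.norm_diagEval_le (by positivity) hr.le hc
    (hx.mono (le_max_right p q) hc le_rfl)).trans (le_of_eq ?_)
  ring

theorem conv_lof_tensorPow (hG : G.IsNuclear) (hm : MomentBound μ p S K A) (n : ℕ) (η : G.NC) :
    conv hG hm (DirectSum.lof ℂ ℕ (fun n => G.Kernel n) n (tensorPow n η)) =
      ∑ k ∈ Finset.range (n + 1), ((n.choose k : ℂ) * ∫ x, pair (toDualC x) η ^ (n - k) ∂μ) •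
        DirectSum.lof ℂ ℕ (fun n => G.Kernel n) k (tensorPow k η) := by
  rw [conv_lof]
  refine Finset.sum_congr rfl fun k hk => ?_
  have h1 : k ≤ n := Nat.lt_succ_iff.1 (Finset.mem_range.1 hk)
  rw [convComp_of_le hG hm h1, LinearMap.smul_apply, contr_tensorPow, smul_smul, map_smul]

/-- Both sides solve the same triangular system ⟨x|η⟩ⁿ = ∑ C(n,k) P_k m_{n-k}, where m_j is the j-th
moment of ⟨·|η⟩. As m_0 = μ(𝒩') ≠ 0, the solution is unique. -/
theorem appellFun_tensorPow (hG : G.IsNuclear) (hm : MomentBound μ p S K A)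
    (hM : 0 < μ.real Set.univ) (n : ℕ) (x : G.Dual) (η : G.NC) :
    appellFun hG hm hM n x (tensorPow n η) =
      iteratedDeriv n (fun t : ℂ => normExp μ (t • η) x) 0 := by
  have hMC : (μ.real Set.univ : ℂ) ≠ 0 := by exact_mod_cast hM.ne'
  have han := hm.analyticAt_laplace η
  have h0 : laplace μ ((0 : ℂ) • η) ≠ 0 := by
    have h : (0 : ℂ) • η = 0 := zero_smul ℂ η
    rwa [h, laplace_zero]
  have hexp : ∀ t : ℂ, Complex.exp (pair (toDualC x) (t • η)) =
      Complex.exp (pair (toDualC x) η * t) := fun t => by rw [pair_smul, mul_comm]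
  have hexpan : AnalyticAt ℂ (fun t : ℂ => Complex.exp (pair (toDualC x) (t • η))) 0 := by
    simp only [hexp]
    fun_prop
  have hnan : AnalyticAt ℂ (fun t : ℂ => normExp μ (t • η) x) 0 := hexpan.div han h0
  have hprod : (fun t : ℂ => Complex.exp (pair (toDualC x) η * t)) =ᶠ[𝓝 0]
      (fun t => normExp μ (t • η) x) * fun t => laplace μ (t • η) := by
    filter_upwards [han.continuousAt.eventually_ne h0] with t ht
    rw [Pi.mul_apply, normExp, div_mul_cancel₀ _ ht, hexp]
  -- Leibniz rule for e^{⟨x|tη⟩} = e_μ(tη; x) times the Laplace transform at tη.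
  have hG' : ∀ n : ℕ, pair (toDualC x) η ^ n = ∑ k ∈ Finset.range (n + 1), (n.choose k : ℂ) *
      iteratedDeriv k (fun t : ℂ => normExp μ (t • η) x) 0 *
        ∫ x, pair (toDualC x) η ^ (n - k) ∂μ := by
    intro n
    have h1 := hprod.iteratedDeriv_eq n
    rw [iteratedDeriv_mul hnan.contDiffAt han.contDiffAt, iteratedDeriv_cexp_const_mul] at h1
    simp only [hm.iteratedDeriv_laplace] at h1
    simpa using h1
  -- Inverse convolution applied to the expansion of the convolved monomial.
  have hP : ∀ n : ℕ, pair (toDualC x) η ^ n = ∑ k ∈ Finset.range (n + 1), (n.choose k : ℂ) *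
      appellFun hG hm hM k x (tensorPow k η) * ∫ x, pair (toDualC x) η ^ (n - k) ∂μ := by
    intro n
    have h1 := congrArg (fun a => diagEval (toDualC x) ((convEquiv hG hm hM).symm a))
      (conv_lof_tensorPow hG hm n η)
    simp only [map_sum, map_smul] at h1
    rw [← convEquiv_apply hG hm hM, LinearEquiv.symm_apply_apply, diagEval_lof,
      tensorPow_apply] at h1
    simp only [Finset.prod_const, Finset.card_univ, Fintype.card_fin] at h1
    rw [h1]
    refine Finset.sum_congr rfl fun k _ => ?_
    change _ * appellFun hG hm hM k x (tensorPow k η) = _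
    ring
  have hm0 : ∫ x, pair (toDualC x) η ^ 0 ∂μ ≠ 0 := by simpa using hMC
  induction n using Nat.strong_induction_on with
  | _ n ih =>
    have h1 := (hP n).symm.trans (hG' n)
    rw [Finset.sum_range_succ, Finset.sum_range_succ] at h1
    rw [Finset.sum_congr rfl fun k hk => by rw [ih k (Finset.mem_range.1 hk)]] at h1
    have h2 := add_left_cancel h1
    rw [Nat.choose_self, Nat.cast_one, one_mul, one_mul, Nat.sub_self] at h2
    exact mul_right_cancel₀ hm0 h2

theorem isAppell_appellFun (hG : G.IsNuclear) (hm : MomentBound μ p S K A)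
    (hM : 0 < μ.real Set.univ) (n : ℕ) (x : G.Dual) :
    IsAppell μ n x (appellFun hG hm hM n x) :=
  ⟨exists_appellFun_le hG hm hM n x, appellFun_tensorPow hG hm hM n x⟩

/-- P and Q may be continuous for different norms, so both bounds are first moved to a common index;
then the density of the span of the tensor powers applies. -/
theorem IsAppell.unique (hG : G.IsNuclear) {n : ℕ} {x : G.Dual} {P Q : G.Kernel n →ₗ[ℂ] ℂ}
    (hP : IsAppell μ n x P) (hQ : IsAppell μ n x Q) : P = Q := by
  obtain ⟨⟨p₁, C₁, h₁⟩, hP⟩ := hP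
  obtain ⟨⟨p₂, C₂, h₂⟩, hQ⟩ := hQ
  obtain ⟨q₁, -, D₁, hD₁, h₁'⟩ := hG.exists_kernelNorm_le p₁
  obtain ⟨q₂, -, D₂, hD₂, h₂'⟩ := hG.exists_kernelNorm_le p₂
  rw [← sub_eq_zero]
  refine hG.eq_zero_of_tensorPow (P - Q) (p := max q₁ q₂)
    (C := |C₁| * (D₁ ^ n * 2 ^ n) + |C₂| * (D₂ ^ n * 2 ^ n)) (fun φ => ?_) fun η => ?_
  · have h0 : 0 ≤ kernelNorm n (max q₁ q₂) φ := apply_nonneg _ _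
    have h3 := h₁' _ (le_max_left q₁ q₂) n φ _ (by positivity) (formBound_kernelNorm φ)
    have h4 := h₂' _ (le_max_right q₁ q₂) n φ _ (by positivity) (formBound_kernelNorm φ)
    have h5 : ‖P φ‖ ≤ |C₁| * (D₁ ^ n * (2 ^ n * kernelNorm n (max q₁ q₂) φ)) :=
      (h₁ φ).trans (mul_le_mul (le_abs_self _) h3 (apply_nonneg _ _) (abs_nonneg _))
    have h6 : ‖Q φ‖ ≤ |C₂| * (D₂ ^ n * (2 ^ n * kernelNorm n (max q₁ q₂) φ)) :=
      (h₂ φ).trans (mul_le_mul (le_abs_self _) h4 (apply_nonneg _ _) (abs_nonneg _))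
    rw [LinearMap.sub_apply]
    refine (norm_sub_le _ _).trans ((add_le_add h5 h6).trans (le_of_eq ?_))
    ring
  · rw [LinearMap.sub_apply, hP, hQ, sub_self]

theorem appell_eq (hG : G.IsNuclear) (hm : MomentBound μ p S K A)
    (hM : 0 < μ.real Set.univ) (n : ℕ) (x : G.Dual) :
    appell μ n x = appellFun hG hm hM n x := by
  have h : ∃ P, IsAppell μ n x P := ⟨_, isAppell_appellFun hG hm hM n x⟩
  rw [appell, dif_pos h]
  exact h.choose_spec.unique hG (isAppell_appellFun hG hm hM n x)

theorem evalAppell_eq (hG : G.IsNuclear) (hm : MomentBound μ p S K A)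
    (hM : 0 < μ.real Set.univ) (a : G.Kernels) (x : G.Dual) :
    evalAppell μ a x = evalPoly ((convEquiv hG hm hM).symm a) x := by
  obtain ⟨s, hs⟩ := exists_support a
  have h1 : evalAppell μ a x = ∑ n ∈ s, appell μ n x (a n) := toModule_eq_sum _ a hs
  have h2 := congrArg (fun a => diagEval (toDualC x) ((convEquiv hG hm hM).symm a))
    (eq_sum_lof a hs)
  simp only [map_sum] at h2
  rw [h1]
  refine Eq.trans (Finset.sum_congr rfl fun n _ => ?_) h2.symm
  rw [appell_eq hG hm hM]
  rfl

/-- Here the abstractly chosen kernels become computable: from now on ‖φ‖_{p,q,μ} is a weighted norm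
of the convolution of φ. -/
theorem appellKernels_eq (hG : G.IsNuclear) (hm : MomentBound μ p S K A)
    (hM : 0 < μ.real Set.univ) : appellKernels μ = conv hG hm := by
  have h : ∃ T : G.Poly →ₗ[ℂ] G.Kernels, ∀ φ x, evalPoly φ x = evalAppell μ (T φ) x :=
    ⟨conv hG hm, fun φ x => by
      rw [evalAppell_eq hG hm hM, ← convEquiv_apply hG hm hM, LinearEquiv.symm_apply_apply]⟩
  rw [appellKernels, dif_pos h]
  refine LinearMap.ext fun φ => ?_
  have h1 : φ = (convEquiv hG hm hM).symm (h.choose φ) :=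
    evalPoly_injective fun x => by rw [h.choose_spec φ x, evalAppell_eq hG hm hM]
  conv_rhs => rw [h1]
  rw [← convEquiv_apply hG hm hM, LinearEquiv.apply_symm_apply]

/-! ### The generalized Radon-Nikodym derivative -/

theorem diffOp_eq_sum (n : ℕ) (ζ : G.DualC) (φ : G.Poly) (x : G.Dual) {s : Finset ℕ}
    (hs : ∀ m ∉ s, φ m = 0) : diffOp n ζ φ x = ∑ m ∈ s, (m.descFactorial n : ℂ) *
      (φ m).1 fun j : Fin m => if (j : ℕ) < m - n then toDualC x else ζ :=
  toModule_eq_sum _ φ hs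

theorem apply_slots_eq {m n : ℕ} (h : n ≤ m) (φ : G.Form m) (x ζ : G.DualC) :
    (φ fun j : Fin m => if (j : ℕ) < m - n then x else ζ) =
      splitForm h φ (fun _ => x) fun _ => ζ := by
  rw [splitForm_apply]
  congr 1
  funext i
  obtain ⟨j, rfl⟩ := (slotEquiv h).surjective i
  rw [Equiv.symm_apply_apply]
  rcases j with j | j
  · rw [slotEquiv_inl, if_pos j.2]
    rfl
  · rw [slotEquiv_inr, if_neg (by omega)]
    rfl

/-- Since m!/(m-n)! = n! C(m,n), the Taylor coefficient of order n is exactly the degree-n component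
of the convolution. -/
theorem qPair_div_factorial (hG : G.IsNuclear) (hm : MomentBound μ p S K A) (n : ℕ)
    (ζ : G.DualC) (φ : G.Poly) :
    qPair μ n ζ φ / n.factorial = (conv hG hm φ n).1 fun _ => ζ := by
  obtain ⟨s, hs⟩ := exists_support φ
  have h1 : ∀ m, (fun x : G.Dual => (m.descFactorial n : ℂ) *
      (φ m).1 fun j : Fin m => if (j : ℕ) < m - n then toDualC x else ζ) =
      if h : n ≤ m then fun x => (m.descFactorial n : ℂ) *
        splitForm h (φ m).1 (fun _ => toDualC x) (fun _ => ζ) else fun _ => 0 := by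
    intro m
    split_ifs with h
    · simp only [apply_slots_eq h]
    · funext x
      rw [Nat.descFactorial_of_lt (not_le.1 h), Nat.cast_zero, zero_mul]
  have hint : ∀ m ∈ s, Integrable (fun x : G.Dual => (m.descFactorial n : ℂ) *
      (φ m).1 fun j : Fin m => if (j : ℕ) < m - n then toDualC x else ζ) μ := by
    intro m _
    rw [h1 m]
    split_ifs with h
    · exact (hG.integrable_splitForm hm h (φ m) _).const_mul _
    · exact integrable_zero _ _ _
  rw [qPair]
  simp only [diffOp_eq_sum n ζ φ _ hs]
  rw [integral_finsetSum s hint, conv_apply hG hm φ hs, sum_val, Finset.sum_div, sum_apply]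
  refine Finset.sum_congr rfl fun m _ => ?_
  rw [h1 m]
  split_ifs with h
  · rw [convComp_of_le hG hm h, integral_const_mul, Nat.descFactorial_eq_factorial_mul_choose]
    have h3 : (n.factorial : ℂ) ≠ 0 := by exact_mod_cast n.factorial_ne_zero
    change _ = (m.choose n : ℂ) * (contr hG hm h (φ m)).1 fun _ => ζ
    rw [contr_apply]
    push_cast
    field_simp
  · rw [convComp_of_lt hG hm (not_le.1 h)]
    simp

/-- Homogeneity turns the sign (-1)ⁿ into the argument -ζ; the Taylor series sums to the convolution
of φ evaluated there. -/
theorem rhoPair_eq (hG : G.IsNuclear) (hm : MomentBound μ p S K A) (ζ : G.DualC) (φ : G.Poly) :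
    rhoPair μ ζ φ = diagEval (-ζ) (conv hG hm φ) := by
  obtain ⟨s, hs⟩ := exists_support (conv hG hm φ)
  rw [diagEval_eq_sum _ _ hs, rhoPair, tsum_eq_sum (s := s)]
  · refine Finset.sum_congr rfl fun n _ => ?_
    rw [qPair_div_factorial hG hm]
    have h1 := ((conv hG hm φ n).1).map_smul_univ (fun _ => (-1 : ℂ)) fun _ => ζ
    rw [neg_one_smul ℂ ζ] at h1
    simp only [Finset.prod_const, Finset.card_univ, Fintype.card_fin,
      smul_eq_mul] at h1
    exact h1.symm
  · intro n hn
    rw [qPair_div_factorial hG hm, hs n hn]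
    simp


end Moments

variable {μ ν : Measure G.Dual}

/-- Tested on the constant polynomial 1, which would vanish almost everywhere if μ were zero. -/
theorem NonDegenerate.real_univ_pos (hμ : NonDegenerate μ) [IsFiniteMeasure μ] :
    0 < μ.real Set.univ := by
  have h1 : ∀ x : G.Dual, evalPoly
      (DirectSum.lof ℂ ℕ (fun n => G.Kernel n) 0 (tensorPow 0 (0 : G.NC))) x = 1 := fun x => by
    refine (diagEval_lof (toDualC x) 0 _).trans ?_
    rw [tensorPow_apply]
    simp
  refine ENNReal.toReal_pos (fun h0 => ?_) (measure_ne_top μ _)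
  have h2 := (hμ (DirectSum.lof ℂ ℕ (fun n => G.Kernel n) 0 (tensorPow 0 (0 : G.NC)))).1 (by
    rw [Measure.measure_univ_eq_zero.1 h0]
    simp) 0
  rw [h1] at h2
  exact one_ne_zero h2

/-! ### The norms of the spaces `(H_{p,q,μ})` -/

theorem norm_toHpq (p q : ℕ) (φ : G.Poly) : ‖toHpq μ p q φ‖ = polyNorm μ p q φ :=
  UniformSpace.Completion.norm_coe (E := NormedPoly μ p q) φ

theorem norm_toHpq_eq (hG : G.IsNuclear) {p : ℕ} {S : G.Dual → ℝ} {K A : ℝ}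
    (hm : MomentBound μ p S K A) (hM : 0 < μ.real Set.univ) (p₀ q : ℕ) (φ : G.Poly) :
    ‖toHpq μ p₀ q φ‖ = weightedNorm p₀ q (conv hG hm φ) := by
  rw [norm_toHpq]
  change weightedNorm p₀ q (appellKernels μ φ) = _
  rw [appellKernels_eq hG hm hM]

theorem denseRange_toHpq (p q : ℕ) : DenseRange (toHpq μ p q) :=
  UniformSpace.Completion.denseRange_coe (α := NormedPoly μ p q)

theorem weightedNorm_nonneg (p q : ℕ) (a : G.Kernels) : 0 ≤ weightedNorm p q a :=
  Real.sqrt_nonneg _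

theorem kernelNorm_le_weightedNorm (p s n : ℕ) (a : G.Kernels) :
    n.factorial * (2 ^ s) ^ n * kernelNorm n p (a n) ≤ weightedNorm p (2 * s) a := by
  obtain ⟨t, ht⟩ := exists_support a
  have h0 : 0 ≤ kernelNorm n p (a n) := apply_nonneg _ _
  -- Inserting n allows for a degree outside the support.
  rw [weightedNorm_eq p (2 * s) a (insert n t) fun k hk =>
    ht k fun h => hk (Finset.mem_insert_of_mem h)]
  refine Real.le_sqrt_of_sq_le ?_
  refine le_trans (le_of_eq ?_) (Finset.single_le_sum (f := fun n => ((n.factorial : ℝ) ^ 2 *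
    2 ^ (2 * s * n)) * kernelNorm n p (a n) ^ 2) (fun k _ => by positivity)
    (Finset.mem_insert_self n t))
  rw [mul_pow, mul_pow, ← pow_mul, ← pow_mul]
  ring_nf

/-- In the radius, 2^s is the square root of the weight 2^{2s}, and the numerator 2 comes from
`formBound_kernelNorm`. -/
theorem seqBound_weightedNorm (p s : ℕ) (a : G.Kernels) :
    SeqBound p (weightedNorm p (2 * s) a) (2 / 2 ^ s) a := fun n => by
  refine (formBound_kernelNorm (a n)).mono ?_
  have h := kernelNorm_le_weightedNorm p s n a
  rw [div_pow, le_div_iff₀ (by positivity), mul_div_assoc', le_div_iff₀ (by positivity)]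
  calc _ = 2 ^ n * (n.factorial * (2 ^ s) ^ n * kernelNorm n p (a n)) := by ring
    _ ≤ 2 ^ n * weightedNorm p (2 * s) a := by gcongr
    _ = _ := by ring

/-- Converse of `seqBound_weightedNorm`: n! cancels, and r₀ is chosen so small against the weight
2^q and the nuclear constant C that the squared terms decay like 2^{-n}. -/
theorem IsNuclear.exists_weightedNorm_le (hG : G.IsNuclear) (p q : ℕ) :
    ∃ P, ∃ r₀ > 0, ∀ p', P ≤ p' → ∀ (W r : ℝ), 0 ≤ W → 0 ≤ r → r ≤ r₀ → ∀ a : G.Kernels,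
      SeqBound p' W r a → weightedNorm p q a ≤ 2 * W := by
  obtain ⟨P, -, C, hC, h⟩ := hG.exists_kernelNorm_le p
  refine ⟨P, 1 / (2 ^ (q + 1) * C), by positivity, fun p' hp' W r hW hr hr₀ a ha => ?_⟩
  obtain ⟨N, hN⟩ := exists_support_range a
  rw [weightedNorm_eq p q a _ hN]
  have h1 : C * r ≤ 1 / 2 ^ (q + 1) := by
    rw [le_div_iff₀ (by positivity)] at hr₀ ⊢
    linarith
  have h2 : (2 : ℝ) ^ q * (C * r) ^ 2 ≤ 1 / 2 := by
    calc (2 : ℝ) ^ q * (C * r) ^ 2 ≤ 2 ^ q * (1 / 2 ^ (q + 1)) ^ 2 := by gcongr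
      _ = 1 / 2 * (1 / 2 ^ (q + 1)) := by field_simp; ring
      _ ≤ 1 / 2 * 1 := by
        gcongr
        rw [div_le_one (by positivity)]
        exact one_le_pow₀ (by norm_num)
      _ = 1 / 2 := mul_one _
  refine Real.sqrt_le_iff.2 ⟨by positivity, ?_⟩
  have h3 : ∀ n ∈ Finset.range N, ((n.factorial : ℝ) ^ 2 * 2 ^ (q * n)) * kernelNorm n p (a n) ^ 2
      ≤ W ^ 2 * (1 / 2) ^ n := by
    intro n _
    have h4 := h p' hp' n (a n) _ (by positivity) (ha n)
    have h0 : 0 ≤ kernelNorm n p (a n) := apply_nonneg _ _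
    calc _ ≤ ((n.factorial : ℝ) ^ 2 * 2 ^ (q * n)) * (C ^ n * (W * r ^ n / n.factorial)) ^ 2 := by
          gcongr
      _ = W ^ 2 * (2 ^ q * (C * r) ^ 2) ^ n := by
          have : (n.factorial : ℝ) ≠ 0 := by positivity
          rw [pow_mul]
          field_simp
          ring
      _ ≤ _ := by gcongr
  refine (Finset.sum_le_sum h3).trans ?_
  rw [← Finset.mul_sum]
  have h5 := (summable_geometric_of_lt_one (r := (1 / 2 : ℝ)) (by norm_num)
    (by norm_num)).sum_le_tsum (Finset.range N) fun i _ => by positivity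
  rw [tsum_geometric_of_lt_one (by norm_num) (by norm_num)] at h5
  nlinarith [sq_nonneg W]

theorem exists_two_div_pow_le {r₀ : ℝ} (hr₀ : 0 < r₀) : ∃ s₀ : ℕ, ∀ s, s₀ ≤ s →
    (2 : ℝ) / 2 ^ s ≤ r₀ := by
  obtain ⟨s₀, hs₀⟩ := pow_unbounded_of_one_lt (2 / r₀) (one_lt_two : (1 : ℝ) < 2)
  refine ⟨s₀, fun s hs => ?_⟩
  have h1 : (2 : ℝ) ^ s₀ ≤ 2 ^ s := pow_le_pow_right₀ one_le_two hs
  rw [div_lt_iff₀ hr₀] at hs₀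
  rw [div_le_iff₀ (by positivity), mul_comm]
  exact hs₀.le.trans (mul_le_mul_of_nonneg_right h1 hr₀.le)

variable {pm pn : ℕ} {Sm Sn : G.Dual → ℝ} {Km Kn Am An : ℝ}

/-- Comparison of the norms `‖·‖_{p,q,μ}` and `‖·‖_{p',q',ν}`. -/
theorem exists_norm_toHpq_le (hG : G.IsNuclear) (hm : MomentBound μ pm Sm Km Am)
    (hM : 0 < μ.real Set.univ) (hn : MomentBound ν pn Sn Kn An) (hN : 0 < ν.real Set.univ)
    (p q : ℕ) : ∃ P s₀ : ℕ, ∃ C : ℝ, 0 ≤ C ∧ ∀ p' s, P ≤ p' → s₀ ≤ s → ∀ φ : G.Poly,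
      ‖toHpq μ p q φ‖ ≤ C * ‖toHpq ν p' (2 * s) φ‖ := by
  obtain ⟨P, r₀, hr₀, h⟩ := hG.exists_weightedNorm_le p q
  obtain ⟨r₁, hr₁, h₁⟩ := hm.exists_radius hM
  obtain ⟨r₂, hr₂, h₂⟩ := hn.exists_radius hN
  obtain ⟨s₀, hs₀⟩ := exists_two_div_pow_le (lt_min hr₀ (lt_min hr₁ hr₂))
  have hK := hm.K_pos
  refine ⟨max P (max pm pn), s₀, 2 * (2 * Km * (2 / ν.real Set.univ)), by positivity,
    fun p' s hp' hs φ => ?_⟩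
  have hr := hs₀ s hs
  have hr' : (0 : ℝ) ≤ 2 / 2 ^ s := by positivity
  have hW := weightedNorm_nonneg p' (2 * s) (conv hG hn φ)
  obtain ⟨h3, -⟩ := h₁ _ hr' (hr.trans ((min_le_right _ _).trans (min_le_left _ _)))
  obtain ⟨h4, h5⟩ := h₂ _ hr' (hr.trans ((min_le_right _ _).trans (min_le_right _ _)))
  -- From the ν-kernels back to the polynomial, then forward to its μ-kernels.
  have h6 := SeqBound.of_conv hG hn hN (le_trans (by omega) hp') hW hr' h4 h5
    (seqBound_weightedNorm p' s (conv hG hn φ))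
  have h7 := SeqBound.conv hG hm (le_trans (by omega) hp') (by positivity) hr' h3 h6
  rw [norm_toHpq_eq hG hm hM, norm_toHpq_eq hG hn hN]
  refine (h p' (le_trans (by omega) hp') _ _ (by positivity) hr' (hr.trans (min_le_left _ _)) _
    h7).trans (le_of_eq ?_)
  ring

/-! ### Extension of operators on the test space -/

/-- The inclusion `𝒫(𝒩') → (𝒩)¹` as a linear map. -/
noncomputable def toTestLin (μ : Measure G.Dual) : G.Poly →ₗ[ℂ] TestSpace μ :=
  (LinearMap.pi fun i : ℕ × ℕ => toHpq μ i.1 i.2).codRestrict (TestSpace μ) fun φ =>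
    (toTest μ φ).2

theorem exists_norm_lt_of_mem_nhds {V : Set (TestSpace μ)} (hV : V ∈ 𝓝 0) :
    ∃ I : Finset (ℕ × ℕ), ∃ δ > 0, ∀ f : TestSpace μ,
      (∀ i ∈ I, ‖ofTest μ i.1 i.2 f‖ < δ) → f ∈ V := by
  rw [nhds_subtype_eq_comap, Filter.mem_comap] at hV
  obtain ⟨W, hW, hWV⟩ := hV
  rw [nhds_pi, Filter.mem_pi] at hW
  obtain ⟨I, hI, t, ht, htW⟩ := hW
  choose δ hδ hδt using fun i => Metric.mem_nhds_iff.1 (ht i)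
  obtain ⟨ε, hε, h⟩ := hI.isCompact.exists_forall_le' (f := δ) (a := 0)
    (continuous_of_discreteTopology.continuousOn) fun i _ => hδ i
  refine ⟨hI.toFinset, ε, hε, fun f hf => hWV (htW fun i hi => hδt i ?_)⟩
  change _ ∈ Metric.ball (0 : Hpq μ i.1 i.2) _
  rw [mem_ball_zero_iff]
  exact (hf i (hI.mem_toFinset.2 hi)).trans_le (h i hi)

theorem exists_extension_toHpq {F : Type*} [NormedAddCommGroup F] [NormedSpace ℂ F]
    [CompleteSpace F] {p q : ℕ} (f : G.Poly →ₗ[ℂ] F) {C : ℝ}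
    (h : ∀ φ, ‖f φ‖ ≤ C * ‖toHpq μ p q φ‖) :
    ∃ g : Hpq μ p q →L[ℂ] F, (∀ φ, g (toHpq μ p q φ) = f φ) ∧ ∀ x, ‖g x‖ ≤ C * ‖x‖ :=
  ⟨LinearMap.extendOfNorm (E := G.Poly) (Eₗ := Hpq μ p q) f (toHpq μ p q),
    fun φ => LinearMap.extendOfNorm_eq (E := G.Poly) (denseRange_toHpq p q) ⟨C, h⟩ φ,
    fun x => LinearMap.norm_extendOfNorm_apply_le (E := G.Poly) (denseRange_toHpq p q) C h x⟩

/-- A scaling argument; the additional t > 0 covers vectors with C ‖e v‖ = 0. -/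
theorem norm_le_of_forall_lt {E F V : Type*} [AddCommGroup V] [Module ℂ V]
    [SeminormedAddCommGroup E] [NormedSpace ℂ E] [SeminormedAddCommGroup F] [NormedSpace ℂ F]
    (f : V →ₗ[ℂ] F) (e : V →ₗ[ℂ] E) {C δ : ℝ} (hC : 0 ≤ C) (hδ : 0 < δ)
    (h : ∀ v, C * ‖e v‖ < δ → ‖f v‖ < 1) (v : V) : ‖f v‖ ≤ C / δ * ‖e v‖ := by
  refine le_of_forall_pos_lt_add fun t ht => ?_
  set c := C / δ * ‖e v‖ + t with hc
  have hc0 : 0 < c := by positivity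
  have h2 := h ((c⁻¹ : ℂ) • v) (by
    rw [map_smul, norm_smul, norm_inv, Complex.norm_real, Real.norm_of_nonneg hc0.le]
    have h3 : C * ‖e v‖ < c * δ := by
      have h4 : c * δ = C * ‖e v‖ + t * δ := by
        rw [hc]
        field_simp
      rw [h4]
      exact lt_add_of_pos_right _ (mul_pos ht hδ)
    calc _ = (C * ‖e v‖) / c := by ring
      _ < δ := by rwa [div_lt_iff₀ hc0, mul_comm δ])
  rwa [map_smul, norm_smul, norm_inv, Complex.norm_real, Real.norm_of_nonneg hc0.le,
    inv_mul_lt_iff₀ hc0, mul_one] at h2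

theorem exists_linearMap_ofTest (B : TestSpace μ →L[ℂ] TestSpace μ) (p q : ℕ) :
    ∃ f : G.Poly →ₗ[ℂ] Hpq μ p q, ∀ φ, f φ = ofTest μ p q (B (toTest μ φ)) :=
  ⟨LinearMap.proj (R := ℂ) (φ := fun i : ℕ × ℕ => Hpq μ i.1 i.2) (p, q) ∘ₗ
    (TestSpace μ).subtype ∘ₗ B.toLinearMap ∘ₗ toTestLin μ, fun _ => rfl⟩

theorem exists_norm_ofTest_lt (B : TestSpace μ →L[ℂ] TestSpace μ) (p q : ℕ) :
    ∃ I : Finset (ℕ × ℕ), ∃ δ > 0, ∀ f : TestSpace μ,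
      (∀ i ∈ I, ‖ofTest μ i.1 i.2 f‖ < δ) → ‖ofTest μ p q (B f)‖ < 1 := by
  have hcont : Continuous fun g : TestSpace μ => ofTest μ p q (B g) :=
    (continuous_apply (p, q)).comp (continuous_subtype_val.comp B.continuous)
  have h0 : ofTest μ p q (B 0) = 0 := by
    rw [map_zero]
    rfl
  have h1 : {g : TestSpace μ | ‖ofTest μ p q (B g)‖ < 1} ∈ 𝓝 0 :=
    (isOpen_lt hcont.norm continuous_const).mem_nhds (by
      rw [Set.mem_ofPred_eq, h0, norm_zero]
      exact one_pos)
  exact exists_norm_lt_of_mem_nhds h1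

/-- Continuity of B into one target norm involves finitely many μ-norms, and a single ν-norm of
large index dominates them all. The target indices are arbitrary, which the choice of a small
exponential type requires. -/
theorem exists_isExtension (hG : G.IsNuclear) (hm : MomentBound μ pm Sm Km Am)
    (hM : 0 < μ.real Set.univ) (hn : MomentBound ν pn Sn Kn An) (hN : 0 < ν.real Set.univ)
    (B : TestSpace μ →L[ℂ] TestSpace μ) (p₀ q₀ : ℕ) :
    ∃ p q, ∃ B' : Hpq ν p q →L[ℂ] Hpq μ p₀ q₀, IsExtension μ ν B p q p₀ q₀ B' := by
  obtain ⟨f, hf⟩ := exists_linearMap_ofTest B p₀ q₀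
  obtain ⟨I, δ, hδ, hI⟩ := exists_norm_ofTest_lt B p₀ q₀
  choose P s C hC hle using fun i : ℕ × ℕ => exists_norm_toHpq_le hG hm hM hn hN i.1 i.2
  have hC1 : 0 ≤ ∑ i ∈ I, C i := Finset.sum_nonneg fun i _ => hC i
  have key : ∀ φ, (∑ i ∈ I, C i) * ‖toHpq ν (I.sup P) (2 * I.sup s) φ‖ < δ → ‖f φ‖ < 1 := by
    intro φ hφ
    rw [hf]
    refine hI (toTest μ φ) fun i hi => ?_
    change ‖toHpq μ i.1 i.2 φ‖ < δ
    refine ((hle i _ _ (Finset.le_sup hi) (Finset.le_sup hi) φ).trans ?_).trans_lt hφ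
    exact mul_le_mul_of_nonneg_right (Finset.single_le_sum (fun i _ => hC i) hi) (norm_nonneg _)
  have hbound := norm_le_of_forall_lt (F := Hpq μ p₀ q₀) (V := G.Poly)
    (E := Hpq ν (I.sup P) (2 * I.sup s)) f (toHpq ν _ _) hC1 hδ key
  obtain ⟨B', hB', -⟩ := exists_extension_toHpq f hbound
  exact ⟨_, _, B', fun φ => (hB' φ).trans (hf φ)⟩

/-! ### Independence of the symbol of the choice of the extension -/

/-- The identity holds on polynomials and is a closed condition, so it holds on their closure. -/
theorem IsRho.apply_eq {p₁ q₁ p₂ q₂ : ℕ} {ζ : G.DualC} {R₁ : Hpq μ p₁ q₁ →L[ℂ] ℂ}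
    {R₂ : Hpq μ p₂ q₂ →L[ℂ] ℂ} (h₁ : IsRho μ p₁ q₁ ζ R₁) (h₂ : IsRho μ p₂ q₂ ζ R₂)
    (f : TestSpace μ) : R₁ (ofTest μ p₁ q₁ f) = R₂ (ofTest μ p₂ q₂ f) := by
  have hclosed : IsClosed {g : ∀ i : ℕ × ℕ, Hpq μ i.1 i.2 | R₁ (g (p₁, q₁)) = R₂ (g (p₂, q₂))} :=
    isClosed_eq (R₁.continuous.comp (continuous_apply (p₁, q₁)))
      (R₂.continuous.comp (continuous_apply (p₂, q₂)))
  refine closure_minimal ?_ hclosed f.2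
  rintro _ ⟨φ, rfl⟩
  exact (h₁ φ).trans (h₂ φ).symm

/-- Pair the exponential series termwise. Each term is a polynomial, on which every extension agrees
with B itself, and B maps it into the test space, where all versions of ρ_μ coincide. -/
theorem IsSymbolValue.unique {B : TestSpace μ →L[ℂ] TestSpace μ} {ξ η : G.NC} {z₁ z₂ : ℂ}
    (h₁ : IsSymbolValue μ ν B ξ η z₁) (h₂ : IsSymbolValue μ ν B ξ η z₂) : z₁ = z₂ := by
  obtain ⟨p₁, q₁, p, q, B₁, e₁, R₁, hB₁, -, ⟨s, hs, he₁⟩, hR₁, rfl⟩ := h₁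
  obtain ⟨p₂, q₂, p', q', B₂, e₂, R₂, hB₂, -, ⟨t, ht, he₂⟩, hR₂, rfl⟩ := h₂
  have hst : s = t := funext fun n => evalPoly_injective fun x => by rw [hs, ht]
  subst hst
  have h3 := (he₁.mapL B₁).mapL R₁
  have h4 := (he₂.mapL B₂).mapL R₂
  refine h3.unique (h4.congr_fun fun n => ?_)
  rw [hB₁ (s n), hB₂ (s n)]
  exact hR₁.apply_eq hR₂ _

/-! ### Normalized exponentials -/

/-- The polynomial `⟨P_{n,ν}(·) | η^{⊗n}⟩ / n!`. -/
noncomputable def expTerm (hG : G.IsNuclear) (hn : MomentBound ν pn Sn Kn An)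
    (hN : 0 < ν.real Set.univ) (n : ℕ) (η : G.NC) : G.Poly :=
  (1 / n.factorial : ℂ) • (convEquiv hG hn hN).symm
    (DirectSum.lof ℂ ℕ (fun n => G.Kernel n) n (tensorPow n η))

theorem evalPoly_expTerm (hG : G.IsNuclear) (hn : MomentBound ν pn Sn Kn An)
    (hN : 0 < ν.real Set.univ) (n : ℕ) (η : G.NC) (x : G.Dual) :
    evalPoly (expTerm hG hn hN n η) x =
      (1 / n.factorial : ℂ) * appell ν n x (tensorPow n η) := by
  rw [expTerm, evalPoly_smul, appell_eq hG hn hN, appellFun_apply]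

theorem sqrt_pow_eq {x : ℝ} (hx : 0 ≤ x) (n : ℕ) : √(x ^ n) = √x ^ n := by
  rw [Real.sqrt_eq_iff_mul_self_eq (by positivity) (by positivity), ← mul_pow,
    Real.mul_self_sqrt hx]

/-- The weight (n!)² cancels the coefficient 1/n!, leaving a geometric series; |η|_p² < 2^{-q-1}
makes its ratio at most √(1/2). -/
theorem norm_toHpq_expTerm_le (hG : G.IsNuclear) (hn : MomentBound ν pn Sn Kn An)
    (hN : 0 < ν.real Set.univ) (p q n : ℕ) (η : G.NC) :
    ‖toHpq ν p q (expTerm hG hn hN n η)‖ ≤ √(2 ^ q * normC p η ^ 2) ^ n := by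
  have h1 : kernelNorm n p (tensorPow n η) ≤ √((normC p η ^ 2) ^ n) := by
    rw [kernelNorm_apply]
    exact Real.iSup_le (fun e => tensorPow_bound n p η e) (Real.sqrt_nonneg _)
  have h0 : 0 ≤ kernelNorm n p (tensorPow n η) := apply_nonneg _ _
  rw [norm_toHpq_eq hG hn hN, expTerm, map_smul, weightedNorm_smul, ← convEquiv_apply hG hn hN,
    LinearEquiv.apply_symm_apply, weightedNorm_eq p q _ {n} fun k hk =>
      lof_apply_ne (Finset.mem_singleton.not.1 hk) _, Finset.sum_singleton, lof_apply_same,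
    ← sqrt_pow_eq (by positivity), mul_pow, ← pow_mul 2 q]
  have hf : (n.factorial : ℝ) ≠ 0 := by positivity
  have h2 : ‖(1 / n.factorial : ℂ)‖ = 1 / n.factorial := by simp
  rw [h2, mul_assoc, Real.sqrt_mul (by positivity), Real.sqrt_sq (by positivity), ← mul_assoc,
    one_div_mul_cancel hf, one_mul]
  refine Real.sqrt_le_sqrt ?_
  refine mul_le_mul_of_nonneg_left ?_ (by positivity)
  calc _ ≤ √((normC p η ^ 2) ^ n) ^ 2 := by gcongr
    _ = _ := Real.sq_sqrt (by positivity)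

theorem norm_toHpq_expTerm_le_of_lt (hG : G.IsNuclear) (hn : MomentBound ν pn Sn Kn An)
    (hN : 0 < ν.real Set.univ) {p q : ℕ} {η : G.NC} (hη : normC p η ^ 2 < (2 ^ (q + 1) : ℝ)⁻¹)
    (n : ℕ) : ‖toHpq ν p q (expTerm hG hn hN n η)‖ ≤ √(1 / 2) ^ n := by
  refine (norm_toHpq_expTerm_le hG hn hN p q n η).trans ?_
  have h1 : 2 ^ q * normC p η ^ 2 ≤ 1 / 2 := by
    calc 2 ^ q * normC p η ^ 2 ≤ 2 ^ q * (2 ^ (q + 1) : ℝ)⁻¹ := by gcongr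
      _ = 1 / 2 := by rw [pow_succ]; field_simp
  gcongr

theorem sqrt_half_lt_one : √(1 / 2 : ℝ) < 1 := by
  rw [Real.sqrt_lt' one_pos]
  norm_num

theorem summable_expTerm (hG : G.IsNuclear) (hn : MomentBound ν pn Sn Kn An)
    (hN : 0 < ν.real Set.univ) {p q : ℕ} {η : G.NC} (hη : normC p η ^ 2 < (2 ^ (q + 1) : ℝ)⁻¹) :
    Summable fun n => toHpq ν p q (expTerm hG hn hN n η) :=
  Summable.of_norm_bounded (summable_geometric_of_lt_one (Real.sqrt_nonneg _) sqrt_half_lt_one)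
    (norm_toHpq_expTerm_le_of_lt hG hn hN hη)

theorem isNormExp_tsum (hG : G.IsNuclear) (hn : MomentBound ν pn Sn Kn An)
    (hN : 0 < ν.real Set.univ) {p q : ℕ} {η : G.NC} (hη : normC p η ^ 2 < (2 ^ (q + 1) : ℝ)⁻¹) :
    IsNormExp ν p q η (∑' n, toHpq ν p q (expTerm hG hn hN n η)) :=
  ⟨fun n => expTerm hG hn hN n η, fun n x => evalPoly_expTerm hG hn hN n η x,
    (summable_expTerm hG hn hN hη).hasSum⟩

theorem norm_tsum_expTerm_le (hG : G.IsNuclear) (hn : MomentBound ν pn Sn Kn An)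
    (hN : 0 < ν.real Set.univ) {p q : ℕ} {η : G.NC} (hη : normC p η ^ 2 < (2 ^ (q + 1) : ℝ)⁻¹) :
    ‖∑' n, toHpq ν p q (expTerm hG hn hN n η)‖ ≤ (1 - √(1 / 2))⁻¹ :=
  tsum_of_norm_bounded (hasSum_geometric_of_lt_one (Real.sqrt_nonneg _) sqrt_half_lt_one)
    (norm_toHpq_expTerm_le_of_lt hG hn hN hη)


/-! ### Restriction of multilinear maps to complex lines -/

/-- The Lagrange basis polynomials at the nodes `0, ..., n`. -/
noncomputable def lineWeight (n j : ℕ) : Polynomial ℂ :=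
  Lagrange.basis (Finset.range (n + 1)) (fun j : ℕ => (j : ℂ)) j

/-- On a line F is a polynomial in t of degree at most n, hence equal to its Lagrange interpolant.
Only diagonal values appear, with weights independent of F, so the formula passes to tensor powers
and to functionals without mixed terms. -/
theorem multilinear_diag_add_smul {n : ℕ} {E : Type*} [AddCommGroup E] [Module ℂ E]
    (F : MultilinearMap ℂ (fun _ : Fin n => E) ℂ) (a b : E) (t : ℂ) :
    (F fun _ => a + t • b) =
      ∑ j ∈ Finset.range (n + 1), (lineWeight n j).eval t * F fun _ => a + (j : ℂ) • b := by
  classical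
  let P : Polynomial ℂ := ∑ s : Finset (Fin n),
    Polynomial.C (F (s.piecewise (fun _ => b) fun _ => a)) * Polynomial.X ^ s.card
  have hP : ∀ t : ℂ, P.eval t = F fun _ => a + t • b := by
    intro t
    have h1 := F.map_add_univ (fun _ => t • b) fun _ => a
    have h2 : ((fun _ : Fin n => t • b) + fun _ => a) = fun _ => a + t • b :=
      funext fun _ => add_comm _ _
    rw [h2] at h1
    rw [h1, Polynomial.eval_finsetSum]
    refine Finset.sum_congr rfl fun s _ => ?_
    have h3 := F.map_piecewise_smul (fun _ => t) (s.piecewise (fun _ => b) fun _ => a) s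
    rw [Finset.prod_const, smul_eq_mul] at h3
    rw [Polynomial.eval_mul, Polynomial.eval_C, Polynomial.eval_pow, Polynomial.eval_X, mul_comm,
      ← h3]
    congr 1
    funext i
    by_cases hi : i ∈ s <;> simp [hi]
  have hdeg : P.degree < (Finset.range (n + 1)).card := by
    rw [Finset.card_range]
    refine (Polynomial.degree_sum_le _ _).trans_lt ?_
    rw [Finset.sup_lt_iff (by exact WithBot.bot_lt_coe _)]
    intro s _
    refine (Polynomial.degree_C_mul_X_pow_le _ _).trans_lt ?_
    have : s.card ≤ n := (Finset.card_le_univ s).trans_eq (Fintype.card_fin n)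
    exact_mod_cast Nat.lt_succ_of_le this
  have hinj : Set.InjOn (fun j : ℕ => (j : ℂ)) (Finset.range (n + 1)) :=
    fun i _ j _ h => Nat.cast_injective h
  have h4 := congrArg (Polynomial.eval t) (Lagrange.eq_interpolate hinj hdeg)
  rw [hP, Lagrange.interpolate_apply, Polynomial.eval_finsetSum] at h4
  rw [h4]
  refine Finset.sum_congr rfl fun j _ => ?_
  rw [Polynomial.eval_mul, Polynomial.eval_C, hP, mul_comm]
  rfl

theorem tensorPow_add_smul (n : ℕ) (η v : G.NC) (t : ℂ) :
    tensorPow n (η + t • v) = ∑ j ∈ Finset.range (n + 1),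
      (lineWeight n j).eval t • tensorPow n (η + (j : ℂ) • v) := by
  refine Subtype.ext (MultilinearMap.ext fun y => ?_)
  rw [sum_val, sum_apply, tensorPow_apply]
  have h := multilinear_diag_add_smul ((MultilinearMap.mkPiAlgebra ℂ (Fin n) ℂ).compLinearMap
    fun j => pairLinRight (y j)) η v t
  simp only [MultilinearMap.compLinearMap_apply, MultilinearMap.mkPiAlgebra_apply,
    pairLinRight_apply] at h
  rw [h]
  refine Finset.sum_congr rfl fun j _ => ?_
  rw [← tensorPow_apply]
  rfl

/-! ### Norms on `𝒩_ℂ` -/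

theorem continuous_re : Continuous (Cplx.re : G.NC → G.N) := continuous_fst

theorem continuous_im : Continuous (Cplx.im : G.NC → G.N) := continuous_snd

/-- The norm `|a|_p + |b|_p` of `a + i b`. -/
noncomputable def sumNorm (p : ℕ) (η : G.NC) : ℝ := ‖G.proj p η.re‖ + ‖G.proj p η.im‖

theorem sumNorm_nonneg (p : ℕ) (η : G.NC) : 0 ≤ sumNorm p η :=
  add_nonneg (norm_nonneg _) (norm_nonneg _)

theorem continuous_normC (p : ℕ) : Continuous (normC (G := G) p) :=
  ((((G.proj p).continuous.comp continuous_re).norm.pow 2).add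
    (((G.proj p).continuous.comp continuous_im).norm.pow 2)).sqrt

theorem continuous_line (η v : G.NC) : Continuous fun t : ℂ => η + t • v := by
  refine Continuous.prodMk (X := G.N) (Y := G.N) (Z := ℂ)
    (f := fun t : ℂ => η.re + (t.re • v.re - t.im • v.im))
    (g := fun t : ℂ => η.im + (t.re • v.im + t.im • v.re)) ?_ ?_
  · exact continuous_const.add ((Complex.continuous_re.smul continuous_const).sub
      (Complex.continuous_im.smul continuous_const))
  · exact continuous_const.add ((Complex.continuous_re.smul continuous_const).add
      (Complex.continuous_im.smul continuous_const))

theorem sumNorm_smul_le (p : ℕ) (t : ℂ) (η : G.NC) :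
    sumNorm p (t • η) ≤ 2 * ‖t‖ * sumNorm p η := by
  have h1 : ‖G.proj p (t • η).re‖ ≤ ‖t‖ * ‖G.proj p η.re‖ + ‖t‖ * ‖G.proj p η.im‖ := by
    rw [Cplx.smul_re, map_sub, map_smul, map_smul]
    refine (norm_sub_le _ _).trans ?_
    rw [norm_smul, norm_smul]
    gcongr
    · exact Complex.abs_re_le_norm t
    · exact Complex.abs_im_le_norm t
  have h2 : ‖G.proj p (t • η).im‖ ≤ ‖t‖ * ‖G.proj p η.im‖ + ‖t‖ * ‖G.proj p η.re‖ := by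
    rw [Cplx.smul_im, map_add, map_smul, map_smul]
    refine (norm_add_le _ _).trans ?_
    rw [norm_smul, norm_smul]
    gcongr
    · exact Complex.abs_re_le_norm t
    · exact Complex.abs_im_le_norm t
  unfold sumNorm
  linarith

theorem norm_proj_re_le (p : ℕ) (θ : G.NC) : ‖G.proj p θ.re‖ ≤ normC p θ :=
  Real.le_sqrt_of_sq_le (by linarith [sq_nonneg ‖G.proj p θ.im‖])

theorem norm_proj_im_le (p : ℕ) (θ : G.NC) : ‖G.proj p θ.im‖ ≤ normC p θ :=
  Real.le_sqrt_of_sq_le (by linarith [sq_nonneg ‖G.proj p θ.re‖])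

theorem normC_add_le (p : ℕ) (η v : G.NC) : normC p (η + v) ≤ normC p η + sumNorm p v := by
  have h1 : ‖G.proj p (η + v).re‖ ≤ ‖G.proj p η.re‖ + ‖G.proj p v.re‖ := by
    change ‖G.proj p (η.re + v.re)‖ ≤ _
    rw [map_add]
    exact norm_add_le _ _
  have h2 : ‖G.proj p (η + v).im‖ ≤ ‖G.proj p η.im‖ + ‖G.proj p v.im‖ := by
    change ‖G.proj p (η.im + v.im)‖ ≤ _
    rw [map_add]
    exact norm_add_le _ _
  have h0 : 0 ≤ normC p η := Real.sqrt_nonneg _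
  have hs : normC p η ^ 2 = ‖G.proj p η.re‖ ^ 2 + ‖G.proj p η.im‖ ^ 2 :=
    Real.sq_sqrt (by positivity)
  have h3 := norm_proj_re_le p η
  have h4 := norm_proj_im_le p η
  have hv1 := norm_nonneg (G.proj p v.re)
  have hv2 := norm_nonneg (G.proj p v.im)
  refine Real.sqrt_le_iff.2 ⟨add_nonneg h0 (sumNorm_nonneg p v), ?_⟩
  calc _ ≤ (‖G.proj p η.re‖ + ‖G.proj p v.re‖) ^ 2 + (‖G.proj p η.im‖ + ‖G.proj p v.im‖) ^ 2 := by
        gcongr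
    _ ≤ _ := by
        unfold sumNorm
        nlinarith [mul_le_mul_of_nonneg_right h3 hv1, mul_le_mul_of_nonneg_right h4 hv2,
          mul_nonneg hv1 hv2]

/-! ### The inclusion of `𝒩_ℂ` into `𝒩'_ℂ` -/

theorem incl_add (ξ w : G.NC) : incl (ξ + w) = incl ξ + incl w := by
  refine ContinuousLinearMap.ext fun θ => ?_
  change ((inner ℝ (G.proj 0 (ξ.re + w.re)) (G.proj 0 θ) : ℝ) : ℂ) +
    Complex.I * ((inner ℝ (G.proj 0 (ξ.im + w.im)) (G.proj 0 θ) : ℝ) : ℂ) =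
    (((inner ℝ (G.proj 0 ξ.re) (G.proj 0 θ) : ℝ) : ℂ) +
      Complex.I * ((inner ℝ (G.proj 0 ξ.im) (G.proj 0 θ) : ℝ) : ℂ)) +
    (((inner ℝ (G.proj 0 w.re) (G.proj 0 θ) : ℝ) : ℂ) +
      Complex.I * ((inner ℝ (G.proj 0 w.im) (G.proj 0 θ) : ℝ) : ℂ))
  rw [map_add, map_add, inner_add_left, inner_add_left]
  push_cast
  ring

theorem incl_smul (t : ℂ) (ξ : G.NC) : incl (t • ξ) = t • incl ξ := by
  refine ContinuousLinearMap.ext fun θ => ?_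
  change ((inner ℝ (G.proj 0 (t.re • ξ.re - t.im • ξ.im)) (G.proj 0 θ) : ℝ) : ℂ) +
    Complex.I * ((inner ℝ (G.proj 0 (t.re • ξ.im + t.im • ξ.re)) (G.proj 0 θ) : ℝ) : ℂ) =
    t * (((inner ℝ (G.proj 0 ξ.re) (G.proj 0 θ) : ℝ) : ℂ) +
      Complex.I * ((inner ℝ (G.proj 0 ξ.im) (G.proj 0 θ) : ℝ) : ℂ))
  rw [map_sub, map_add, map_smul, map_smul, map_smul, map_smul, inner_sub_left, inner_add_left,
    inner_smul_left, inner_smul_left, inner_smul_left, inner_smul_left]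
  conv_rhs => rw [← Complex.re_add_im t]
  simp only [RCLike.conj_to_real]
  push_cast
  linear_combination -(t.im : ℂ) * ((inner ℝ (G.proj 0 ξ.im) (G.proj 0 θ) : ℝ) : ℂ) *
    Complex.I_mul_I

theorem neg_incl_neg (ξ : G.NC) : -incl (-ξ) = incl ξ := by
  have h1 : (-ξ : G.NC) = (-1 : ℂ) • ξ := (neg_one_smul ℂ ξ).symm
  rw [h1, incl_smul]
  refine ContinuousLinearMap.ext fun θ => ?_
  change -(-1 * incl ξ θ) = incl ξ θ
  ring

/-- A crude bound by the norm of H, locally bounded in ξ; it suffices for convergence and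
holomorphy, while the growth estimate uses `dualBound_dualNormC`. -/
theorem dualBound_incl (p : ℕ) (ξ : G.NC) : DualBound p (incl ξ) (sumNorm 0 ξ) := by
  have h := (dualBound_riesz 0 (G.proj 0 ξ.re)).add
    ((dualBound_riesz 0 (G.proj 0 ξ.im)).smul Complex.I)
  rw [Complex.norm_I, one_mul] at h
  exact h.mono (Nat.zero_le p) (sumNorm_nonneg 0 ξ) le_rfl

theorem norm_pair_incl_le_dualNormC (p : ℕ) (ξ : G.NC) {θ : G.NC} (hθ : normC p θ ≤ 1) :
    ‖pair (incl ξ) θ‖ ≤ dualNormC p ξ := by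
  -- The set has to be bounded, as the real `sSup` of an unbounded set is 0.
  refine le_csSup ⟨sumNorm 0 ξ * 2, ?_⟩ ⟨θ, hθ, rfl⟩
  rintro _ ⟨θ, hθ, rfl⟩
  refine ((dualBound_incl p ξ).norm_pair_le θ).trans
    (mul_le_mul_of_nonneg_left ?_ (sumNorm_nonneg 0 ξ))
  linarith [norm_proj_re_le p θ, norm_proj_im_le p θ]

theorem dualNormC_nonneg (p : ℕ) (ξ : G.NC) : 0 ≤ dualNormC p ξ :=
  Real.sSup_nonneg (by
    rintro _ ⟨θ, -, rfl⟩
    exact norm_nonneg _)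

theorem normC_ofN (p : ℕ) (θ : G.N) : normC p (ofN θ) = ‖G.proj p θ‖ := by
  change √(‖G.proj p θ‖ ^ 2 + ‖G.proj p (0 : G.N)‖ ^ 2) = _
  rw [map_zero, norm_zero, zero_pow two_ne_zero, add_zero, Real.sqrt_sq (norm_nonneg _)]

theorem dualBound_dualNormC (p : ℕ) (ξ : G.NC) : DualBound p (incl ξ) (dualNormC p ξ) := by
  intro θ
  by_cases h0 : ‖G.proj p θ‖ = 0
  · have h2 : θ = 0 := proj_injective p (by rw [norm_eq_zero.1 h0, map_zero])
    simp [h2]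
  · have hpos : 0 < ‖G.proj p θ‖ := lt_of_le_of_ne (norm_nonneg _) (Ne.symm h0)
    have h3 := norm_pair_incl_le_dualNormC p ξ (θ := ofN (‖G.proj p θ‖⁻¹ • θ)) (by
      rw [normC_ofN, map_smul, norm_smul, norm_inv, norm_norm, inv_mul_cancel₀ h0])
    rw [pair_ofN, map_smul, norm_smul, norm_inv, norm_norm, inv_mul_le_iff₀ hpos, mul_comm] at h3
    exact h3

/-! ### The generalized Radon-Nikodym derivative as a functional -/

/-- The `m`-th term `φ ↦ ⟨y^{⊗m} | a_m⟩` of the functional `ρ_μ(-y)`. -/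
noncomputable def rhoTerm (hG : G.IsNuclear) (hm : MomentBound μ pm Sm Km Am) (p q m : ℕ)
    (y : G.DualC) : Hpq μ p q →L[ℂ] ℂ :=
  LinearMap.extendOfNorm (E := G.Poly) (Eₗ := Hpq μ p q)
    ((evalAt fun _ => y) ∘ₗ DirectSum.component ℂ ℕ (fun n => G.Kernel n) m ∘ₗ conv hG hm)
    (toHpq μ p q)

theorem norm_conv_apply_le (hG : G.IsNuclear) (hm : MomentBound μ pm Sm Km Am)
    (hM : 0 < μ.real Set.univ) (p s m : ℕ) {y : G.DualC} {c : ℝ} (hc : 0 ≤ c)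
    (hy : DualBound p y c) (φ : G.Poly) :
    ‖(conv hG hm φ m).1 fun _ => y‖ ≤
      (2 / 2 ^ s * c) ^ m / m.factorial * ‖toHpq μ p (2 * s) φ‖ := by
  rw [norm_toHpq_eq hG hm hM, mul_comm]
  exact (seqBound_weightedNorm p s (conv hG hm φ)).norm_apply_le hc hy m

theorem rhoTerm_toHpq (hG : G.IsNuclear) (hm : MomentBound μ pm Sm Km Am)
    (hM : 0 < μ.real Set.univ) (p s m : ℕ) {y : G.DualC} {c : ℝ} (hc : 0 ≤ c)
    (hy : DualBound p y c) (φ : G.Poly) :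
    rhoTerm hG hm p (2 * s) m y (toHpq μ p (2 * s) φ) = (conv hG hm φ m).1 fun _ => y :=
  LinearMap.extendOfNorm_eq (E := G.Poly) (denseRange_toHpq p (2 * s))
    ⟨_, norm_conv_apply_le hG hm hM p s m hc hy⟩ φ

theorem norm_rhoTerm_le (hG : G.IsNuclear) (hm : MomentBound μ pm Sm Km Am)
    (hM : 0 < μ.real Set.univ) (p s m : ℕ) {y : G.DualC} {c : ℝ} (hc : 0 ≤ c)
    (hy : DualBound p y c) :
    ‖rhoTerm hG hm p (2 * s) m y‖ ≤ (2 / 2 ^ s * c) ^ m / m.factorial :=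
  LinearMap.opNorm_extendOfNorm_le (E := G.Poly) (denseRange_toHpq p (2 * s)) (by positivity)
    (norm_conv_apply_le hG hm hM p s m hc hy)

theorem rhoTerm_add_smul (hG : G.IsNuclear) (hm : MomentBound μ pm Sm Km Am)
    (hM : 0 < μ.real Set.univ) (p s m : ℕ) (ξ w : G.NC) (t : ℂ) :
    rhoTerm hG hm p (2 * s) m (incl (ξ + t • w)) = ∑ j ∈ Finset.range (m + 1),
      (lineWeight m j).eval t • rhoTerm hG hm p (2 * s) m (incl (ξ + (j : ℂ) • w)) := by
  refine ContinuousLinearMap.coeFn_injective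
    ((denseRange_toHpq p (2 * s)).equalizer (ContinuousLinearMap.continuous _)
      (ContinuousLinearMap.continuous _) (funext fun φ => ?_))
  have h1 : ∀ t : ℂ, rhoTerm hG hm p (2 * s) m (incl (ξ + t • w)) (toHpq μ p (2 * s) φ) =
      (conv hG hm φ m).1 fun _ => incl ξ + t • incl w := fun t => by
    rw [rhoTerm_toHpq hG hm hM p s m (sumNorm_nonneg 0 _) (dualBound_incl p _), incl_add,
      incl_smul]
  rw [Function.comp_apply, Function.comp_apply, h1, sum_apply]
  refine (multilinear_diag_add_smul (conv hG hm φ m).1 (incl ξ) (incl w) t).trans ?_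
  refine Finset.sum_congr rfl fun j _ => ?_
  rw [smul_apply, h1, smul_eq_mul]

/-- The functional `ρ_μ(-y)`. -/
noncomputable def rhoFun (hG : G.IsNuclear) (hm : MomentBound μ pm Sm Km Am) (p q : ℕ)
    (y : G.DualC) : Hpq μ p q →L[ℂ] ℂ := ∑' m, rhoTerm hG hm p q m y

theorem summable_rhoTerm (hG : G.IsNuclear) (hm : MomentBound μ pm Sm Km Am)
    (hM : 0 < μ.real Set.univ) (p s : ℕ) {y : G.DualC} {c : ℝ} (hc : 0 ≤ c)
    (hy : DualBound p y c) : Summable fun m => rhoTerm hG hm p (2 * s) m y :=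
  Summable.of_norm_bounded (Real.summable_pow_div_factorial _)
    fun m => norm_rhoTerm_le hG hm hM p s m hc hy

/-- The terms are dominated by an exponential series. Its type 2/2^s tends to 0 as s grows, with p
fixed: this is the source of ε. -/
theorem norm_rhoFun_le (hG : G.IsNuclear) (hm : MomentBound μ pm Sm Km Am)
    (hM : 0 < μ.real Set.univ) (p s : ℕ) {y : G.DualC} {c : ℝ} (hc : 0 ≤ c)
    (hy : DualBound p y c) : ‖rhoFun hG hm p (2 * s) y‖ ≤ Real.exp (2 / 2 ^ s * c) := by
  have h := NormedSpace.expSeries_div_hasSum_exp (2 / 2 ^ s * c)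
  rw [← Real.exp_eq_exp_ℝ] at h
  exact tsum_of_norm_bounded h fun m => norm_rhoTerm_le hG hm hM p s m hc hy

theorem isRho_rhoFun (hG : G.IsNuclear) (hm : MomentBound μ pm Sm Km Am)
    (hM : 0 < μ.real Set.univ) (p s : ℕ) (ξ : G.NC) :
    IsRho μ p (2 * s) (incl (-ξ)) (rhoFun hG hm p (2 * s) (incl ξ)) := by
  intro φ
  have hb := dualBound_incl p ξ
  have h1 := (summable_rhoTerm hG hm hM p s (sumNorm_nonneg 0 ξ) hb).hasSum.mapL
    (ContinuousLinearMap.apply ℂ ℂ (toHpq μ p (2 * s) φ))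
  obtain ⟨t, ht⟩ := exists_support (conv hG hm φ)
  rw [rhoPair_eq hG hm, neg_incl_neg, diagEval_eq_sum _ _ ht]
  refine h1.unique ?_
  have h2 : ∀ m, (ContinuousLinearMap.apply ℂ ℂ (toHpq μ p (2 * s) φ))
      (rhoTerm hG hm p (2 * s) m (incl ξ)) = (conv hG hm φ m).1 fun _ => incl ξ := fun m =>
    rhoTerm_toHpq hG hm hM p s m (sumNorm_nonneg 0 ξ) hb φ
  simp only [h2]
  refine hasSum_sum_of_ne_finset_zero fun m hm' => ?_
  rw [ht m hm']
  rfl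


/-! ### Holomorphic dependence on the parameters -/

theorem differentiable_lineWeight (n j : ℕ) : Differentiable ℂ fun t => (lineWeight n j).eval t :=
  (lineWeight n j).differentiable

/-- By interpolation each term is a polynomial in t with fixed functionals as coefficients, and the
series converges uniformly in operator norm on the ball of radius ‖t₀‖ + 1. -/
theorem differentiable_rhoFun (hG : G.IsNuclear) (hm : MomentBound μ pm Sm Km Am)
    (hM : 0 < μ.real Set.univ) (p s : ℕ) (ξ w : G.NC) :
    Differentiable ℂ fun t : ℂ => rhoFun hG hm p (2 * s) (incl (ξ + t • w)) := by
  intro t₀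
  have hw := sumNorm_nonneg 0 w
  have hξ := sumNorm_nonneg 0 ξ
  have hb : ∀ t ∈ Metric.ball (0 : ℂ) (‖t₀‖ + 1), DualBound p (incl (ξ + t • w))
      (sumNorm 0 ξ + (‖t₀‖ + 1) * sumNorm 0 w) := by
    intro t ht
    rw [incl_add, incl_smul]
    refine ((dualBound_incl p ξ).add ((dualBound_incl p w).smul t)).mono le_rfl
      (by positivity) ?_
    have : ‖t‖ ≤ ‖t₀‖ + 1 := (mem_ball_zero_iff.1 ht).le
    gcongr
  have h1 := Complex.differentiableOn_tsum_of_summable_norm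
    (F := fun m t => rhoTerm hG hm p (2 * s) m (incl (ξ + t • w)))
    (Real.summable_pow_div_factorial (2 / 2 ^ s * (sumNorm 0 ξ + (‖t₀‖ + 1) * sumNorm 0 w)))
    (fun m => (Differentiable.fun_sum fun j _ =>
      (differentiable_lineWeight m j).smul_const _).differentiableOn.congr
        fun t _ => rhoTerm_add_smul hG hm hM p s m ξ w t)
    (Metric.isOpen_ball (x := (0 : ℂ)) (ε := ‖t₀‖ + 1))
    fun m t ht => norm_rhoTerm_le hG hm hM p s m (by positivity) (hb t ht)
  exact h1.differentiableAt (Metric.isOpen_ball.mem_nhds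
    (mem_ball_zero_iff.2 (lt_add_one ‖t₀‖)))

/-- The normalized exponential `e_ν(η; ·)` as an element of `(H_{p,q,ν})`. -/
noncomputable def expSum (hG : G.IsNuclear) (hn : MomentBound ν pn Sn Kn An)
    (hN : 0 < ν.real Set.univ) (p q : ℕ) (η : G.NC) : Hpq ν p q :=
  ∑' n, toHpq ν p q (expTerm hG hn hN n η)

theorem expTerm_add_smul (hG : G.IsNuclear) (hn : MomentBound ν pn Sn Kn An)
    (hN : 0 < ν.real Set.univ) (n : ℕ) (η v : G.NC) (t : ℂ) :
    expTerm hG hn hN n (η + t • v) = ∑ j ∈ Finset.range (n + 1),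
      (lineWeight n j).eval t • expTerm hG hn hN n (η + (j : ℂ) • v) := by
  unfold expTerm
  rw [tensorPow_add_smul, map_sum, map_sum, Finset.smul_sum]
  refine Finset.sum_congr rfl fun j _ => ?_
  rw [map_smul, map_smul]
  exact smul_comm _ _ _

/-- The zero neighbourhood `|η|_p² < 2^{-q-1}`. -/
def expDomain (G : HilbertChain.{u}) (p q : ℕ) : Set G.NC :=
  {η | normC p η ^ 2 < (2 ^ (q + 1) : ℝ)⁻¹}

theorem isOpen_expDomain (p q : ℕ) : IsOpen (expDomain G p q) :=
  isOpen_lt ((continuous_normC p).pow 2) continuous_const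

theorem isOpen_line_expDomain (p q : ℕ) (η v : G.NC) :
    IsOpen {t : ℂ | η + t • v ∈ expDomain G p q} :=
  (isOpen_expDomain p q).preimage (continuous_line η v)

theorem differentiableOn_expSum (hG : G.IsNuclear) (hn : MomentBound ν pn Sn Kn An)
    (hN : 0 < ν.real Set.univ) (p q : ℕ) (η v : G.NC) :
    DifferentiableOn ℂ (fun t : ℂ => expSum hG hn hN p q (η + t • v))
      {t | η + t • v ∈ expDomain G p q} := by
  refine Complex.differentiableOn_tsum_of_summable_norm
    (summable_geometric_of_lt_one (Real.sqrt_nonneg _) sqrt_half_lt_one) (fun n => ?_)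
    (isOpen_line_expDomain p q η v)
    fun n t ht => norm_toHpq_expTerm_le_of_lt hG hn hN (η := η + t • v) ht n
  refine (Differentiable.fun_sum (u := Finset.range (n + 1)) fun j _ =>
    (differentiable_lineWeight n j).smul_const
      (toHpq ν p q (expTerm hG hn hN n (η + (j : ℂ) • v)))).differentiableOn.congr fun t _ => ?_
  rw [expTerm_add_smul hG hn hN n η v t, map_sum]
  exact Finset.sum_congr rfl fun j _ => map_smul _ _ _

/-- The pairing `⟨⟨ρ_μ(-ξ) | B e_ν(η; ·)⟩⟩_μ`. -/
noncomputable def symbolFun (hG : G.IsNuclear) (hm : MomentBound μ pm Sm Km Am)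
    (hn : MomentBound ν pn Sn Kn An) (hN : 0 < ν.real Set.univ) {p₀ q₀ p q : ℕ}
    (B : Hpq ν p q →L[ℂ] Hpq μ p₀ q₀) (z : G.NC × G.NC) : ℂ :=
  rhoFun hG hm p₀ q₀ (incl z.1) (B (expSum hG hn hN p q z.2))

theorem differentiableOn_symbolFun (hG : G.IsNuclear) (hm : MomentBound μ pm Sm Km Am)
    (hM : 0 < μ.real Set.univ) (hn : MomentBound ν pn Sn Kn An) (hN : 0 < ν.real Set.univ)
    {p₀ s p q : ℕ} (B : Hpq ν p q →L[ℂ] Hpq μ p₀ (2 * s)) (z w : G.NC × G.NC) :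
    DifferentiableOn ℂ (fun t : ℂ => symbolFun hG hm hn hN B (z + t • w))
      {t | z.2 + t • w.2 ∈ expDomain G p q} :=
  (differentiable_rhoFun hG hm hM p₀ s z.1 w.1).differentiableOn.clm_apply
    (B.differentiable.comp_differentiableOn (differentiableOn_expSum hG hn hN p q z.2 w.2))

theorem norm_symbolFun_le (hG : G.IsNuclear) (hm : MomentBound μ pm Sm Km Am)
    (hM : 0 < μ.real Set.univ) (hn : MomentBound ν pn Sn Kn An) (hN : 0 < ν.real Set.univ)
    {p₀ s p q : ℕ} (B : Hpq ν p q →L[ℂ] Hpq μ p₀ (2 * s)) {z : G.NC × G.NC} {c : ℝ} (hc : 0 ≤ c)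
    (hz₁ : DualBound p₀ (incl z.1) c) (hz₂ : z.2 ∈ expDomain G p q) :
    ‖symbolFun hG hm hn hN B z‖ ≤ ‖B‖ * (1 - √(1 / 2))⁻¹ * Real.exp (2 / 2 ^ s * c) := by
  refine (ContinuousLinearMap.le_opNorm _ _).trans ?_
  rw [mul_comm]
  refine mul_le_mul ?_ (norm_rhoFun_le hG hm hM p₀ s hc hz₁) (norm_nonneg _)
    (mul_nonneg (norm_nonneg _) (inv_nonneg.2 (sub_nonneg.2 sqrt_half_lt_one.le)))
  exact (B.le_opNorm _).trans
    (mul_le_mul_of_nonneg_left (norm_tsum_expTerm_le hG hn hN hz₂) (norm_nonneg _))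

/-- A locally bounded function that is holomorphic along complex lines is continuous. -/
theorem continuousAt_of_bounded_of_differentiableOn_lines {E : Type*} [AddCommGroup E] [Module ℂ E]
    [TopologicalSpace E] {f : E → ℂ} {z₀ : E} {σ : E → ℝ}
    (hσ : ∀ τ > 0, ∀ᶠ z in 𝓝 z₀, σ (z - z₀) < τ) (hσt : ∀ (t : ℂ) z, σ (t • z) ≤ 2 * ‖t‖ * σ z)
    {δ M : ℝ} (hδ : 0 < δ) (hM : ∀ z, σ z < δ → ‖f (z₀ + z)‖ ≤ M)
    (hdiff : ∀ z, DifferentiableOn ℂ (fun t : ℂ => f (z₀ + t • z)) {t | σ (t • z) < δ}) :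
    ContinuousAt f z₀ := by
  rw [ContinuousAt, Metric.tendsto_nhds]
  intro e he
  -- The first condition puts t = 1 into the disc of radius δ/(2τ); the second makes the Schwarz
  -- bound 2|M| · 2τ/δ smaller than e.
  have hτ : ∃ τ > 0, 2 * τ < δ ∧ 2 * |M| * (2 * τ) < e * δ := by
    refine ⟨min (δ / 4) (e * δ / (8 * (|M| + 1))), by positivity, ?_, ?_⟩
    · linarith [min_le_left (δ / 4) (e * δ / (8 * (|M| + 1)))]
    · have h := min_le_right (δ / 4) (e * δ / (8 * (|M| + 1)))
      rw [le_div_iff₀ (by positivity)] at h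
      have h' : 0 < min (δ / 4) (e * δ / (8 * (|M| + 1))) := by positivity
      nlinarith [mul_pos he hδ, abs_nonneg M]
  obtain ⟨τ, hτ0, hτ1, hτ2⟩ := hτ
  filter_upwards [hσ τ hτ0] with z hz
  have hline : ∀ t ∈ Metric.ball (0 : ℂ) (δ / (2 * τ)), σ (t • (z - z₀)) < δ := by
    intro t ht
    have h1 := mem_ball_zero_iff.1 ht
    rw [lt_div_iff₀ (by positivity)] at h1
    refine (hσt t (z - z₀)).trans_lt (lt_of_le_of_lt ?_ h1)
    calc 2 * ‖t‖ * σ (z - z₀) ≤ 2 * ‖t‖ * τ := by gcongr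
      _ = _ := by ring
  have h0 : (0 : ℂ) ∈ Metric.ball (0 : ℂ) (δ / (2 * τ)) := Metric.mem_ball_self (by positivity)
  have h1 : (1 : ℂ) ∈ Metric.ball (0 : ℂ) (δ / (2 * τ)) := by
    rw [mem_ball_zero_iff, norm_one, lt_div_iff₀ (by positivity)]
    linarith
  have hmaps : Set.MapsTo (fun t : ℂ => f (z₀ + t • (z - z₀))) (Metric.ball 0 (δ / (2 * τ)))
      (Metric.closedBall (f (z₀ + (0 : ℂ) • (z - z₀))) (2 * |M|)) := by
    intro t ht
    rw [Metric.mem_closedBall, dist_eq_norm]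
    refine (norm_sub_le _ _).trans ?_
    have h2 := (hM _ (hline t ht)).trans (le_abs_self M)
    have h3 := (hM _ (hline 0 h0)).trans (le_abs_self M)
    linarith
  -- Schwarz lemma on the line from z₀ through z, evaluated at t = 1.
  have h4 := Complex.dist_le_div_mul_dist_of_mapsTo_ball
    ((hdiff (z - z₀)).mono fun t ht => hline t ht) hmaps h1
  simp only [one_smul, zero_smul, add_zero, add_sub_cancel, dist_zero_right, norm_one,
    mul_one] at h4
  refine h4.trans_lt ?_
  rw [div_lt_iff₀ (by positivity)]
  have h5 : e * (δ / (2 * τ)) = e * δ / (2 * τ) := by ring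
  rw [h5, lt_div_iff₀ (by positivity)]
  exact hτ2

/-- Here σ measures ξ by the norm of H and η by the norms of H_p; δ is the gap between |z₀.2|_p and
the radius of the domain. -/
theorem continuousAt_symbolFun (hG : G.IsNuclear) (hm : MomentBound μ pm Sm Km Am)
    (hM : 0 < μ.real Set.univ) (hn : MomentBound ν pn Sn Kn An) (hN : 0 < ν.real Set.univ)
    {p₀ s p q : ℕ} (B : Hpq ν p q →L[ℂ] Hpq μ p₀ (2 * s)) {z₀ : G.NC × G.NC}
    (hz₀ : z₀.2 ∈ expDomain G p q) : ContinuousAt (symbolFun hG hm hn hN B) z₀ := by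
  have hn0 : 0 ≤ normC p z₀.2 := Real.sqrt_nonneg _
  have hκ : normC p z₀.2 < √(2 ^ (q + 1) : ℝ)⁻¹ := (Real.lt_sqrt hn0).2 hz₀
  have hdom : ∀ v : G.NC, sumNorm p v < √(2 ^ (q + 1) : ℝ)⁻¹ - normC p z₀.2 →
      z₀.2 + v ∈ expDomain G p q := by
    intro v hv
    refine (Real.lt_sqrt (Real.sqrt_nonneg _)).1 ((normC_add_le p z₀.2 v).trans_lt ?_)
    linarith
  refine continuousAt_of_bounded_of_differentiableOn_lines
    (σ := fun z : G.NC × G.NC => sumNorm 0 z.1 + sumNorm p z.2)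
    (δ := √(2 ^ (q + 1) : ℝ)⁻¹ - normC p z₀.2)
    (M := ‖B‖ * (1 - √(1 / 2))⁻¹ * Real.exp (2 / 2 ^ s *
      (sumNorm 0 z₀.1 + (√(2 ^ (q + 1) : ℝ)⁻¹ - normC p z₀.2)))) ?_ ?_ (sub_pos.2 hκ) ?_ ?_
  · intro τ hτ
    have h1 : Continuous fun z : G.NC × G.NC =>
        ‖G.proj 0 z.1.re - G.proj 0 z₀.1.re‖ + ‖G.proj 0 z.1.im - G.proj 0 z₀.1.im‖ +
        (‖G.proj p z.2.re - G.proj p z₀.2.re‖ + ‖G.proj p z.2.im - G.proj p z₀.2.im‖) := by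
      have hr1 := continuous_re.comp (continuous_fst (X := G.NC) (Y := G.NC))
      have hr2 := continuous_re.comp (continuous_snd (X := G.NC) (Y := G.NC))
      have hi1 := continuous_im.comp (continuous_fst (X := G.NC) (Y := G.NC))
      have hi2 := continuous_im.comp (continuous_snd (X := G.NC) (Y := G.NC))
      exact ((((G.proj 0).continuous.comp hr1).sub continuous_const).norm.add
        (((G.proj 0).continuous.comp hi1).sub continuous_const).norm).add
        ((((G.proj p).continuous.comp hr2).sub continuous_const).norm.add
        (((G.proj p).continuous.comp hi2).sub continuous_const).norm)
    have h2 := h1.continuousAt (x := z₀) |>.eventually_lt (continuousAt_const (y := τ)) (by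
      simpa using hτ)
    filter_upwards [h2] with z hz
    have h3 : ∀ (p : ℕ) (a b : G.NC), sumNorm p (a - b) =
        ‖G.proj p a.re - G.proj p b.re‖ + ‖G.proj p a.im - G.proj p b.im‖ := fun p a b => by
      rw [← map_sub, ← map_sub]
      rfl
    change sumNorm 0 (z.1 - z₀.1) + sumNorm p (z.2 - z₀.2) < τ
    rw [h3, h3]
    exact hz
  · intro t z
    change sumNorm 0 (t • z.1) + sumNorm p (t • z.2) ≤ _
    rw [mul_add]
    exact add_le_add (sumNorm_smul_le 0 t z.1) (sumNorm_smul_le p t z.2)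
  · intro z hz
    have h1 := sumNorm_nonneg 0 z.1
    have h2 := sumNorm_nonneg p z.2
    have h3 := sumNorm_nonneg 0 z₀.1
    refine norm_symbolFun_le hG hm hM hn hN B (add_nonneg h3 (sub_pos.2 hκ).le) ?_
      (hdom z.2 (by linarith))
    change DualBound p₀ (incl (z₀.1 + z.1)) _
    rw [incl_add]
    exact ((dualBound_incl p₀ z₀.1).add (dualBound_incl p₀ z.1)).mono le_rfl
      (add_nonneg h3 h1) (by linarith)
  · intro z
    refine (differentiableOn_symbolFun hG hm hM hn hN B z₀ z).mono fun t ht => hdom _ ?_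
    have h1 := sumNorm_nonneg 0 (t • z).1
    have h2 : sumNorm 0 (t • z).1 + sumNorm p (t • z).2 <
      √(2 ^ (q + 1) : ℝ)⁻¹ - normC p z₀.2 := ht
    change sumNorm p (t • z).2 < _
    linarith

theorem isSymbolValue_symbolFun (hG : G.IsNuclear) (hm : MomentBound μ pm Sm Km Am)
    (hM : 0 < μ.real Set.univ) (hn : MomentBound ν pn Sn Kn An) (hN : 0 < ν.real Set.univ)
    {B : TestSpace μ →L[ℂ] TestSpace μ} {p₀ s p q : ℕ} {B' : Hpq ν p q →L[ℂ] Hpq μ p₀ (2 * s)}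
    (hB' : IsExtension μ ν B p q p₀ (2 * s) B') (ξ : G.NC) {η : G.NC}
    (hη : η ∈ expDomain G p q) :
    IsSymbolValue μ ν B ξ η (symbolFun hG hm hn hN B' (ξ, η)) :=
  ⟨p₀, 2 * s, p, q, B', _, _, hB', hη, isNormExp_tsum hG hn hN hη, isRho_rhoFun hG hm hM p₀ s ξ,
    rfl⟩

theorem IsSymbolValue.csSymbol_eq {B : TestSpace μ →L[ℂ] TestSpace μ} {ξ η : G.NC} {z : ℂ}
    (h : IsSymbolValue μ ν B ξ η z) : csSymbol μ ν B ξ η = z := by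
  have h' : ∃ z, IsSymbolValue μ ν B ξ η z := ⟨z, h⟩
  rw [csSymbol, dif_pos h']
  exact h'.choose_spec.unique h

theorem HolomorphicOn.of_differentiableOn_lines {f g : G.NC × G.NC → ℂ} {U : Set G.NC}
    (hU : IsOpen U) (hfg : ∀ z : G.NC × G.NC, z.2 ∈ U → f z = g z)
    (hdiff : ∀ z w : G.NC × G.NC, DifferentiableOn ℂ (fun t : ℂ => g (z + t • w))
      {t | z.2 + t • w.2 ∈ U}) (hcont : ∀ z : G.NC × G.NC, z.2 ∈ U → ContinuousAt g z) :
    HolomorphicOn f (Set.univ ×ˢ U) := by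
  refine ⟨isOpen_univ.prod hU, fun z hz w => ?_, fun z hz => ?_⟩
  · have hopen : IsOpen {t : ℂ | z.2 + t • w.2 ∈ U} := hU.preimage (continuous_line z.2 w.2)
    have h0 : (0 : ℂ) ∈ {t : ℂ | z.2 + t • w.2 ∈ U} := by
      have h1 : z.2 + (0 : ℂ) • w.2 = z.2 := by
        have h : (0 : ℂ) • w.2 = 0 := zero_smul ℂ w.2
        rw [h, add_zero]
      change z.2 + (0 : ℂ) • w.2 ∈ U
      rw [h1]
      exact hz.2
    refine ((hdiff z w).analyticAt (hopen.mem_nhds h0)).congr ?_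
    filter_upwards [hopen.mem_nhds h0] with t ht
    exact (hfg (z + t • w) ht).symm
  · exact (hcont z hz.2).continuousWithinAt.congr (fun y hy => hfg y hy.2) (hfg z hz.2)

end AppellCS.HilbertChain

theorem mainTheorem1 (G : HilbertChain.{u}) (hG : G.IsNuclear) (μ ν : MeasureTheory.Measure G.Dual)
    (hμ : AnalyticLaplace μ) (hμ' : NonDegenerate μ)
    (hν : AnalyticLaplace ν) (hν' : NonDegenerate ν)
    (B : TestSpace μ →L[ℂ] TestSpace μ) (p₀ : ℕ) (ε : ℝ) (hε : 0 < ε) :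
    ∃ C : ℝ, 0 < C ∧ ∃ U : Set G.NC, IsOpen U ∧ 0 ∈ U ∧
      (∀ ξ : G.NC, ∀ η ∈ U, ∃! z : ℂ, IsSymbolValue μ ν B ξ η z) ∧
      HolomorphicOn (fun z : G.NC × G.NC => csSymbol μ ν B z.1 z.2) (Set.univ ×ˢ U) ∧
      ∀ ξ : G.NC, ∀ η ∈ U, ‖csSymbol μ ν B ξ η‖ ≤ C * Real.exp (ε * dualNormC p₀ ξ) := by
  have := hμ.isFiniteMeasure
  have := hν.isFiniteMeasure
  obtain ⟨pm, Sm, Km, Am, hm⟩ := hG.exists_momentBound hμ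
  obtain ⟨pn, Sn, Kn, An, hn⟩ := hG.exists_momentBound hν
  have hM := hμ'.real_univ_pos
  have hN := hν'.real_univ_pos
  -- The weight of the target space is fixed by ε first; only then is the source space of the
  -- extension of B found, and with it U.
  obtain ⟨s, hs⟩ := exists_two_div_pow_le hε
  obtain ⟨p, q, B', hB'⟩ := exists_isExtension hG hm hM hn hN B p₀ (2 * s)
  have hval : ∀ ξ : G.NC, ∀ η ∈ expDomain G p q,
      IsSymbolValue μ ν B ξ η (symbolFun hG hm hn hN B' (ξ, η)) :=
    fun ξ η hη => isSymbolValue_symbolFun hG hm hM hn hN hB' ξ hη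
  have hC : 0 ≤ ‖B'‖ * (1 - √(1 / 2))⁻¹ :=
    mul_nonneg (norm_nonneg _) (inv_nonneg.2 (sub_nonneg.2 sqrt_half_lt_one.le))
  -- The added 1 makes the constant positive even if B' = 0.
  refine ⟨‖B'‖ * (1 - √(1 / 2))⁻¹ + 1, by positivity, expDomain G p q, isOpen_expDomain p q,
    ?_, fun ξ η hη => ⟨_, hval ξ η hη, fun z hz => hz.unique (hval ξ η hη)⟩, ?_, ?_⟩
  · have h0 : normC p (0 : G.NC) = 0 := by
      have h := normC_ofN p (0 : G.N)
      rw [map_zero, norm_zero] at h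
      exact h
    change normC p (0 : G.NC) ^ 2 < _
    rw [h0, zero_pow two_ne_zero]
    positivity
  · exact HolomorphicOn.of_differentiableOn_lines (g := symbolFun hG hm hn hN B')
      (isOpen_expDomain p q) (fun z hz => (hval z.1 z.2 hz).csSymbol_eq)
      (differentiableOn_symbolFun hG hm hM hn hN B')
      fun z hz => continuousAt_symbolFun hG hm hM hn hN B' hz
  · intro ξ η hη
    rw [(hval ξ η hη).csSymbol_eq]
    refine (norm_symbolFun_le hG hm hM hn hN B' (z := (ξ, η)) (dualNormC_nonneg p₀ ξ)
      (dualBound_dualNormC p₀ ξ) hη).trans ?_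
    have h1 : 2 / 2 ^ s * dualNormC p₀ ξ ≤ ε * dualNormC p₀ ξ :=
      mul_le_mul_of_nonneg_right (hs s le_rfl) (dualNormC_nonneg p₀ ξ)
    gcongr
    exact le_add_of_nonneg_right zero_le_one
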